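/- For a full-rank lattice $\mathcal L\subseteq\mathbb Z^d$ let $\mathcal L^*\supseteq\mathbb Z^d$ be its dual, and for $\mathbf w\in\mathbb R^d$ and a coset $\mathbf v\in\mathcal L^*/\mathbb Z^d$ let $\mathrm{dist}(\mathbf w,\mathbf v)$ be the distance in $\mathbb R^d/\mathbb Z^d$. **Setting.** Let $m=m_1+m_2$ with $m_1\ge d+4$, and let $\mathcal L\subseteq\mathbb Z^d$ be a $d$-dimensional lattice with $\det\mathcal L<2^{d^2}$. Let $C$ be a real number and put $\delta=2^{-Cd}\sqrt d/2$ and $S=\delta^{-1}$. Rational vectors $\mathbf w_1,\dots,\mathbf w_m\in\mathbb Q^d$ (for instance with entries in $[0,1)$) are produced by $m$ runs. In $m_1$ of the runs (the good ones) $\mathrm{dist}(\mathbf w_i,\mathbf v_i)\le\delta$ almost surely, where the $\mathbf v_i$ are independent uniformly distributed elements of $\mathcal L^*/\mathbb Z^d$. In the other $m_2$ runs (the bad ones) the $\mathbf w_i$ are sampled independently of each other, and of the $\mathbf v_i$, from an arbitrary probability distribution $\mathcal F$ on $\mathbb Q^d$. Which runs are bad is arbitrary and not known. **Assumption** (with parameters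 $F>0$ and $p$). Let $\mathbf B$ be a matrix whose rows form a basis of $\mathcal L$, and let $\mathbf F$ be a $d\times m_2$ matrix whose columns are sampled independently from $\mathcal F$. Then with probability (at least) $p$ the lattice $\Lambda\subset\mathbb R^{d+m_2}$ generated by the rows of $$\begin{pmatrix}\mathbf B & S\,\mathbf B\mathbf F\\ \mathbf 0 & S\,\mathbf I_{m_2}\end{pmatrix}$$ has a basis in which every vector whose first $d$ coordinates are not all zero is shorter than $$T=F\sqrt{m_2+d}\;S^{m_2/(m_2+d)}(\det\mathcal L)^{1/(m_2+d)}.$$ **Theorem.** There is a deterministic polynomial-time algorithm which, given $d$, $m$, $\lfloor S\rfloor$ and $\mathbf w_1,\dots,\mathbf w_m$, outputs a $d\times d$ integer matrix, and which has the following property. For every constant $F>0$ there is an error term $\eta(d,m)$, tending to $0$ as $d\to\infty$ with $m=O(d)$, such that for all data as in the setting with $$C>\Bigl(\frac52+\frac m{2d}\Bigr)\Bigl(1+\frac{m_2}d\Bigr)+\eta(d,m),$$ if the assumption holds with parameters $F$ and $p$, then with probability at least $p/4$ over the choice of the $\mathbf w_i$ the rows of the output matrix are a basis of $\mathcal L$.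 Here polynomial time means that the algorithm runs on a random access machine with integer words, every operation being charged the bit lengths of its operands (their product for multiplication and division), and that on every input its total cost is bounded by a fixed polynomial in the length of the input: the sum of $d$, $m$ and the bit lengths of $\lfloor S\rfloor$ and of the numerators and denominators of the entries of the $\mathbf w_i$. -/

import Mathlib

open MeasureTheory

/-! ### Machine model: a random access machine with integer words and logarithmic cost

The memory consists of countably many arrays of integers.  Programs are structured (sequences,
conditionals, while loops) and arrays are accessed with computed indices.  Every step is charged
the bit lengths of the numbers it handles; multiplication and division are charged the product of
the bit lengths of the operands. -/

namespace RAM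

/-- `σ a k` is the content of cell `k` of array `a`. -/
abbrev Mem : Type := ℕ → ℕ → ℤ

/-- Bit length of an integer, including a sign bit. -/
def bits (z : ℤ) : ℕ := Nat.size z.natAbs + 1

inductive Expr : Type
  | const (z : ℤ) : Expr
  | get (a : ℕ) (index : Expr) : Expr
  | add (x y : Expr) : Expr
  | sub (x y : Expr) : Expr
  | mul (x y : Expr) : Expr
  | div (x y : Expr) : Expr

namespace Expr

/-- Value of an expression.  A negative index is read as index `0`; `div` is the Euclidean
quotient of integers, with quotient `0` if the divisor is `0`. -/
def eval (σ : Mem) : Expr → ℤ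
  | const z => z
  | get a i => σ a (i.eval σ).toNat
  | add x y => x.eval σ + y.eval σ
  | sub x y => x.eval σ - y.eval σ
  | mul x y => x.eval σ * y.eval σ
  | div x y => x.eval σ / y.eval σ

/-- Number of bit operations charged for evaluating an expression. -/
def cost (σ : Mem) : Expr → ℕ
  | const z => bits z
  | get a i => i.cost σ + bits (i.eval σ) + bits (σ a (i.eval σ).toNat)
  | add x y => x.cost σ + y.cost σ + bits (x.eval σ) + bits (y.eval σ)
  | sub x y => x.cost σ + y.cost σ + bits (x.eval σ) + bits (y.eval σ)
  | mul x y => x.cost σ + y.cost σ + bits (x.eval σ) * bits (y.eval σ)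
  | div x y => x.cost σ + y.cost σ + bits (x.eval σ) * bits (y.eval σ)

end Expr

inductive Prog : Type
  | skip : Prog
  | set (a : ℕ) (index value : Expr) : Prog
  | seq (p q : Prog) : Prog
  | ifPos (e : Expr) (p q : Prog) : Prog
  | whilePos (e : Expr) (p : Prog) : Prog

/-- The memory after `v` has been written to cell `k` of array `a`. -/
def Mem.write (σ : Mem) (a k : ℕ) (v : ℤ) : Mem :=
  fun a' k' => if a' = a ∧ k' = k then v else σ a' k'

/-- `Exec p σ t τ`: started in memory `σ`, the program `p` halts in memory `τ` after exactly `t`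
(bit) steps.  The conditions of `ifPos` and `whilePos` hold when the expression is positive. -/
inductive Exec : Prog → Mem → ℕ → Mem → Prop
  | skip (σ : Mem) : Exec .skip σ 1 σ
  | set (a : ℕ) (i e : Expr) (σ : Mem) :
      Exec (.set a i e) σ (1 + i.cost σ + e.cost σ + bits (i.eval σ) + bits (e.eval σ))
        (σ.write a (i.eval σ).toNat (e.eval σ))
  | seq {p q : Prog} {σ τ υ : Mem} {s t : ℕ} :
      Exec p σ s τ → Exec q τ t υ → Exec (.seq p q) σ (1 + s + t) υ
  | if_true {e : Expr} {p q : Prog} {σ τ : Mem} {t : ℕ} :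
      0 < e.eval σ → Exec p σ t τ → Exec (.ifPos e p q) σ (1 + e.cost σ + t) τ
  | if_false {e : Expr} {p q : Prog} {σ τ : Mem} {t : ℕ} :
      ¬ 0 < e.eval σ → Exec q σ t τ → Exec (.ifPos e p q) σ (1 + e.cost σ + t) τ
  | while_true {e : Expr} {p : Prog} {σ τ υ : Mem} {s t : ℕ} :
      0 < e.eval σ → Exec p σ s τ → Exec (.whilePos e p) τ t υ →
        Exec (.whilePos e p) σ (1 + e.cost σ + s + t) υ
  | while_false {e : Expr} {p : Prog} {σ : Mem} :
      ¬ 0 < e.eval σ → Exec (.whilePos e p) σ (1 + e.cost σ) σ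

end RAM

/-! ### Inputs and outputs of the post-processing, and polynomial time -/

namespace PostProcess

open RAM

/-- Input of the post-processing: the dimension `d`, the number `m` of runs, the integer part of
the scaling parameter, and the `m` vectors produced by the runs. -/
structure Input : Type where
  d : ℕ
  m : ℕ
  scale : ℕ
  w : Fin m → Fin d → ℚ

/-- Bit length of an input (with `d` and `m` counted in unary). -/
def Input.size (x : Input) : ℕ :=
  x.d + x.m + bits x.scale + ∑ i, ∑ j, (bits (x.w i j).num + bits (x.w i j).den)

/-- Row-major layout of a matrix with `n` columns in an array, with zeros behind it. -/
def flatten {k n : ℕ} (M : Fin k → Fin n → ℤ) : ℕ → ℤ :=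
  fun c => if h : c / n < k ∧ c % n < n then M ⟨c / n, h.1⟩ ⟨c % n, h.2⟩ else 0

/-- Initial memory: array `0` holds `d, m, scale`, array `1` the numerators and array `2` the
denominators of the vectors (in lowest terms), and everything else is zero. -/
def Input.load (x : Input) : Mem := fun a c =>
  if a = 0 then (if c = 0 then (x.d : ℤ) else if c = 1 then (x.m : ℤ)
    else if c = 2 then (x.scale : ℤ) else 0)
  else if a = 1 then flatten (fun i j => (x.w i j).num) c
  else if a = 2 then flatten (fun i j => ((x.w i j).den : ℤ)) c
  else 0

/-- `A` is computed by a program whose running time on every input is at most a fixed polynomial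
in the bit length of the input.  The output, a `d × d` integer matrix, is left in array `3` in
row-major order. -/
def PolyTime (A : (x : Input) → Matrix (Fin x.d) (Fin x.d) ℤ) : Prop :=
  ∃ (prog : Prog) (P : Polynomial ℕ), ∀ x : Input, ∃ (t : ℕ) (τ : Mem),
    Exec prog x.load t τ ∧ t ≤ P.eval x.size ∧
      ∀ i j : Fin x.d, τ 3 (x.d * i.val + j.val) = A x i j

/-! ### Lattices -/

/-- `ℝ^d` with the Euclidean norm. -/
abbrev E (d : ℕ) : Type := EuclideanSpace ℝ (Fin d)

/-- The lattice `ℤ^d` in `ℝ^d`. -/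
def intLattice (d : ℕ) : Submodule ℤ (E d) :=
  Submodule.span ℤ (Set.range (EuclideanSpace.basisFun (Fin d) ℝ))

/-- A rational vector as a vector of `ℝ^d`. -/
noncomputable def ratVec {d : ℕ} (w : Fin d → ℚ) : E d := WithLp.toLp 2 fun i => (w i : ℝ)

/-- An integer vector as a vector of `ℝ^d`. -/
noncomputable def intVec {d : ℕ} (z : Fin d → ℤ) : E d := WithLp.toLp 2 fun i => (z i : ℝ)

/-- The rows of the integer matrix `M` are a basis of the lattice `L`. -/
def IsBasisOf {d : ℕ} (L : Submodule ℤ (E d)) (M : Matrix (Fin d) (Fin d) ℤ) : Prop :=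
  LinearIndependent ℤ (fun i => intVec (M i)) ∧
    Submodule.span ℤ (Set.range fun i => intVec (M i)) = L

/-- The dual lattice `L^*`: all `y` with `⟪y, x⟫ ∈ ℤ` for every `x ∈ L`. -/
noncomputable def dualLattice {d : ℕ} (L : Submodule ℤ (E d)) : Submodule ℤ (E d) :=
  LinearMap.BilinForm.dualSubmodule (innerₗ (E d)) L

/-- The group `L^* / ℤ^d`. -/
def DualQuotient {d : ℕ} (L : Submodule ℤ (E d)) : Type :=
  ↥(dualLattice L) ⧸ (intLattice d).submoduleOf (dualLattice L)

/-- All sets of cosets are measurable (`L^* / ℤ^d` is finite when `L` is a full-rank sublattice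
of `ℤ^d`). -/
instance {d : ℕ} (L : Submodule ℤ (E d)) : MeasurableSpace (DualQuotient L) := ⊤

/-- A coset in `L^* / ℤ^d`, as a subset of `ℝ^d`. -/
def DualQuotient.toSet {d : ℕ} {L : Submodule ℤ (E d)} (v : DualQuotient L) : Set (E d) :=
  {y | ∃ h : y ∈ dualLattice L, (Submodule.Quotient.mk ⟨y, h⟩ : ↥(dualLattice L) ⧸ _) = v}

/-- Distance in `ℝ^d / ℤ^d` between the class of `x` and the coset `v`. -/
noncomputable def torusDist {d : ℕ} {L : Submodule ℤ (E d)} (x : E d) (v : DualQuotient L) : ℝ :=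
  Metric.infDist x v.toSet

/-- The lattice `Λ` generated by the rows of the block matrix
`(B | S • B * F) / (0 | S • I)`, where the rows of `B` are the vectors `B k` and the columns of
`F` are the vectors `F j`. -/
noncomputable def errorLattice {d n : ℕ} (B : Fin d → E d) (S : ℝ) (F : Fin n → Fin d → ℚ) :
    Submodule ℤ (EuclideanSpace ℝ (Fin d ⊕ Fin n)) :=
  Submodule.span ℤ (Set.range (Sum.elim
    (fun k : Fin d => (WithLp.toLp 2 (Sum.elim (fun i => B k i)
      (fun j => S * inner ℝ (B k) (ratVec (F j)))) : EuclideanSpace ℝ (Fin d ⊕ Fin n)))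
    (fun j : Fin n => EuclideanSpace.single (Sum.inr j) S)))

/-- `Λ` has a basis in which every vector whose first `d` coordinates are not all zero is
shorter than `T`. -/
def HasShortBasis {d n : ℕ} (Λ : Submodule ℤ (EuclideanSpace ℝ (Fin d ⊕ Fin n))) (T : ℝ) : Prop :=
  ∃ b : Module.Basis (Fin d ⊕ Fin n) ℤ Λ, ∀ r,
    (∃ i : Fin d, (b r : EuclideanSpace ℝ (Fin d ⊕ Fin n)) (Sum.inl i) ≠ 0) →
      ‖(b r : EuclideanSpace ℝ (Fin d ⊕ Fin n))‖ < T

/-- The heuristic assumption on the lattice `L` (with basis `B`) and the distribution `𝓕` of the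
output of bad runs: if the columns of the `d × m₂` matrix `F` are sampled independently from `𝓕`,
then with probability (at least) `p` the lattice `Λ` has a basis in which every vector with non-zero
values in its first `d` coordinates is shorter than
`T = K √(m₂ + d) S^(m₂ / (m₂ + d)) (det L)^(1 / (m₂ + d))`. -/
def ErrorBasisAssumption {d : ℕ} (L : Submodule ℤ (E d)) (B : Module.Basis (Fin d) ℤ L)
    (m₂ : ℕ) (𝓕 : Measure (Fin d → ℚ)) (S K p : ℝ) : Prop :=
  p ≤ (Measure.pi fun _ : Fin m₂ => 𝓕).real
    {F | HasShortBasis (errorLattice (fun k => (B k : E d)) S F)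
      (K * √((m₂ : ℝ) + d) * S ^ ((m₂ : ℝ) / (m₂ + d)) *
        (ZLattice.covolume L) ^ (1 / ((m₂ : ℝ) + d)))}

end PostProcess

/-! ### Running times from bounds on the memory contents -/

namespace RAM

/-! Put s = ⌊S⌋ + 1 and consider the lattice of rank n = d + m formed by all vectors (a, s(⟨a, w_k⟩
+ y_k)_k) with a and y integral. The program works with D times this lattice, where D is a common
denominator of the inputs, so that all its numbers are integers. The vectors with left part a in L
should have short generators, and all other vectors should be long.

Vectors outside L are long. Suppose that for every integral a ∉ L some ⟨a, v_i⟩ is more than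
1/(3·2^d) away from ℤ (`Separates`). Then every vector of length at most R = s/(16·2^d) has a ∈ L,
since otherwise the coordinate of that good run would place ⟨a, v_i⟩ within 5/(16·2^d) of ℤ
(`mem_of_runNormSq_le`). Separation depends only on the class of a in ℤ^d/L. For a class of order k
the value ⟨a, v⟩ modulo 1 is uniform on the multiples of 1/k, so one run misses the class with
probability at most max(1/k, 2^-d). At most k^d classes are killed by k, and there are fewer than
2^(d²) classes, so d + 4 independent runs fail to separate with probability at most 1/4 + 16^-d ≤
5/16 (`measureReal_not_separates_le`). Independence of the bad runs then gives 11p/16 ≥ p/4.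

L has enough short vectors. A vector of Λ of length below T with left part u ∈ L yields a vector of
the lattice of the runs with the same left part and squared length at most 16(m + 1)T², because ⟨u,
v_i⟩ is an integer in every good run. By the assumption such u generate L. A reduced basis has an
initial segment whose span contains these vectors and whose members are longer at most by the factor
√(n 2^n) (`IsReduced.exists_short`). If this still lies below R, the left parts of the reduced rows
of length at most R generate exactly L (`IsRunBasis.span_short`). In logarithms this requirement is
the lower bound on C (`short_basis_bound`).

From generators to a basis. The generators x_t are reduced a second time, as rows (Q x_t | e_t) with
a huge weight Q. Their Gram determinant grows only like Q^(2d), so at most d reduced vectors have a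
non-zero left part. These are among the last d, and their left parts form a basis of L
(`IsGenBasis.isBasisOf`).

Polynomial time. Gram-Schmidt vectors multiplied by Gram determinants are integral, and the
determinants are positive integers; this bounds all numbers and, through the usual potential, the
number of exchanges (`run_lllProg_of_le`). `Run b` records that written values are at most 2^b and
that loops make at most b rounds, and `Run.exec` turns this into a cost polynomial in b. The program
is shown to run with b = 13824 (size + 1)^9 on every input, whether or not the input comes from a
lattice. -/

theorem one_le_bits (z : ℤ) : 1 ≤ bits z := by simp [bits]

theorem bits_le_iff (z : ℤ) (b : ℕ) : bits z ≤ b + 1 ↔ z.natAbs < 2 ^ b := by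
  simp [bits, Nat.size_le]

theorem bits_le_of_abs_le {z : ℤ} {b : ℕ} (h : |z| ≤ 2 ^ b) : bits z ≤ b + 2 := by
  refine (bits_le_iff z (b + 1)).2 ?_
  have : z.natAbs ≤ 2 ^ b := by zify; exact h
  exact this.trans_lt (Nat.pow_lt_pow_right (by norm_num) (by omega))

theorem natAbs_lt_two_pow_bits (z : ℤ) : z.natAbs < 2 ^ (bits z - 1) := by
  have := (bits_le_iff z (bits z - 1)).1 (by have := one_le_bits z; omega)
  exact this

theorem bits_add_le (x y : ℤ) : bits (x + y) ≤ bits x + bits y := by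
  have hx := natAbs_lt_two_pow_bits x
  have hy := natAbs_lt_two_pow_bits y
  have h1 := one_le_bits x
  have h2 := one_le_bits y
  have key : (x + y).natAbs < 2 ^ (bits x + bits y - 1) := by
    calc (x + y).natAbs ≤ x.natAbs + y.natAbs := Int.natAbs_add_le x y
      _ < 2 ^ (bits x - 1) + 2 ^ (bits y - 1) := by omega
      _ ≤ 2 ^ (bits x + bits y - 2) + 2 ^ (bits x + bits y - 2) :=
          add_le_add (Nat.pow_le_pow_right (by norm_num) (by omega))
            (Nat.pow_le_pow_right (by norm_num) (by omega))
      _ = 2 ^ (bits x + bits y - 1) := by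
          rw [← two_mul, ← pow_succ']; congr 1; omega
  have := (bits_le_iff (x + y) _).2 key
  omega

theorem bits_neg (x : ℤ) : bits (-x) = bits x := by simp [bits]

theorem bits_sub_le (x y : ℤ) : bits (x - y) ≤ bits x + bits y := by
  rw [sub_eq_add_neg, ← bits_neg y]; exact bits_add_le x (-y)

theorem bits_mul_le (x y : ℤ) : bits (x * y) ≤ bits x + bits y := by
  have hx := natAbs_lt_two_pow_bits x
  have hy := natAbs_lt_two_pow_bits y
  have h1 := one_le_bits x
  have h2 := one_le_bits y
  have key : (x * y).natAbs < 2 ^ ((bits x - 1) + (bits y - 1)) := by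
    rw [Int.natAbs_mul, pow_add]
    exact Nat.mul_lt_mul'' hx hy
  have := (bits_le_iff (x * y) _).2 key
  omega

theorem bits_div_le (x y : ℤ) : bits (x / y) ≤ bits x := by
  have : (x / y).natAbs ≤ x.natAbs := Int.natAbs_ediv_le_natAbs x y
  unfold bits
  have := Nat.size_le_size this
  omega

/-! ### Polynomial bounds for the cost of expressions -/

namespace Expr

/-- The scalar variable stored in cell `0` of array `a`. -/
abbrev V (a : ℕ) : Expr := .get a (.const 0)

/-- Bound for the bit length of the value, as a polynomial in a bound for the bit lengths of the
memory contents. -/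
noncomputable def sizePoly : Expr → Polynomial ℕ
  | const z => Polynomial.C (bits z)
  | get _ _ => Polynomial.X
  | add x y => x.sizePoly + y.sizePoly
  | sub x y => x.sizePoly + y.sizePoly
  | mul x y => x.sizePoly + y.sizePoly
  | div x _ => x.sizePoly

/-- Bound for the evaluation cost. -/
noncomputable def costPoly : Expr → Polynomial ℕ
  | const z => Polynomial.C (bits z)
  | get _ i => i.costPoly + i.sizePoly + Polynomial.X
  | add x y => x.costPoly + y.costPoly + x.sizePoly + y.sizePoly
  | sub x y => x.costPoly + y.costPoly + x.sizePoly + y.sizePoly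
  | mul x y => x.costPoly + y.costPoly + x.sizePoly * y.sizePoly
  | div x y => x.costPoly + y.costPoly + x.sizePoly * y.sizePoly

theorem bits_eval_le {σ : Mem} {B : ℕ} (h : ∀ a k, bits (σ a k) ≤ B) (e : Expr) :
    bits (e.eval σ) ≤ e.sizePoly.eval B := by
  induction e with
  | const z => simp [eval, sizePoly]
  | get a i _ => simpa [eval, sizePoly] using h _ _
  | add x y hx hy =>
    simp only [eval, sizePoly, Polynomial.eval_add]
    exact (bits_add_le _ _).trans (add_le_add hx hy)
  | sub x y hx hy =>
    simp only [eval, sizePoly, Polynomial.eval_add]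
    exact (bits_sub_le _ _).trans (add_le_add hx hy)
  | mul x y hx hy =>
    simp only [eval, sizePoly, Polynomial.eval_add]
    exact (bits_mul_le _ _).trans (add_le_add hx hy)
  | div x y hx _ =>
    simp only [eval, sizePoly]
    exact (bits_div_le _ _).trans hx

theorem cost_le {σ : Mem} {B : ℕ} (h : ∀ a k, bits (σ a k) ≤ B) (e : Expr) :
    e.cost σ ≤ e.costPoly.eval B := by
  induction e with
  | const z => simp [cost, costPoly]
  | get a i hi =>
    simp only [cost, costPoly, Polynomial.eval_add, Polynomial.eval_X]
    exact add_le_add (add_le_add hi (bits_eval_le h i)) (h _ _)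
  | add x y hx hy =>
    simp only [cost, costPoly, Polynomial.eval_add]
    exact add_le_add (add_le_add (add_le_add hx hy) (bits_eval_le h x)) (bits_eval_le h y)
  | sub x y hx hy =>
    simp only [cost, costPoly, Polynomial.eval_add]
    exact add_le_add (add_le_add (add_le_add hx hy) (bits_eval_le h x)) (bits_eval_le h y)
  | mul x y hx hy =>
    simp only [cost, costPoly, Polynomial.eval_add, Polynomial.eval_mul]
    exact add_le_add (add_le_add hx hy) (Nat.mul_le_mul (bits_eval_le h x) (bits_eval_le h y))
  | div x y hx hy =>
    simp only [cost, costPoly, Polynomial.eval_add, Polynomial.eval_mul]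
    exact add_le_add (add_le_add hx hy) (Nat.mul_le_mul (bits_eval_le h x) (bits_eval_le h y))

end Expr

/-! ### Runs with bounded memory contents and bounded loops -/

/-- `k` iterations of a loop with condition `e` and body relation `R`. -/
def loopRel (e : Expr) (R : Mem → Mem → Prop) : ℕ → Mem → Mem → Prop
  | 0 => fun σ τ => ¬ 0 < e.eval σ ∧ τ = σ
  | k + 1 => fun σ τ => 0 < e.eval σ ∧ ∃ υ, R σ υ ∧ loopRel e R k υ τ

/-- `p` leads from `σ` to `τ`, writing only values of absolute value at most `2 ^ b`, and with at
most `b` iterations of each loop. -/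
def Run (b : ℕ) : Prog → Mem → Mem → Prop
  | .skip => fun σ τ => τ = σ
  | .set a i e => fun σ τ => |e.eval σ| ≤ 2 ^ b ∧ τ = σ.write a (i.eval σ).toNat (e.eval σ)
  | .seq p q => fun σ τ => ∃ υ, Run b p σ υ ∧ Run b q υ τ
  | .ifPos e p q => fun σ τ => (0 < e.eval σ ∧ Run b p σ τ) ∨ (¬ 0 < e.eval σ ∧ Run b q σ τ)
  | .whilePos e p => fun σ τ => ∃ k ≤ b, loopRel e (Run b p) k σ τ

namespace Prog

/-- Bound for the running time, as a polynomial in a bound for the bit lengths and the numbers of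
iterations. -/
noncomputable def timePoly : Prog → Polynomial ℕ
  | skip => 1
  | set _ i e => 1 + i.costPoly + e.costPoly + i.sizePoly + e.sizePoly
  | seq p q => 1 + p.timePoly + q.timePoly
  | ifPos e p q => 1 + e.costPoly + (p.timePoly + q.timePoly)
  | whilePos e p => Polynomial.X * (1 + e.costPoly + p.timePoly) + (1 + e.costPoly)

/-- The arrays a program may write to. -/
def writes : Prog → List ℕ
  | skip => []
  | set a _ _ => [a]
  | seq p q => p.writes ++ q.writes
  | ifPos _ p q => p.writes ++ q.writes
  | whilePos _ p => p.writes

end Prog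

theorem Mem.write_of_ne {σ : Mem} {a a' : ℕ} (h : a' ≠ a) (k : ℕ) (v : ℤ) :
    σ.write a k v a' = σ a' := by
  funext k'; simp [Mem.write, h]

@[simp] theorem Mem.write_self (σ : Mem) (a k : ℕ) (v : ℤ) : σ.write a k v a k = v := by
  simp [Mem.write]

theorem Mem.write_of_ne_index (σ : Mem) (a : ℕ) {k k' : ℕ} (h : k' ≠ k) (v : ℤ) :
    σ.write a k v a k' = σ a k' := by
  simp [Mem.write, h]

/-- For concrete programs the condition on `writes` is decidable, so most later claims that an array
is untouched are closed by `decide`. -/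
theorem Run.frame {b : ℕ} {p : Prog} {σ τ : Mem} (h : Run b p σ τ) {a : ℕ}
    (ha : a ∉ p.writes) : τ a = σ a := by
  induction p generalizing σ τ with
  | skip => rw [h]
  | set a' i e =>
    rw [h.2]
    exact Mem.write_of_ne (by simpa [Prog.writes] using ha) _ _
  | seq p q hp hq =>
    simp only [Prog.writes, List.mem_append, not_or] at ha
    obtain ⟨υ, h1, h2⟩ := h
    rw [hq h2 ha.2, hp h1 ha.1]
  | ifPos e p q hp hq =>
    simp only [Prog.writes, List.mem_append, not_or] at ha
    rcases h with h | h
    · exact hp h.2 ha.1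
    · exact hq h.2 ha.2
  | whilePos e p hp =>
    obtain ⟨k, -, h⟩ := h
    induction k generalizing σ with
    | zero => rw [h.2]
    | succ k ih =>
      obtain ⟨-, υ, h1, h2⟩ := h
      rw [ih h2, hp h1 ha]

/-- With all cells below 2^b, each elementary step costs a polynomial in b + 2, and a loop
multiplies the bound for its body by at most b. The degree depends on the program alone. -/
theorem Run.exec {b : ℕ} {p : Prog} {σ τ : Mem} (h : Run b p σ τ)
    (hσ : ∀ a k, |σ a k| ≤ 2 ^ b) :
    (∀ a k, |τ a k| ≤ 2 ^ b) ∧ ∃ t ≤ p.timePoly.eval (b + 2), Exec p σ t τ := by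
  have bd : ∀ {υ : Mem}, (∀ a k, |υ a k| ≤ 2 ^ b) → ∀ a k, bits (υ a k) ≤ b + 2 :=
    fun h a k => bits_le_of_abs_le (h a k)
  induction p generalizing σ τ with
  | skip => rw [h]; exact ⟨hσ, 1, by simp [Prog.timePoly], .skip σ⟩
  | set a i e =>
    obtain ⟨h1, rfl⟩ := h
    refine ⟨fun a' k' => ?_, _, ?_, .set a i e σ⟩
    · unfold Mem.write
      split_ifs
      · exact h1
      · exact hσ _ _
    · simp only [Prog.timePoly, Polynomial.eval_add, Polynomial.eval_one]
      exact add_le_add (add_le_add (add_le_add (add_le_add le_rfl (i.cost_le (bd hσ)))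
        (e.cost_le (bd hσ))) (i.bits_eval_le (bd hσ))) (e.bits_eval_le (bd hσ))
  | seq p q hp hq =>
    obtain ⟨υ, h1, h2⟩ := h
    obtain ⟨b1, t1, l1, e1⟩ := hp h1 hσ
    obtain ⟨b2, t2, l2, e2⟩ := hq h2 b1
    refine ⟨b2, _, ?_, .seq e1 e2⟩
    simp only [Prog.timePoly, Polynomial.eval_add, Polynomial.eval_one]
    omega
  | ifPos e p q hp hq =>
    have hc := e.cost_le (bd hσ)
    rcases h with ⟨h0, h⟩ | ⟨h0, h⟩
    · obtain ⟨b1, t1, l1, e1⟩ := hp h hσ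
      refine ⟨b1, _, ?_, .if_true h0 e1⟩
      simp only [Prog.timePoly, Polynomial.eval_add, Polynomial.eval_one]
      omega
    · obtain ⟨b1, t1, l1, e1⟩ := hq h hσ
      refine ⟨b1, _, ?_, .if_false h0 e1⟩
      simp only [Prog.timePoly, Polynomial.eval_add, Polynomial.eval_one]
      omega
  | whilePos e p hp =>
    obtain ⟨k, hk, h⟩ := h
    have key : (∀ a k, |τ a k| ≤ 2 ^ b) ∧ ∃ t ≤ k * (1 + e.costPoly.eval (b + 2) +
        p.timePoly.eval (b + 2)) + (1 + e.costPoly.eval (b + 2)), Exec (.whilePos e p) σ t τ := by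
      clear hk
      induction k generalizing σ with
      | zero =>
        obtain ⟨h0, rfl⟩ := h
        refine ⟨hσ, _, ?_, .while_false h0⟩
        have hc := e.cost_le (bd hσ)
        omega
      | succ k ih =>
        obtain ⟨h0, υ, h1, h2⟩ := h
        obtain ⟨b1, t1, l1, e1⟩ := hp h1 hσ
        obtain ⟨b2, t2, l2, e2⟩ := ih b1 h2
        refine ⟨b2, _, ?_, .while_true h0 e1 e2⟩
        have hc := e.cost_le (bd hσ)
        rw [add_mul]
        omega
    obtain ⟨h1, t, ht, he⟩ := key
    refine ⟨h1, t, ht.trans ?_, he⟩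
    simp only [Prog.timePoly, Polynomial.eval_add, Polynomial.eval_one, Polynomial.eval_mul,
      Polynomial.eval_X]
    gcongr
    omega

/-- The parameter of the invariant is fuel. It is not stored in memory; since it drops strictly in
every round, it bounds the number of rounds. -/
theorem Run.while {b : ℕ} {e : Expr} {p : Prog} {I : ℕ → Mem → Prop}
    (hstep : ∀ f σ, I f σ → 0 < e.eval σ → ∃ f' < f, ∃ τ, Run b p σ τ ∧ I f' τ)
    {f : ℕ} (hf : f ≤ b) {σ : Mem} (h : I f σ) :
    ∃ τ, Run b (.whilePos e p) σ τ ∧ ∃ f', I f' τ ∧ ¬ 0 < e.eval τ := by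
  have key : ∀ f σ, I f σ → ∃ k ≤ f, ∃ τ, loopRel e (Run b p) k σ τ ∧
      ∃ f', I f' τ ∧ ¬ 0 < e.eval τ := by
    intro f
    induction f using Nat.strong_induction_on with
    | _ f ih =>
      intro σ h
      by_cases h0 : 0 < e.eval σ
      · obtain ⟨f', hf', τ, h1, h2⟩ := hstep f σ h h0
        obtain ⟨k, hk, υ, h3, h4⟩ := ih f' hf' τ h2
        exact ⟨k + 1, by omega, υ, ⟨h0, τ, h1, h3⟩, h4⟩
      · exact ⟨0, by omega, σ, ⟨h0, rfl⟩, f, h, h0⟩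
  obtain ⟨k, hk, τ, h1, h2⟩ := key f σ h
  exact ⟨τ, ⟨k, hk.trans hf, h1⟩, h2⟩

/-! ### Counting loops and their verification rules -/

namespace Prog
open RAM.Expr

/-- `for v = 0, …, E - 1 do p`, for a body `p` that does not change `E`. -/
def forTo (v : ℕ) (E : Expr) (p : Prog) : Prog :=
  .seq (.set v (.const 0) (.const 0))
    (.whilePos (.sub E (V v)) (.seq p (.set v (.const 0) (.add (V v) (.const 1)))))

/-- `acc = ∑ v < E, e`. -/
def sumTo (acc v : ℕ) (E e : Expr) : Prog :=
  .seq (.set acc (.const 0) (.const 0)) (forTo v E (.set acc (.const 0) (.add (V acc) e)))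

/-- `a[i] = e` for `v = 0, …, E - 1`. -/
def vecTo (a v : ℕ) (E i e : Expr) : Prog := forTo v E (.set a i e)

end Prog

open RAM.Prog RAM.Expr

theorem Run.set_const_zero {b a : ℕ} {e : Expr} {σ : Mem} {z : ℤ} (he : e.eval σ = z)
    (hz : |z| ≤ 2 ^ b) : Run b (.set a (.const 0) e) σ (σ.write a 0 z) := by
  subst he
  exact ⟨hz, rfl⟩

/-- The bound `E` is evaluated again before each round, hence `hE`. The hypothesis `hI` keeps the
invariant insensitive to the counter cell, and the frame conditions are supplied to `hE` and `hstep`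
so that they need not be part of the invariant. -/
theorem Run.forTo {b v : ℕ} {E : Expr} {p : Prog} {n : ℕ} {I : ℕ → Mem → Prop} {σ : Mem}
    (hn : n ≤ b) (hv : v ∉ p.writes)
    (hI : ∀ k τ z, I k τ → I k (τ.write v 0 z)) (h0 : I 0 σ)
    (hE : ∀ k τ, (∀ a, a ∉ v :: p.writes → τ a = σ a) → I k τ → E.eval τ = n)
    (hstep : ∀ k < n, ∀ τ, (∀ a, a ∉ v :: p.writes → τ a = σ a) → τ v 0 = (k : ℤ) → I k τ →
      ∃ υ, Run b p τ υ ∧ I (k + 1) υ) :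
    ∃ τ, Run b (forTo v E p) σ τ ∧ I n τ := by
  have hb : n < 2 ^ b := hn.trans_lt Nat.lt_two_pow_self
  let J : ℕ → Mem → Prop := fun f τ => ∃ k, k + f = n ∧ (∀ a, a ∉ v :: p.writes → τ a = σ a) ∧
    τ v 0 = (k : ℤ) ∧ I k τ
  have hw : ∀ (τ : Mem) z, (∀ a, a ∉ v :: p.writes → τ a = σ a) →
      ∀ a, a ∉ v :: p.writes → τ.write v 0 z a = σ a := by
    intro τ z h a ha
    rw [Mem.write_of_ne (by rintro rfl; simp at ha), h a ha]
  have h1 : J n (σ.write v 0 0) :=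
    ⟨0, by simp, hw σ 0 (fun _ _ => rfl), by simp, hI _ _ _ h0⟩
  obtain ⟨τ, hτ, f, ⟨k, hk, hfr, hkv, hIk⟩, hneg⟩ := Run.while (b := b)
    (e := .sub E (V v)) (p := .seq p (.set v (.const 0) (.add (V v) (.const 1)))) (I := J) (by
      rintro f τ ⟨k, hk, hfr, hkv, hIk⟩ hpos
      have hEe := hE k τ hfr hIk
      simp only [eval, hEe, Int.toNat_zero, hkv] at hpos
      have hkn : k < n := by omega
      obtain ⟨υ, h2, h3⟩ := hstep k hkn τ hfr hkv hIk
      have hvv : υ v 0 = k := by rw [h2.frame hv, hkv]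
      refine ⟨f - 1, by omega, υ.write v 0 (k + 1 : ℕ), ⟨υ, h2, ?_⟩, k + 1, by omega, ?_, by simp,
        hI _ _ _ h3⟩
      · refine Run.set_const_zero (by simp [eval, hvv]) ?_
        rw [Nat.abs_cast]
        exact_mod_cast (show k + 1 ≤ 2 ^ b by omega)
      · refine hw _ _ fun a ha => ?_
        rw [h2.frame (by simp at ha; exact ha.2), hfr a ha]) hn h1
  have hEe := hE k τ hfr hIk
  simp only [eval, hEe, Int.toNat_zero, hkv] at hneg
  have hkn : k = n := by omega
  subst hkn
  refine ⟨τ, ⟨σ.write v 0 0, Run.set_const_zero rfl (by simp), hτ⟩, hIk⟩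

/-- Every partial sum passes through memory, so all of them have to be bounded, not only the last.
-/
theorem Run.sumTo {b acc v : ℕ} {E e : Expr} {N : ℕ} {f : ℕ → ℤ} {σ : Mem}
    (hN : N ≤ b) (hne : v ≠ acc)
    (hE : ∀ τ : Mem, (∀ a, a ≠ acc → a ≠ v → τ a = σ a) → E.eval τ = N)
    (he : ∀ c < N, ∀ τ : Mem, (∀ a, a ≠ acc → a ≠ v → τ a = σ a) → τ v 0 = c → e.eval τ = f c)
    (hf : ∀ k ≤ N, |∑ c ∈ Finset.range k, f c| ≤ 2 ^ b) :
    ∃ τ, Run b (sumTo acc v E e) σ τ ∧ τ acc 0 = ∑ c ∈ Finset.range N, f c ∧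
      ∀ a, a ≠ acc → a ≠ v → τ a = σ a := by
  have hfr : ∀ τ : Mem, (∀ a, a ∉ v :: (Prog.set acc (.const 0) (.add (V acc) e)).writes →
      τ a = σ.write acc 0 0 a) → ∀ a, a ≠ acc → a ≠ v → τ a = σ a := by
    intro τ h a h1 h2
    rw [h a (by simp [writes, h1, h2]), Mem.write_of_ne h1]
  obtain ⟨τ, h1, h2⟩ := Run.forTo (b := b) (v := v) (E := E)
    (p := .set acc (.const 0) (.add (V acc) e)) (n := N) (σ := σ.write acc 0 0)
    (I := fun k τ => k ≤ N → τ acc 0 = ∑ c ∈ Finset.range k, f c) hN (by simp [writes, hne])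
    (fun k τ z h hk => by rw [Mem.write_of_ne hne.symm, h hk]) (by simp)
    (fun k τ h _ => hE τ (hfr τ h))
    (fun k hk τ h hv hI => by
      have hev : (Expr.add (V acc) e).eval τ = ∑ c ∈ Finset.range (k + 1), f c := by
        simp only [eval, Int.toNat_zero]
        rw [he k hk τ (hfr τ h) hv, hI hk.le, Finset.sum_range_succ]
      exact ⟨_, Run.set_const_zero hev (hf _ (by omega)), fun _ => by simp⟩)
  refine ⟨τ, ⟨_, Run.set_const_zero (z := 0) rfl (by simp), h1⟩, h2 le_rfl, fun a ha hv => ?_⟩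
  rw [h1.frame (by simp [Prog.forTo, writes, ha, hv]), Mem.write_of_ne ha]

/-- The expression may read the array that is being overwritten: in round c it may rely on all cells
outside the first c of the segment still having their old contents. -/
theorem Run.vecTo {b a v : ℕ} {E i e : Expr} {N base : ℕ} {g : ℕ → ℤ} {σ : Mem}
    (hN : N ≤ b) (hne : v ≠ a)
    (hE : ∀ τ : Mem, (∀ a', a' ≠ a → a' ≠ v → τ a' = σ a') → E.eval τ = N)
    (hi : ∀ c < N, ∀ τ : Mem, (∀ a', a' ≠ a → a' ≠ v → τ a' = σ a') → τ v 0 = c →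
      i.eval τ = (base + c : ℕ))
    (he : ∀ c < N, ∀ τ : Mem, (∀ a', a' ≠ a → a' ≠ v → τ a' = σ a') → τ v 0 = c →
      (∀ k, k < base ∨ base + c ≤ k → τ a k = σ a k) → e.eval τ = g c)
    (hg : ∀ c < N, |g c| ≤ 2 ^ b) :
    ∃ τ, Run b (vecTo a v E i e) σ τ ∧ (∀ c < N, τ a (base + c) = g c) ∧
      (∀ k, k < base ∨ base + N ≤ k → τ a k = σ a k) ∧
      ∀ a', a' ≠ a → a' ≠ v → τ a' = σ a' := by
  have hfr : ∀ τ : Mem, (∀ a', a' ∉ v :: (Prog.set a i e).writes → τ a' = σ a') →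
      ∀ a', a' ≠ a → a' ≠ v → τ a' = σ a' := by
    intro τ h a' h1 h2
    rw [h a' (by simp [writes, h1, h2])]
  obtain ⟨τ, h1, h2, h3⟩ := Run.forTo (b := b) (v := v) (E := E)
    (p := .set a i e) (n := N) (σ := σ)
    (I := fun k τ => (∀ c < k, τ a (base + c) = g c) ∧
      (∀ k', k' < base ∨ base + k ≤ k' → τ a k' = σ a k')) hN (by simp [writes, hne])
    (fun k τ z h => by rw [Mem.write_of_ne hne.symm]; exact h) (by simp)
    (fun k τ h _ => hE τ (hfr τ h))
    (fun k hk τ h hv hI => by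
      have hev := he k hk τ (hfr τ h) hv hI.2
      have hiv := hi k hk τ (hfr τ h) hv
      refine ⟨_, ⟨by rw [hev]; exact hg k hk, rfl⟩, fun c hc => ?_, fun k' hk' => ?_⟩
      · rw [hev, hiv, Int.toNat_natCast]
        rcases Nat.lt_succ_iff_lt_or_eq.1 hc with h | rfl
        · rw [Mem.write_of_ne_index _ _ (by omega), hI.1 c h]
        · simp
      · rw [hiv, Int.toNat_natCast, Mem.write_of_ne_index _ _ (by omega)]
        exact hI.2 k' (by omega))
  exact ⟨τ, h1, h2, h3, fun a' ha hv => h1.frame (by simp [Prog.forTo, writes, ha, hv])⟩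

end RAM

/-! ### Gram-Schmidt orthogonalization of sequences of vectors -/

namespace LLL

open InnerProductSpace Finset

variable {E : Type*} [NormedAddCommGroup E] [InnerProductSpace ℝ E]

/-- The Gram-Schmidt vectors of a sequence. -/
noncomputable abbrev gs (b : ℕ → E) (i : ℕ) : E := gramSchmidt ℝ b i

/-- The component of `x` orthogonal to the first `k` vectors of `b`. -/
noncomputable def res (b : ℕ → E) (k : ℕ) (x : E) : E :=
  x - ∑ j ∈ range k, (inner ℝ (gs b j) x / ‖gs b j‖ ^ 2) • gs b j

/-- The real span of the first `k` vectors of `b`. -/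
def spn (b : ℕ → E) (k : ℕ) : Submodule ℝ E := Submodule.span ℝ (b '' Set.Iio k)

/-- The Gram determinant of the first `k` vectors of `b`. -/
noncomputable def gd (b : ℕ → E) (k : ℕ) : ℝ := ∏ j ∈ range k, ‖gs b j‖ ^ 2

theorem gs_eq_res (b : ℕ → E) (i : ℕ) : gs b i = res b i (b i) := by
  have h := gramSchmidt_def'' ℝ b i
  rw [Nat.Iio_eq_range] at h
  exact eq_sub_of_add_eq h.symm

theorem res_zero (b : ℕ → E) (x : E) : res b 0 x = x := by simp [res]

theorem res_succ (b : ℕ → E) (k : ℕ) (x : E) :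
    res b (k + 1) x = res b k x - (inner ℝ (gs b k) x / ‖gs b k‖ ^ 2) • gs b k := by
  simp only [res, sum_range_succ]; abel

theorem res_add (b : ℕ → E) (k : ℕ) (x y : E) : res b k (x + y) = res b k x + res b k y := by
  simp only [res, inner_add_right, add_div, add_smul, sum_add_distrib]; abel

theorem inner_gs_gs (b : ℕ → E) {i j : ℕ} (h : i ≠ j) : inner ℝ (gs b i) (gs b j) = 0 :=
  gramSchmidt_orthogonal ℝ b h

theorem inner_gs_res_of_le (b : ℕ → E) {j k : ℕ} (h : k ≤ j) (x : E) :
    inner ℝ (gs b j) (res b k x) = inner ℝ (gs b j) x := by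
  rw [res, inner_sub_right, inner_sum, sum_eq_zero, sub_zero]
  intro i hi
  rw [inner_smul_right, inner_gs_gs b (by have := mem_range.1 hi; omega), mul_zero]

theorem inner_gs_res_of_lt (b : ℕ → E) {j k : ℕ} (h : j < k) (x : E) :
    inner ℝ (gs b j) (res b k x) = 0 := by
  rw [res, inner_sub_right, inner_sum, sum_eq_single j]
  · rw [inner_smul_right, real_inner_self_eq_norm_sq]
    by_cases h0 : gs b j = 0
    · simp [h0]
    · have : ‖gs b j‖ ≠ 0 := by simpa using h0
      field_simp
      ring
  · intro i _ hi
    rw [inner_smul_right, inner_gs_gs b hi.symm, mul_zero]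
  · intro hj; exact absurd (mem_range.2 h) hj

theorem span_gs (b : ℕ → E) (k : ℕ) : Submodule.span ℝ (gs b '' Set.Iio k) = spn b k :=
  span_gramSchmidt_Iio ℝ b k

theorem gs_mem_spn (b : ℕ → E) {j k : ℕ} (h : j < k) : gs b j ∈ spn b k := by
  rw [← span_gs]; exact Submodule.subset_span ⟨j, h, rfl⟩

theorem mem_spn (b : ℕ → E) {j k : ℕ} (h : j < k) : b j ∈ spn b k :=
  Submodule.subset_span ⟨j, h, rfl⟩

theorem sub_res_mem (b : ℕ → E) (k : ℕ) (x : E) : x - res b k x ∈ spn b k := by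
  rw [res, sub_sub_cancel]
  exact Submodule.sum_mem _ fun j hj =>
    Submodule.smul_mem _ _ (gs_mem_spn b (mem_range.1 hj))

theorem inner_res_of_mem {b : ℕ → E} {k : ℕ} {y : E} (hy : y ∈ spn b k) (x : E) :
    inner ℝ y (res b k x) = 0 := by
  rw [← span_gs] at hy
  induction hy using Submodule.span_induction with
  | mem y hy => obtain ⟨j, hj, rfl⟩ := hy; exact inner_gs_res_of_lt b hj x
  | zero => simp
  | add y z _ _ h1 h2 => rw [inner_add_left, h1, h2, add_zero]
  | smul c y _ h => rw [inner_smul_left, h, mul_zero]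

/-- The difference of two candidates lies in the span and is orthogonal to it. This lets `res` be
identified without computing with its defining sum. -/
theorem res_unique {b : ℕ → E} {k : ℕ} {x r : E} (h1 : x - r ∈ spn b k)
    (h2 : ∀ y ∈ spn b k, inner ℝ y r = 0) : r = res b k x := by
  have h : r - res b k x ∈ spn b k := by
    have := Submodule.sub_mem _ (sub_res_mem b k x) h1
    simpa using this
  have h0 : inner ℝ (r - res b k x) (r - res b k x) = 0 := by
    rw [inner_sub_right, h2 _ h, inner_res_of_mem h, sub_zero]
  exact sub_eq_zero.1 (inner_self_eq_zero.1 h0)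

theorem res_eq_zero {b : ℕ → E} {k : ℕ} {x : E} (h : x ∈ spn b k) : res b k x = 0 :=
  (res_unique (by simpa using h) (by simp)).symm

theorem res_congr {b b' : ℕ → E} {k : ℕ} (h : spn b' k = spn b k) (x : E) :
    res b' k x = res b k x :=
  res_unique (h ▸ sub_res_mem b' k x) fun _ hy => inner_res_of_mem (h ▸ hy) x

theorem gs_congr {b b' : ℕ → E} {i : ℕ} (h : spn b' i = spn b i)
    (hi : b' i - b i ∈ spn b i) : gs b' i = gs b i := by
  rw [gs_eq_res, gs_eq_res, res_congr h, ← sub_add_cancel (b' i) (b i), res_add,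
    res_eq_zero hi, zero_add]

theorem spn_congr {b b' : ℕ → E} {k : ℕ} (h : ∀ i < k, gs b' i = gs b i) :
    spn b' k = spn b k := by
  rw [← span_gs, ← span_gs]
  congr 1
  exact Set.image_congr fun i hi => h i hi

/-- A unitriangular change of basis leaves the successive spans, and hence the projections, alone.
Size reduction is such a change. -/
theorem gs_congr_of_lt {b b' : ℕ → E} {n : ℕ} (h : ∀ i < n, b' i - b i ∈ spn b i) :
    ∀ i < n, gs b' i = gs b i := by
  intro i
  induction i using Nat.strong_induction_on with
  | _ i ih =>
    intro hi
    exact gs_congr (spn_congr fun j hj => ih j hj (by omega)) (h i hi)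

theorem norm_sq_res (b : ℕ → E) (k : ℕ) (x : E) :
    ‖x‖ ^ 2 = ‖res b k x‖ ^ 2 + ∑ j ∈ range k, inner ℝ (gs b j) x ^ 2 / ‖gs b j‖ ^ 2 := by
  induction k with
  | zero => simp [res_zero]
  | succ k ih =>
    have h : res b k x = res b (k + 1) x + (inner ℝ (gs b k) x / ‖gs b k‖ ^ 2) • gs b k := by
      rw [res_succ]; abel
    rw [ih, sum_range_succ, h, norm_add_sq_real, inner_smul_right,
      real_inner_comm (gs b k), inner_gs_res_of_lt b (Nat.lt_succ_self k), norm_smul, mul_pow, Real.norm_eq_abs, sq_abs]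
    by_cases h0 : gs b k = 0
    · simp [h0]
    · have : ‖gs b k‖ ≠ 0 := by simpa using h0
      field_simp
      ring

theorem norm_res_le (b : ℕ → E) (k : ℕ) (x : E) : ‖res b k x‖ ≤ ‖x‖ := by
  refine (sq_le_sq₀ (norm_nonneg _) (norm_nonneg _)).1 ?_
  rw [norm_sq_res b k x]
  have : 0 ≤ ∑ j ∈ range k, inner ℝ (gs b j) x ^ 2 / ‖gs b j‖ ^ 2 :=
    sum_nonneg fun _ _ => by positivity
  linarith

theorem norm_gs_le (b : ℕ → E) (i : ℕ) : ‖gs b i‖ ≤ ‖b i‖ := by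
  rw [gs_eq_res]; exact norm_res_le _ _ _

theorem inner_gs_self (b : ℕ → E) (i : ℕ) : inner ℝ (gs b i) (b i) = ‖gs b i‖ ^ 2 := by
  rw [← inner_gs_res_of_le b le_rfl, ← gs_eq_res, real_inner_self_eq_norm_sq]

theorem inner_gs_of_lt (b : ℕ → E) {i j : ℕ} (h : i < j) : inner ℝ (gs b j) (b i) = 0 :=
  gramSchmidt_inv_triangular ℝ b h

theorem norm_sq_eq (b : ℕ → E) (i : ℕ) :
    ‖b i‖ ^ 2 = ‖gs b i‖ ^ 2 + ∑ j ∈ range i, inner ℝ (gs b j) (b i) ^ 2 / ‖gs b j‖ ^ 2 := by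
  rw [norm_sq_res b i (b i), gs_eq_res b i]

theorem gd_succ (b : ℕ → E) (k : ℕ) : gd b (k + 1) = gd b k * ‖gs b k‖ ^ 2 :=
  prod_range_succ _ _

theorem gd_zero (b : ℕ → E) : gd b 0 = 1 := by simp [gd]

theorem gd_pos {b : ℕ → E} {k : ℕ} (h : ∀ i < k, gs b i ≠ 0) : 0 < gd b k :=
  prod_pos fun i hi => by have := norm_pos_iff.2 (h i (mem_range.1 hi)); positivity

theorem gd_congr {b b' : ℕ → E} {k : ℕ} (h : ∀ i < k, gs b' i = gs b i) : gd b' k = gd b k :=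
  prod_congr rfl fun i hi => by rw [h i (mem_range.1 hi)]

theorem gd_le {b : ℕ → E} {k : ℕ} {X : ℝ} (h : ∀ i < k, ‖gs b i‖ ≤ X) :
    gd b k ≤ X ^ (2 * k) := by
  calc gd b k ≤ ∏ _j ∈ range k, X ^ 2 := prod_le_prod (fun _ _ => by positivity) fun i hi => by
        have := h i (mem_range.1 hi); gcongr
    _ = X ^ (2 * k) := by rw [prod_const, card_range, pow_mul]

/-! ### Gram determinants and integrality -/

/-- The Gram matrix of the first `k` vectors of `b`. -/
noncomputable def gramMat (b : ℕ → E) (k : ℕ) : Matrix (Fin k) (Fin k) ℝ :=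
  Matrix.of fun i j => inner ℝ (b i) (b j)

/-- The Gram matrix factors as T Δ Tᵀ, where T is the unit lower triangular matrix of Gram-Schmidt
coefficients and Δ is the diagonal matrix of the ‖gs b j‖². -/
theorem det_gramMat {b : ℕ → E} {k : ℕ} (h : ∀ i < k, gs b i ≠ 0) :
    (gramMat b k).det = gd b k := by
  let T : Matrix (Fin k) (Fin k) ℝ :=
    Matrix.of fun i j => inner ℝ (gs b j) (b i) / ‖gs b j‖ ^ 2
  have hT : T.det = 1 := by
    rw [Matrix.det_of_isLowerTriangular]
    · refine prod_eq_one fun i _ => ?_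
      have : ‖gs b i‖ ≠ 0 := by simpa using h i i.2
      simp only [T, Matrix.of_apply]
      rw [inner_gs_self, div_self (pow_ne_zero 2 this)]
    · intro i j hij
      have hij' : (i : ℕ) < j := hij
      simp only [T, Matrix.of_apply]
      rw [inner_gs_of_lt b hij', zero_div]
  have hG : gramMat b k = T * Matrix.diagonal (fun j : Fin k => ‖gs b j‖ ^ 2) * T.transpose := by
    ext i l
    have hb : b l = ∑ j ∈ range k, (inner ℝ (gs b j) (b l) / ‖gs b j‖ ^ 2) • gs b j := by
      have := res_eq_zero (mem_spn b l.2)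
      rw [res, sub_eq_zero] at this
      exact this
    rw [Matrix.mul_apply]
    simp only [gramMat, Matrix.of_apply, Matrix.mul_diagonal, Matrix.transpose_apply, T]
    conv_lhs => rw [hb]
    rw [inner_sum, Finset.sum_range]
    refine sum_congr rfl fun j _ => ?_
    have : ‖gs b j‖ ≠ 0 := by simpa using h j j.2
    rw [inner_smul_right, real_inner_comm (gs b j) (b i)]
    field_simp
  rw [hG, Matrix.det_mul, Matrix.det_mul, Matrix.det_transpose, hT, Matrix.det_diagonal, gd,
    Finset.prod_range]
  ring

variable {Γ : AddSubgroup E}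

theorem exists_int_gramMat (hΓ : ∀ x ∈ Γ, ∀ y ∈ Γ, ∃ z : ℤ, inner ℝ x y = (z : ℝ))
    {b : ℕ → E} {k : ℕ} (hb : ∀ i < k, b i ∈ Γ) :
    ∃ G : Matrix (Fin k) (Fin k) ℤ, G.map (Int.cast : ℤ → ℝ) = gramMat b k := by
  choose G hG using fun i j : Fin k => hΓ _ (hb i i.2) _ (hb j j.2)
  exact ⟨Matrix.of G, by ext i j; simp [gramMat, hG]⟩

theorem exists_int_gd (hΓ : ∀ x ∈ Γ, ∀ y ∈ Γ, ∃ z : ℤ, inner ℝ x y = (z : ℝ))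
    {b : ℕ → E} {k : ℕ} (hb : ∀ i < k, b i ∈ Γ) (h : ∀ i < k, gs b i ≠ 0) :
    ∃ z : ℤ, gd b k = z := by
  obtain ⟨G, hG⟩ := exists_int_gramMat hΓ hb
  refine ⟨G.det, ?_⟩
  rw [← det_gramMat h, ← hG]
  exact ((Int.castRingHom ℝ).map_det G).symm

/-- Cramer's rule: the coefficients of the projection of x solve a linear system with the integral
Gram matrix, so multiplication by its determinant makes them integers. This permits
orthogonalization without fractions. -/
theorem gd_smul_res_mem (hΓ : ∀ x ∈ Γ, ∀ y ∈ Γ, ∃ z : ℤ, inner ℝ x y = (z : ℝ))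
    {b : ℕ → E} {k : ℕ} (hb : ∀ i < k, b i ∈ Γ) (h : ∀ i < k, gs b i ≠ 0) {x : E} (hx : x ∈ Γ) :
    gd b k • res b k x ∈ Γ := by
  obtain ⟨G, hG⟩ := exists_int_gramMat hΓ hb
  have hr : Set.range (fun i : Fin k => b i) = b '' Set.Iio k := by
    ext y; constructor
    · rintro ⟨i, rfl⟩; exact ⟨i, i.2, rfl⟩
    · rintro ⟨i, hi, rfl⟩; exact ⟨⟨i, hi⟩, rfl⟩
  have hm := sub_res_mem b k x
  rw [spn, ← hr, Submodule.mem_span_range_iff_exists_fun] at hm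
  obtain ⟨c, hc⟩ := hm
  choose r hr using fun i : Fin k => hΓ _ (hb i i.2) _ hx
  have hGc : (gramMat b k).mulVec c = fun i => (r i : ℝ) := by
    ext i
    have h1 : inner ℝ (b i) (x - res b k x) = (r i : ℝ) := by
      rw [inner_sub_right, inner_res_of_mem (mem_spn b i.2), sub_zero, hr]
    rw [← h1, ← hc, inner_sum]
    simp only [Matrix.mulVec, dotProduct, gramMat, Matrix.of_apply, inner_smul_right]
    exact sum_congr rfl fun j _ => mul_comm _ _
  have hadj : gd b k • c = fun i => ((G.adjugate.mulVec r i : ℤ) : ℝ) := by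
    have h1 : (gramMat b k).adjugate.mulVec ((gramMat b k).mulVec c) = gd b k • c := by
      rw [Matrix.mulVec_mulVec, Matrix.adjugate_mul, det_gramMat h, Matrix.smul_mulVec,
        Matrix.one_mulVec]
    rw [← h1, hGc, ← hG]
    have h2 : (G.map (Int.cast : ℤ → ℝ)).adjugate = G.adjugate.map (Int.cast : ℤ → ℝ) :=
      ((Int.castRingHom ℝ).map_adjugate G).symm
    rw [h2]
    ext i
    simp [Matrix.mulVec, dotProduct]
  obtain ⟨D, hD⟩ := exists_int_gd hΓ hb h
  have : gd b k • res b k x = D • x - ∑ i, (G.adjugate.mulVec r i) • b i := by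
    have h3 : gd b k • (x - res b k x) = ∑ i, (G.adjugate.mulVec r i) • b i := by
      rw [← hc, smul_sum]
      refine sum_congr rfl fun i _ => ?_
      rw [smul_smul, ← Int.cast_smul_eq_zsmul ℝ]
      congr 1
      exact congrFun hadj i
    rw [← h3, ← Int.cast_smul_eq_zsmul ℝ, ← hD, smul_sub]
    abel
  rw [this]
  exact Γ.sub_mem (Γ.zsmul_mem hx _) (Γ.sum_mem fun i _ => Γ.zsmul_mem (hb i i.2) _)

theorem one_le_gd (hΓ : ∀ x ∈ Γ, ∀ y ∈ Γ, ∃ z : ℤ, inner ℝ x y = (z : ℝ))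
    {b : ℕ → E} {k : ℕ} (hb : ∀ i < k, b i ∈ Γ) (h : ∀ i < k, gs b i ≠ 0) : 1 ≤ gd b k := by
  obtain ⟨z, hz⟩ := exists_int_gd hΓ hb h
  have := gd_pos h
  rw [hz] at this ⊢
  exact_mod_cast this

end LLL

/-! ### Reduced bases -/

namespace LLL

open InnerProductSpace Finset

variable {E : Type*} [NormedAddCommGroup E] [InnerProductSpace ℝ E]

set_option linter.unusedSectionVars false

/-- The lattice generated by the first `n` vectors of `b`. -/
def lat (b : ℕ → E) (n : ℕ) : Submodule ℤ E := Submodule.span ℤ (b '' Set.Iio n)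

theorem mem_lat (b : ℕ → E) {i n : ℕ} (h : i < n) : b i ∈ lat b n :=
  Submodule.subset_span ⟨i, h, rfl⟩

theorem lat_le {b : ℕ → E} {n : ℕ} {M : Submodule ℤ E} (h : ∀ i < n, b i ∈ M) : lat b n ≤ M :=
  Submodule.span_le.2 (by rintro _ ⟨i, hi, rfl⟩; exact h i hi)

theorem lat_mono (b : ℕ → E) {j k : ℕ} (h : j ≤ k) : lat b j ≤ lat b k :=
  lat_le fun _ hi => mem_lat b (hi.trans_le h)

theorem mem_lat_succ {b : ℕ → E} {k : ℕ} {u : E} (h : u ∈ lat b (k + 1)) :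
    ∃ c : ℤ, ∃ v ∈ lat b k, u = c • b k + v := by
  rw [lat, ← Order.succ_eq_add_one, Order.Iio_succ_eq_insert, Set.image_insert_eq,
    Submodule.mem_span_insert] at h
  exact h

theorem lat_le_spn (b : ℕ → E) (k : ℕ) {u : E} (h : u ∈ lat b k) : u ∈ spn b k := by
  have : lat b k ≤ (spn b k).restrictScalars ℤ := lat_le fun i hi => mem_spn b hi
  exact this h

theorem lat_sub_smul {b b' : ℕ → E} {i j n : ℕ} {q : ℤ} (hj : j < i) (hi : i < n)
    (h : ∀ l, l ≠ i → b' l = b l) (h' : b' i = b i - q • b j) : lat b' n = lat b n := by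
  apply le_antisymm
  · refine lat_le fun l hl => ?_
    rcases eq_or_ne l i with rfl | hne
    · rw [h']
      exact Submodule.sub_mem _ (mem_lat b hl) (Submodule.smul_mem _ _ (mem_lat b (hj.trans hi)))
    · rw [h l hne]; exact mem_lat b hl
  · refine lat_le fun l hl => ?_
    rcases eq_or_ne l i with rfl | hne
    · have : b l = b' l + q • b' j := by rw [h', h j hj.ne]; abel
      rw [this]
      exact Submodule.add_mem _ (mem_lat b' hl) (Submodule.smul_mem _ _ (mem_lat b' (hj.trans hi)))
    · rw [← h l hne]; exact mem_lat b' hl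

theorem gs_sub_smul {b b' : ℕ → E} {i j : ℕ} {q : ℤ} (hj : j < i)
    (h : ∀ l, l ≠ i → b' l = b l) (h' : b' i = b i - q • b j) (l : ℕ) : gs b' l = gs b l := by
  refine gs_congr_of_lt (n := l + 1) (fun m _ => ?_) l (Nat.lt_succ_self l)
  rcases eq_or_ne m i with rfl | hne
  · rw [h', sub_sub_cancel_left, ← Int.cast_smul_eq_zsmul ℝ]
    exact Submodule.neg_mem _ (Submodule.smul_mem _ _ (mem_spn b hj))
  · rw [h m hne, sub_self]; exact Submodule.zero_mem _

/-! #### Exchanging two consecutive vectors -/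

section Swap

variable {b b' : ℕ → E} {k : ℕ} (hb : ∀ l, b' l = b (Equiv.swap k (k + 1) l))
include hb

theorem swap_image_Iio {j : ℕ} (hj : j ≤ k ∨ k + 2 ≤ j) : b' '' Set.Iio j = b '' Set.Iio j := by
  have key : ∀ l, l < j → Equiv.swap k (k + 1) l < j := by
    intro l hl
    rw [Equiv.swap_apply_def]
    split_ifs <;> omega
  ext y
  constructor
  · rintro ⟨l, hl, rfl⟩
    exact ⟨_, key l hl, (hb l).symm⟩
  · rintro ⟨l, hl, rfl⟩
    exact ⟨_, key l hl, by rw [hb, Equiv.swap_apply_self]⟩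

theorem swap_spn {j : ℕ} (hj : j ≤ k ∨ k + 2 ≤ j) : spn b' j = spn b j := by
  rw [spn, swap_image_Iio hb hj, spn]

theorem swap_lat {n : ℕ} (hn : k + 2 ≤ n) : lat b' n = lat b n := by
  rw [lat, swap_image_Iio hb (Or.inr hn), lat]

theorem swap_gs_of_ne {j : ℕ} (h1 : j ≠ k) (h2 : j ≠ k + 1) : gs b' j = gs b j := by
  rw [gs_eq_res, gs_eq_res, res_congr (swap_spn hb (by omega)), hb,
    Equiv.swap_apply_of_ne_of_ne h1 h2]

theorem swap_gs_left : gs b' k = res b k (b (k + 1)) := by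
  rw [gs_eq_res, res_congr (swap_spn hb (Or.inl le_rfl)), hb, Equiv.swap_apply_left]

omit hb in
theorem norm_sq_res_succ (b : ℕ → E) (k : ℕ) (x : E) :
    ‖res b k x‖ ^ 2 = ‖res b (k + 1) x‖ ^ 2 + inner ℝ (gs b k) x ^ 2 / ‖gs b k‖ ^ 2 := by
  have h1 := norm_sq_res b k x
  have h2 := norm_sq_res b (k + 1) x
  rw [sum_range_succ] at h2
  linarith

theorem swap_norm_sq_left : ‖gs b' k‖ ^ 2 =
    ‖gs b (k + 1)‖ ^ 2 + inner ℝ (gs b k) (b (k + 1)) ^ 2 / ‖gs b k‖ ^ 2 := by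
  rw [swap_gs_left hb, norm_sq_res_succ, ← gs_eq_res]

/-- The vector `b k` is decomposed with respect to the exchanged basis, where it stands in position
k + 1. -/
theorem swap_norm_sq_right : ‖gs b k‖ ^ 2 =
    ‖gs b' (k + 1)‖ ^ 2 + inner ℝ (gs b k) (b (k + 1)) ^ 2 / ‖gs b' k‖ ^ 2 := by
  have h1 := norm_sq_res_succ b' k (b k)
  have h2 : res b' (k + 1) (b k) = gs b' (k + 1) := by
    rw [gs_eq_res, hb, Equiv.swap_apply_right]
  -- Both sides are the inner product of the projections of `b k` and `b (k + 1)` orthogonal to the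
  -- first k vectors.
  have h3 : inner ℝ (gs b' k) (b k) = inner ℝ (gs b k) (b (k + 1)) := by
    have h4 : inner ℝ (gs b' k) (b k - res b k (b k)) = 0 := by
      rw [swap_gs_left hb, real_inner_comm]
      exact inner_res_of_mem (sub_res_mem b k _) _
    rw [inner_sub_right, sub_eq_zero, ← gs_eq_res] at h4
    rw [h4, swap_gs_left hb, real_inner_comm, inner_gs_res_of_le b le_rfl]
  rw [res_congr (swap_spn hb (Or.inl le_rfl)), ← gs_eq_res, h2, h3] at h1
  exact h1

/-- Both products are the squared area of the parallelogram spanned by the projections of the two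
exchanged vectors. Consequently only the determinant of index k + 1 changes under an exchange. -/
theorem swap_norm_sq_mul (h0 : gs b k ≠ 0) (h1 : gs b (k + 1) ≠ 0) :
    ‖gs b' k‖ ^ 2 * ‖gs b' (k + 1)‖ ^ 2 = ‖gs b k‖ ^ 2 * ‖gs b (k + 1)‖ ^ 2 := by
  have hl := swap_norm_sq_left hb
  have hr := swap_norm_sq_right hb
  have a0 : 0 < ‖gs b k‖ ^ 2 := by have := norm_pos_iff.2 h0; positivity
  have a1 : 0 < ‖gs b (k + 1)‖ ^ 2 := by have := norm_pos_iff.2 h1; positivity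
  have a2 : 0 < ‖gs b' k‖ ^ 2 := by rw [hl]; positivity
  have e1 : ‖gs b' k‖ ^ 2 * ‖gs b' (k + 1)‖ ^ 2 =
      ‖gs b' k‖ ^ 2 * ‖gs b k‖ ^ 2 - inner ℝ (gs b k) (b (k + 1)) ^ 2 := by
    rw [eq_sub_of_add_eq hr.symm, mul_sub, mul_div_cancel₀ _ a2.ne']
  rw [e1, hl, add_mul, div_mul_cancel₀ _ a0.ne']
  ring

theorem swap_gs_ne_zero {n : ℕ} (hn : k + 2 ≤ n) (h : ∀ i < n, gs b i ≠ 0) :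
    ∀ i < n, gs b' i ≠ 0 := by
  intro i hi
  have hm := swap_norm_sq_mul hb (h k (by omega)) (h (k + 1) (by omega))
  have hp : ‖gs b k‖ ^ 2 * ‖gs b (k + 1)‖ ^ 2 ≠ 0 := by
    have := h k (by omega); have := h (k + 1) (by omega); positivity
  rw [← hm] at hp
  by_cases h1 : i = k
  · subst h1; intro h0; rw [h0] at hp; simp at hp
  by_cases h2 : i = k + 1
  · subst h2; intro h0; rw [h0] at hp; simp at hp
  rw [swap_gs_of_ne hb h1 h2]
  exact h i hi

theorem swap_gd_of_ne {n j : ℕ} (hn : k + 2 ≤ n) (h : ∀ i < n, gs b i ≠ 0) (hj : j ≠ k + 1) :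
    gd b' j = gd b j := by
  have low : gd b' k = gd b k :=
    gd_congr fun i hi => swap_gs_of_ne hb (by omega) (by omega)
  rcases lt_or_gt_of_ne hj with hj | hj
  · exact gd_congr fun i hi => swap_gs_of_ne hb (by omega) (by omega)
  · obtain ⟨t, rfl⟩ : ∃ t, j = k + 2 + t := ⟨j - (k + 2), by omega⟩
    induction t with
    | zero =>
      rw [add_zero, gd_succ, gd_succ, gd_succ, gd_succ, low, mul_assoc, mul_assoc,
        swap_norm_sq_mul hb (h k (by omega)) (h (k + 1) (by omega))]
    | succ t ih =>
      rw [← add_assoc, gd_succ, gd_succ, ih (by omega) (by omega),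
        swap_gs_of_ne hb (by omega) (by omega)]

/-- The factor 3/4 is 1/2 from the exchange condition plus (1/2)² from the size-reduced coefficient.
-/
theorem swap_norm_sq_left_le (hk : |inner ℝ (gs b k) (b (k + 1))| ≤ ‖gs b k‖ ^ 2 / 2)
    (hs : 2 * ‖gs b (k + 1)‖ ^ 2 ≤ ‖gs b k‖ ^ 2) (h0 : gs b k ≠ 0) :
    ‖gs b' k‖ ^ 2 ≤ 3 / 4 * ‖gs b k‖ ^ 2 := by
  have a0 : 0 < ‖gs b k‖ ^ 2 := by have := norm_pos_iff.2 h0; positivity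
  rw [swap_norm_sq_left hb]
  have : inner ℝ (gs b k) (b (k + 1)) ^ 2 / ‖gs b k‖ ^ 2 ≤ ‖gs b k‖ ^ 2 / 4 := by
    rw [div_le_iff₀ a0, ← sq_abs]
    nlinarith [abs_nonneg (inner ℝ (gs b k) (b (k + 1)))]
  linarith

/-- Both new Gram-Schmidt vectors are at most as long as the old `gs b k`. A bound valid for the
input basis therefore persists through all exchanges. -/
theorem swap_norm_gs_le {n : ℕ} {X : ℝ} (hn : k + 2 ≤ n) (h0 : gs b k ≠ 0)
    (hk : |inner ℝ (gs b k) (b (k + 1))| ≤ ‖gs b k‖ ^ 2 / 2)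
    (hs : 2 * ‖gs b (k + 1)‖ ^ 2 ≤ ‖gs b k‖ ^ 2)
    (h : ∀ i < n, ‖gs b i‖ ≤ X) : ∀ i < n, ‖gs b' i‖ ≤ X := by
  intro i hi
  have a0 : 0 < ‖gs b k‖ ^ 2 := by have := norm_pos_iff.2 h0; positivity
  by_cases h1 : i = k
  · subst h1
    refine le_trans ((sq_le_sq₀ (norm_nonneg _) (norm_nonneg _)).1 ?_) (h i hi)
    linarith [swap_norm_sq_left_le hb hk hs h0]
  by_cases h2 : i = k + 1
  · subst h2
    refine le_trans ((sq_le_sq₀ (norm_nonneg _) (norm_nonneg _)).1 ?_) (h k (by omega))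
    have h3 : 0 ≤ inner ℝ (gs b k) (b (k + 1)) ^ 2 / ‖gs b' k‖ ^ 2 := by positivity
    linarith [swap_norm_sq_right hb]
  · rw [swap_gs_of_ne hb h1 h2]
    exact h i hi

end Swap

/-! ### The potential and its decrease -/

/-- The potential of a basis. -/
noncomputable def pot (b : ℕ → E) (n : ℕ) : ℝ := ∏ j ∈ range (n + 1), gd b j

theorem pot_le {b : ℕ → E} {n : ℕ} {X : ℝ} (hX : 1 ≤ X) (h : ∀ i < n, ‖gs b i‖ ≤ X) :
    pot b n ≤ X ^ (2 * n * (n + 1)) := by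
  calc pot b n ≤ ∏ _j ∈ range (n + 1), X ^ (2 * n) :=
        prod_le_prod (fun _ _ => prod_nonneg fun _ _ => by positivity) fun j hj => by
          have hj := mem_range.1 hj
          exact (gd_le fun i hi => h i (by omega)).trans
            (pow_le_pow_right₀ hX (by omega))
    _ = X ^ (2 * n * (n + 1)) := by rw [prod_const, card_range, ← pow_mul]

/-- Of all factors only `gd b (k + 1)` changes, and it changes by the ratio of the squared norms of
the k-th Gram-Schmidt vectors. -/
theorem swap_pot_le {b b' : ℕ → E} {k n : ℕ} (hb : ∀ l, b' l = b (Equiv.swap k (k + 1) l))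
    (hn : k + 2 ≤ n) (h : ∀ i < n, gs b i ≠ 0)
    (hk : |inner ℝ (gs b k) (b (k + 1))| ≤ ‖gs b k‖ ^ 2 / 2)
    (hs : 2 * ‖gs b (k + 1)‖ ^ 2 ≤ ‖gs b k‖ ^ 2) : pot b' n ≤ 3 / 4 * pot b n := by
  have hm : k + 1 ∈ range (n + 1) := mem_range.2 (by omega)
  have hpos : ∀ j ∈ range (n + 1), 0 < gd b j := fun j hj =>
    gd_pos fun i hi => h i (by have := mem_range.1 hj; omega)
  rw [pot, pot, ← mul_prod_erase _ _ hm, ← mul_prod_erase _ _ hm, ← mul_assoc]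
  have e : ∏ x ∈ (range (n + 1)).erase (k + 1), gd b' x =
      ∏ x ∈ (range (n + 1)).erase (k + 1), gd b x :=
    prod_congr rfl fun j hj => swap_gd_of_ne hb hn h (ne_of_mem_erase hj)
  rw [e]
  refine mul_le_mul_of_nonneg_right ?_ (prod_nonneg fun j hj => (hpos j (mem_of_mem_erase hj)).le)
  have h1 := swap_norm_sq_left_le hb hk hs (h k (by omega))
  rw [gd_succ, gd_succ, swap_gd_of_ne hb hn h (by omega)]
  have := (hpos k (mem_range.2 (by omega)))
  nlinarith

theorem one_le_pot {Γ : AddSubgroup E}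
    (hΓ : ∀ x ∈ Γ, ∀ y ∈ Γ, ∃ z : ℤ, inner ℝ x y = (z : ℝ))
    {b : ℕ → E} {n : ℕ} (hb : ∀ i < n, b i ∈ Γ) (h : ∀ i < n, gs b i ≠ 0) : 1 ≤ pot b n := by
  refine Finset.prod_induction _ (fun x : ℝ => 1 ≤ x) (fun x y hx hy => ?_) le_rfl fun j hj => ?_
  · nlinarith
  · have hj := mem_range.1 hj
    exact one_le_gd hΓ (fun i hi => hb i (by omega)) fun i hi => h i (by omega)

/-! #### Size reduction -/

/-- The quotient is ⌊l/d + 1/2⌋, the nearest integer to l/d, written with the integer division that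
the program performs. -/
theorem abs_sub_round_le {l d : ℤ} (hd : 0 < d) :
    |(l : ℝ) - ((2 * l + d) / (2 * d) : ℤ) * d| ≤ d / 2 := by
  set q := (2 * l + d) / (2 * d) with hq
  have h1 : 2 * d * q ≤ 2 * l + d := Int.mul_ediv_self_le (by omega)
  have h2 : 2 * l + d < 2 * d * q + 2 * d := Int.lt_mul_ediv_self_add (by omega)
  have h1' : (2 * d * q : ℝ) ≤ 2 * l + d := by exact_mod_cast h1
  have h2' : (2 * l + d : ℝ) < 2 * d * q + 2 * d := by exact_mod_cast h2
  rw [abs_le]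
  constructor <;> nlinarith

/-- Row `i` is size reduced with respect to the rows `j` with `t ≤ j < i`. -/
def SizeRed (b : ℕ → E) (t i : ℕ) : Prop :=
  ∀ j, t ≤ j → j < i → |inner ℝ (gs b j) (b i)| ≤ ‖gs b j‖ ^ 2 / 2

theorem norm_sq_le_of_sizeRed {b : ℕ → E} {i : ℕ} (h : SizeRed b 0 i)
    (h0 : ∀ j < i, gs b j ≠ 0) : ‖b i‖ ^ 2 ≤ ∑ j ∈ range (i + 1), ‖gs b j‖ ^ 2 := by
  rw [norm_sq_eq, sum_range_succ, add_comm]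
  gcongr with j hj
  have hj := mem_range.1 hj
  have a0 : 0 < ‖gs b j‖ ^ 2 := by have := norm_pos_iff.2 (h0 j hj); positivity
  rw [div_le_iff₀ a0, ← sq_abs]
  have := h j (Nat.zero_le _) hj
  nlinarith [abs_nonneg (inner ℝ (gs b j) (b i))]

/-- Subtracting a multiple of `b j` does not affect the coefficients with index above j, because `b
j` is orthogonal to those Gram-Schmidt vectors. This is why j runs downwards. -/
theorem sizeRed_sub_smul {b b' : ℕ → E} {i j : ℕ} {q : ℤ} (hj : j < i)
    (h : ∀ l, l ≠ i → b' l = b l) (h' : b' i = b i - q • b j)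
    (hr : SizeRed b (j + 1) i)
    (hq : |inner ℝ (gs b j) (b i) - q * ‖gs b j‖ ^ 2| ≤ ‖gs b j‖ ^ 2 / 2) : SizeRed b' j i := by
  intro l hl hli
  rw [gs_sub_smul hj h h', h', inner_sub_right, ← Int.cast_smul_eq_zsmul ℝ, inner_smul_right]
  rcases eq_or_lt_of_le hl with rfl | hlt
  · rw [inner_gs_self]; exact hq
  · rw [inner_gs_of_lt b hlt, mul_zero, sub_zero]
    exact hr l hlt hli

/-- The multiplier q could be large only if `gs b j` were short. But 1 ≤ gd b (j + 1) = gd b j · ‖gs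
b j‖² and gd b j ≤ X^(2j) force ‖gs b j‖ ≥ X^(-j). -/
theorem abs_le_of_round {b : ℕ → E} {j : ℕ} {x : E} {q : ℤ} {X : ℝ} {n : ℕ}
    (hX : 1 ≤ X) (hx : 1 ≤ ‖x‖) (hjn : j < n)
    (hq : |inner ℝ (gs b j) x - q * ‖gs b j‖ ^ 2| ≤ ‖gs b j‖ ^ 2 / 2)
    (hg : ∀ i < n, ‖gs b i‖ ≤ X) (hd : 1 ≤ gd b (j + 1)) :
    |(q : ℝ)| ≤ 2 * X ^ n * ‖x‖ := by
  have hdj : gd b j ≤ X ^ (2 * j) := gd_le fun i hi => hg i (by omega)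
  rw [gd_succ] at hd
  have hpos : 0 < ‖gs b j‖ := by
    rcases (norm_nonneg (gs b j)).eq_or_lt with h | h
    · rw [← h] at hd; norm_num at hd
    · exact h
  have h1 : 1 ≤ X ^ j * ‖gs b j‖ := by
    have : 1 ^ 2 ≤ (X ^ j * ‖gs b j‖) ^ 2 := by
      rw [one_pow, mul_pow, ← pow_mul, mul_comm j 2]
      exact hd.trans (by gcongr)
    exact (sq_le_sq₀ zero_le_one (by positivity)).1 this
  have h2 : |(q : ℝ)| * ‖gs b j‖ ^ 2 ≤ ‖gs b j‖ * ‖x‖ + ‖gs b j‖ ^ 2 / 2 := by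
    have e := norm_sub_le (E := ℝ) (inner ℝ (gs b j) x) (inner ℝ (gs b j) x - q * ‖gs b j‖ ^ 2)
    rw [sub_sub_cancel] at e
    calc |(q : ℝ)| * ‖gs b j‖ ^ 2 = |(q : ℝ) * ‖gs b j‖ ^ 2| := by
          rw [abs_mul, abs_of_nonneg (sq_nonneg ‖gs b j‖)]
      _ ≤ |inner ℝ (gs b j) x| + |inner ℝ (gs b j) x - q * ‖gs b j‖ ^ 2| := e
      _ ≤ _ := add_le_add (abs_real_inner_le_norm _ _) hq
  have h3 : |(q : ℝ)| * ‖gs b j‖ ≤ ‖x‖ + ‖gs b j‖ / 2 := by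
    have : |(q : ℝ)| * ‖gs b j‖ * ‖gs b j‖ ≤ (‖x‖ + ‖gs b j‖ / 2) * ‖gs b j‖ := by nlinarith
    exact le_of_mul_le_mul_right this hpos
  have hj1 : X ^ j ≤ X ^ n := pow_le_pow_right₀ hX hjn.le
  have h5 : |(q : ℝ)| ≤ ‖x‖ * X ^ j + 1 / 2 := by
    have : |(q : ℝ)| * ‖gs b j‖ ≤ (‖x‖ * X ^ j + 1 / 2) * ‖gs b j‖ := by
      refine h3.trans ?_
      have : ‖x‖ * 1 ≤ ‖x‖ * (X ^ j * ‖gs b j‖) := by gcongr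
      linarith
    exact le_of_mul_le_mul_right this hpos
  have h6 : 1 ≤ X ^ n := one_le_pow₀ hX
  nlinarith

theorem norm_sub_smul_le {b : ℕ → E} {j : ℕ} {x : E} {q : ℤ} {X Y : ℝ} {n : ℕ}
    (hX : 1 ≤ X) (hx : 1 ≤ ‖x‖) (hjn : j < n)
    (hq : |inner ℝ (gs b j) x - q * ‖gs b j‖ ^ 2| ≤ ‖gs b j‖ ^ 2 / 2)
    (hg : ∀ i < n, ‖gs b i‖ ≤ X) (hd : 1 ≤ gd b (j + 1)) (hY : ‖b j‖ ≤ Y) :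
    ‖x - q • b j‖ ≤ ‖x‖ * (1 + 2 * X ^ n * Y) := by
  have h4 := abs_le_of_round hX hx hjn hq hg hd
  calc ‖x - q • b j‖ ≤ ‖x‖ + ‖q • b j‖ := norm_sub_le _ _
    _ = ‖x‖ + |(q : ℝ)| * ‖b j‖ := by
        rw [← Int.cast_smul_eq_zsmul ℝ, norm_smul, Real.norm_eq_abs]
    _ ≤ ‖x‖ + (2 * X ^ n * ‖x‖) * Y := by gcongr
    _ = _ := by ring

/-- Size reduced bases whose Gram-Schmidt vectors decrease slowly. -/
structure IsReduced (b : ℕ → E) (n : ℕ) : Prop where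
  gs_ne_zero : ∀ i < n, gs b i ≠ 0
  sizeRed : ∀ i < n, SizeRed b 0 i
  siegel : ∀ i, i + 1 < n → ‖gs b i‖ ^ 2 ≤ 2 * ‖gs b (i + 1)‖ ^ 2

/-! ### Short vectors and the initial segments of a reduced basis -/

namespace IsReduced

variable {b : ℕ → E} {n : ℕ}

theorem norm_sq_gs_le (h : IsReduced b n) {i j : ℕ} (hij : i ≤ j) (hj : j < n) :
    ‖gs b i‖ ^ 2 ≤ 2 ^ (j - i) * ‖gs b j‖ ^ 2 := by
  obtain ⟨t, rfl⟩ := Nat.exists_eq_add_of_le hij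
  induction t with
  | zero => simp
  | succ t ih =>
    have h1 := ih (by omega) (by omega)
    have h2 := h.siegel (i + t) hj
    rw [Nat.add_sub_cancel_left] at h1 ⊢
    rw [pow_succ]
    calc _ ≤ _ := h1
      _ ≤ 2 ^ t * (2 * ‖gs b (i + t + 1)‖ ^ 2) := by gcongr
      _ = _ := by rw [add_assoc]; ring

theorem norm_sq_le (h : IsReduced b n) {i j : ℕ} (hij : i ≤ j) (hj : j < n) :
    ‖b i‖ ^ 2 ≤ n * 2 ^ n * ‖gs b j‖ ^ 2 := by
  refine (norm_sq_le_of_sizeRed (h.sizeRed i (by omega))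
    fun l hl => h.gs_ne_zero l (by omega)).trans ?_
  calc ∑ l ∈ range (i + 1), ‖gs b l‖ ^ 2 ≤ ∑ _l ∈ range (i + 1), 2 ^ n * ‖gs b j‖ ^ 2 := by
        refine sum_le_sum fun l hl => ?_
        have hl := mem_range.1 hl
        refine (h.norm_sq_gs_le (by omega : l ≤ j) hj).trans ?_
        gcongr
        · norm_num
        · omega
    _ = (i + 1 : ℕ) * (2 ^ n * ‖gs b j‖ ^ 2) := by rw [sum_const, card_range, nsmul_eq_mul]
    _ ≤ n * (2 ^ n * ‖gs b j‖ ^ 2) := by gcongr; omega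
    _ = _ := by ring

/-- Basis vectors are dropped from the end as long as the last Gram-Schmidt vector is longer than T:
a lattice vector u of length at most T then has coefficient c with |c| ‖gs b k‖² = |⟨gs b k, u⟩| <
‖gs b k‖², so c = 0. Once the last Gram-Schmidt vector has length at most T, it controls all earlier
basis vectors. -/
theorem exists_short (h : IsReduced b n) (T : ℝ) :
    ∃ j ≤ n, (∀ i < j, ‖b i‖ ^ 2 ≤ n * 2 ^ n * T ^ 2) ∧
      ∀ u ∈ lat b n, ‖u‖ ≤ T → u ∈ lat b j := by
  have key : ∀ k ≤ n, ∃ j ≤ k, (∀ i < j, ‖b i‖ ^ 2 ≤ n * 2 ^ n * T ^ 2) ∧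
      ∀ u ∈ lat b k, ‖u‖ ≤ T → u ∈ lat b j := by
    intro k
    induction k with
    | zero => exact fun _ => ⟨0, le_rfl, by simp, fun u hu _ => hu⟩
    | succ k ih =>
      intro hk
      by_cases hT : ‖gs b k‖ ≤ T
      · refine ⟨k + 1, le_rfl, fun i hi => ?_, fun u hu _ => hu⟩
        refine (h.norm_sq_le (by omega : i ≤ k) hk).trans ?_
        gcongr
      · obtain ⟨j, hj, h1, h2⟩ := ih (by omega)
        refine ⟨j, by omega, h1, fun u hu huT => h2 u ?_ huT⟩
        obtain ⟨c, v, hv, rfl⟩ := mem_lat_succ hu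
        have hin : inner ℝ (gs b k) (c • b k + v) = c * ‖gs b k‖ ^ 2 := by
          have : inner ℝ v (gs b k) = 0 := by
            rw [gs_eq_res]; exact inner_res_of_mem (lat_le_spn b k hv) _
          rw [inner_add_right, real_inner_comm v, this, ← Int.cast_smul_eq_zsmul ℝ,
            inner_smul_right, inner_gs_self, add_zero]
        have hpos : 0 < ‖gs b k‖ := norm_pos_iff.2 (h.gs_ne_zero k hk)
        have hle := abs_real_inner_le_norm (gs b k) (c • b k + v)
        rw [hin, abs_mul, abs_of_nonneg (sq_nonneg ‖gs b k‖)] at hle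
        have hlt : |(c : ℝ)| < 1 := by
          have : |(c : ℝ)| * ‖gs b k‖ ^ 2 < 1 * ‖gs b k‖ ^ 2 := by
            push Not at hT
            nlinarith
          exact lt_of_mul_lt_mul_right this (sq_nonneg _)
        have hc : c = 0 := by
          have : |c| < 1 := by exact_mod_cast hlt
          exact Int.abs_lt_one_iff.1 this
        rw [hc, zero_smul, zero_add]
        exact hv
  exact key n le_rfl

end IsReduced

end LLL

/-! ### Integer vectors in memory -/

namespace LLL

open InnerProductSpace Finset PostProcess RAM

/-- The subgroup of integer vectors. -/
noncomputable def intVecs (N : ℕ) : AddSubgroup (E N) where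
  carrier := Set.range intVec
  zero_mem' := ⟨0, by ext; simp [intVec]⟩
  add_mem' := by
    rintro _ _ ⟨x, rfl⟩ ⟨y, rfl⟩
    exact ⟨x + y, by ext; simp [intVec]⟩
  neg_mem' := by
    rintro _ ⟨x, rfl⟩
    exact ⟨-x, by ext; simp [intVec]⟩

theorem intVec_apply {N : ℕ} (x : Fin N → ℤ) (c : Fin N) : intVec x c = x c := rfl

theorem intVec_mem {N : ℕ} (x : Fin N → ℤ) : intVec x ∈ intVecs N := ⟨x, rfl⟩

theorem inner_intVec {N : ℕ} (x y : Fin N → ℤ) :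
    inner ℝ (intVec x) (intVec y) = ((∑ c, x c * y c : ℤ) : ℝ) := by
  rw [PiLp.inner_apply]
  push_cast
  exact sum_congr rfl fun c _ => by simp [intVec, mul_comm]

theorem intVecs_inner {N : ℕ} :
    ∀ x ∈ intVecs N, ∀ y ∈ intVecs N, ∃ z : ℤ, inner ℝ x y = (z : ℝ) := by
  rintro _ ⟨x, rfl⟩ _ ⟨y, rfl⟩
  exact ⟨_, inner_intVec x y⟩

theorem abs_apply_le_norm {N : ℕ} (x : E N) (c : Fin N) : |x c| ≤ ‖x‖ :=
  PiLp.norm_apply_le x c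

theorem one_le_norm {N : ℕ} {x : E N} (hx : x ∈ intVecs N) (h0 : x ≠ 0) : 1 ≤ ‖x‖ := by
  obtain ⟨x, rfl⟩ := hx
  have h1 : ‖intVec x‖ ^ 2 = ((∑ c, x c * x c : ℤ) : ℝ) := by
    rw [← real_inner_self_eq_norm_sq, inner_intVec]
  have h2 : 0 < ‖intVec x‖ ^ 2 := by have := norm_pos_iff.2 h0; positivity
  rw [h1] at h2
  have h3 : (1 : ℝ) ^ 2 ≤ ‖intVec x‖ ^ 2 := by
    rw [h1]
    exact_mod_cast h2
  exact (sq_le_sq₀ zero_le_one (norm_nonneg _)).1 h3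

/-- Row `i` of the matrix with `N` columns that is stored in the array `f`. -/
noncomputable def row (f : ℕ → ℤ) (N i : ℕ) : E N := intVec fun c : Fin N => f (i * N + c)

theorem row_mem (f : ℕ → ℤ) (N i : ℕ) : row f N i ∈ intVecs N := intVec_mem _

theorem row_apply (f : ℕ → ℤ) {N : ℕ} (i : ℕ) (c : Fin N) : row f N i c = f (i * N + c) := rfl

theorem abs_le_norm_row (f : ℕ → ℤ) {N : ℕ} (i : ℕ) {c : ℕ} (hc : c < N) :
    |(f (i * N + c) : ℝ)| ≤ ‖row f N i‖ :=
  abs_apply_le_norm (row f N i) ⟨c, hc⟩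

theorem row_congr {f g : ℕ → ℤ} {N i j : ℕ} (h : ∀ c < N, f (i * N + c) = g (j * N + c)) :
    row f N i = row g N j := by
  unfold row
  congr 1
  exact funext fun c => h c c.2

theorem row_eq_of_ne {f g : ℕ → ℤ} {N i j : ℕ}
    (h : ∀ k, k < i * N ∨ i * N + N ≤ k → f k = g k) (hj : j ≠ i) : row f N j = row g N j := by
  refine row_congr fun c hc => h _ ?_
  rcases lt_or_gt_of_ne hj with h | h
  · left
    have : (j + 1) * N ≤ i * N := Nat.mul_le_mul_right N h
    rw [add_mul, one_mul] at this
    omega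
  · right
    have : (i + 1) * N ≤ j * N := Nat.mul_le_mul_right N h
    rw [add_mul, one_mul] at this
    omega

theorem inner_row (f g : ℕ → ℤ) (N i j : ℕ) : inner ℝ (row f N i) (row g N j) =
    ((∑ c ∈ range N, f (i * N + c) * g (j * N + c) : ℤ) : ℝ) := by
  rw [row, row, inner_intVec, Finset.sum_range]

/-- Cauchy-Schwarz for prefixes, needed because the program stores each partial sum of an inner
product. -/
theorem abs_partial_dot_le (f g : ℕ → ℤ) {N : ℕ} (i j : ℕ) {k : ℕ} (hk : k ≤ N) :
    |((∑ c ∈ range k, f (i * N + c) * g (j * N + c) : ℤ) : ℝ)| ≤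
      ‖row f N i‖ * ‖row g N j‖ := by
  have key : ∀ (f : ℕ → ℤ) i, ∑ c ∈ range k, (f (i * N + c) : ℝ) ^ 2 ≤ ‖row f N i‖ ^ 2 := by
    intro f i
    rw [EuclideanSpace.real_norm_sq_eq]
    simp only [row_apply]
    rw [← Finset.sum_range fun c => (f (i * N + c) : ℝ) ^ 2]
    exact sum_le_sum_of_subset_of_nonneg (range_mono hk) fun _ _ _ => sq_nonneg _
  refine abs_le_of_sq_le_sq ?_ (by positivity)
  push_cast
  rw [mul_pow]
  exact (sum_mul_sq_le_sq_mul_sq _ _ _).trans (mul_le_mul (key f i) (key g j)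
    (sum_nonneg fun _ _ => sq_nonneg _) (sq_nonneg _))

theorem toNat_index (i N c : ℕ) : ((i : ℤ) * N + c).toNat = i * N + c := by
  exact_mod_cast Int.toNat_natCast (i * N + c)

theorem int_le_of_real_le {z : ℤ} {b : ℕ} {x : ℝ} (h : |(z : ℝ)| ≤ x) (hx : x ≤ 2 ^ b) :
    |z| ≤ 2 ^ b := by
  have := h.trans hx
  exact_mod_cast this

end LLL

/-! ### The programs for orthogonalization and size reduction -/

namespace LLL

open InnerProductSpace Finset PostProcess RAM RAM.Expr RAM.Prog

/-- Index of the entry `(i, c)` of a matrix whose number of columns is in cell `0` of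
array `14`. -/
def entry (a : ℕ) (i c : Expr) : Expr := .get a (.add (.mul i (V 14)) c)

/-- Inner product of row `i` of array `a` and row `k` of array `a'`. -/
def dotProg (a : ℕ) (i : Expr) (a' : ℕ) (k : Expr) : Prog :=
  sumTo 18 17 (V 14) (.mul (entry a i (V 17)) (entry a' k (V 17)))

/-- Array 17 is the column counter and array 18 the accumulator in all programs below. The reduction
keeps its matrix in array 10, scaled Gram-Schmidt vectors in 11, Gram determinants in 12, the
numbers of rows and columns in 13 and 14, and row counters in 15 and 16. -/
theorem run_dotProg {b a a' i k N : ℕ} {ei ek : Expr} {σ : Mem} (hN : σ 14 0 = N) (hNb : N ≤ b)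
    (ha : a ≠ 18 ∧ a ≠ 17) (ha' : a' ≠ 18 ∧ a' ≠ 17)
    (hi : ∀ τ : Mem, (∀ a, a ≠ 18 → a ≠ 17 → τ a = σ a) → ei.eval τ = i)
    (hk : ∀ τ : Mem, (∀ a, a ≠ 18 → a ≠ 17 → τ a = σ a) → ek.eval τ = k)
    (hb : ‖row (σ a) N i‖ * ‖row (σ a') N k‖ ≤ 2 ^ b) :
    ∃ τ, Run b (dotProg a ei a' ek) σ τ ∧
      (τ 18 0 : ℝ) = inner ℝ (row (σ a) N i) (row (σ a') N k) ∧
      ∀ a, a ≠ 18 → a ≠ 17 → τ a = σ a := by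
  obtain ⟨τ, h1, h2, h3⟩ := Run.sumTo (b := b) (acc := 18) (v := 17) (E := V 14)
    (e := .mul (entry a ei (V 17)) (entry a' ek (V 17))) (N := N) (σ := σ)
    (f := fun c => σ a (i * N + c) * σ a' (k * N + c)) hNb (by decide)
    (fun τ h => by simp only [eval, Int.toNat_zero]; rw [h 14 (by decide) (by decide), hN])
    (fun c hc τ h hv => by
      simp only [entry, eval, Int.toNat_zero]
      rw [hi τ h, hk τ h, h 14 (by decide) (by decide), hN, hv, toNat_index, toNat_index,
        h a ha.1 ha.2, h a' ha'.1 ha'.2])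
    (fun k' hk' => int_le_of_real_le (abs_partial_dot_le (σ a) (σ a') i k hk') hb)
  exact ⟨τ, h1, by rw [h2, inner_row], h3⟩

/-- Replace row `i` of array `a` by the values of the expression `e` (with column number in cell
`0` of array `17`). -/
def rowProg (a : ℕ) (i e : Expr) : Prog := vecTo a 17 (V 14) (.add (.mul i (V 14)) (V 17)) e

theorem run_rowProg {b a i N : ℕ} {ei e : Expr} {σ : Mem} {g : ℕ → ℤ} (hN : σ 14 0 = N)
    (hNb : N ≤ b) (ha : a ≠ 17 ∧ a ≠ 14)
    (hi : ∀ τ : Mem, (∀ a', a' ≠ a → a' ≠ 17 → τ a' = σ a') → ei.eval τ = i)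
    (he : ∀ c < N, ∀ τ : Mem, (∀ a', a' ≠ a → a' ≠ 17 → τ a' = σ a') → τ 17 0 = c →
      (∀ k, k < i * N ∨ i * N + c ≤ k → τ a k = σ a k) → e.eval τ = g c)
    (hb : ‖intVec fun c : Fin N => g c‖ ≤ 2 ^ b) :
    ∃ τ, Run b (rowProg a ei e) σ τ ∧ row (τ a) N i = intVec (fun c : Fin N => g c) ∧
      (∀ c < N, τ a (i * N + c) = g c) ∧
      (∀ j, j ≠ i → row (τ a) N j = row (σ a) N j) ∧
      (∀ k, k < i * N ∨ i * N + N ≤ k → τ a k = σ a k) ∧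
      ∀ a', a' ≠ a → a' ≠ 17 → τ a' = σ a' := by
  obtain ⟨τ, h1, h2, h3, h4⟩ := Run.vecTo (b := b) (a := a) (v := 17) (E := V 14)
    (i := .add (.mul ei (V 14)) (V 17)) (e := e) (N := N) (base := i * N) (g := g) (σ := σ)
    hNb ha.1.symm
    (fun τ h => by simp only [eval, Int.toNat_zero]; rw [h 14 ha.2.symm (by decide), hN])
    (fun c hc τ h hv => by
      simp only [eval, Int.toNat_zero]
      rw [hi τ h, h 14 ha.2.symm (by decide), hN, hv]
      push_cast; rfl)
    he
    (fun c hc => int_le_of_real_le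
      (abs_apply_le_norm (intVec fun c : Fin N => g c) ⟨c, hc⟩) hb)
  refine ⟨τ, h1, ?_, h2, fun j hj => row_eq_of_ne h3 hj, h3, h4⟩
  unfold row
  congr 1
  exact funext fun c => h2 c c.2

/-- Data on the memory needed to run the orthogonalization. -/
structure GsInput (b n N : ℕ) (Y Z : ℝ) (σ : Mem) : Prop where
  rows : σ 13 0 = n
  cols : σ 14 0 = N
  n_le : n ≤ b
  N_le : N ≤ b
  one_le_Y : 1 ≤ Y
  one_le_Z : 1 ≤ Z
  bound : Z * Y * Y ≤ 2 ^ b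
  gs_ne_zero : ∀ i < n, gs (row (σ 10) N) i ≠ 0
  norm_le : ∀ i < n, ‖row (σ 10) N i‖ ≤ Y
  gd_le : ∀ i ≤ n, gd (row (σ 10) N) i ≤ Z

theorem GsInput.congr {b n N : ℕ} {Y Z : ℝ} {σ τ : Mem} (h : GsInput b n N Y Z σ)
    (h10 : τ 10 = σ 10) (h13 : τ 13 = σ 13) (h14 : τ 14 = σ 14) : GsInput b n N Y Z τ := by
  obtain ⟨h1, h2, h3, h4, h5, h6, h7, h8, h9, h0⟩ := h
  exact ⟨by rw [h13, h1], by rw [h14, h2], h3, h4, h5, h6, h7, by rw [h10]; exact h8,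
    by rw [h10]; exact h9, by rw [h10]; exact h0⟩

/-- Array `11` holds the first `k` scaled Gram-Schmidt vectors and array `12` the first `k + 1`
Gram determinants. -/
def GsDone (N k : ℕ) (b : ℕ → E N) (σ : Mem) : Prop :=
  (∀ j < k, row (σ 11) N j = gd b j • gs b j) ∧ ∀ j ≤ k, (σ 12 j : ℝ) = gd b j

/-- This is the relation res_(k+1) x = res_k x - (⟨gs_k, x⟩/‖gs_k‖²) gs_k multiplied by gd_(k+1) =
gd_k ‖gs_k‖². The division by D is exact because the result is known to be integral by
`gd_smul_res_mem`. -/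
theorem gs_step_int {N : ℕ} {b : ℕ → E N} {k : ℕ} (hb : ∀ i, b i ∈ intVecs N)
    (h : ∀ i < k + 1, gs b i ≠ 0) {x : E N} (hx : x ∈ intVecs N) {D D' acc : ℤ}
    {u v : ℕ → ℤ} (hD : (D : ℝ) = gd b k) (hD' : (D' : ℝ) = gd b (k + 1))
    (hu : intVec (fun c : Fin N => u c) = gd b k • res b k x)
    (hv : intVec (fun c : Fin N => v c) = gd b k • gs b k)
    (hacc : (acc : ℝ) = inner ℝ x (intVec (fun c : Fin N => v c))) :
    intVec (fun c : Fin N => (D' * u c - acc * v c) / D) = gd b (k + 1) • res b (k + 1) x := by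
  obtain ⟨y, hy⟩ := gd_smul_res_mem intVecs_inner (fun i _ => hb i) h hx
  rw [← hy]
  have hDpos : (0 : ℝ) < gd b k := gd_pos fun i hi => h i (by omega)
  have hD0 : D ≠ 0 := by
    rintro rfl
    rw [Int.cast_zero] at hD
    linarith
  congr 1
  funext c
  apply Int.ediv_eq_of_eq_mul_right hD0
  have hk : ‖gs b k‖ ≠ 0 := by simpa using h k (Nat.lt_succ_self k)
  have huc : (u c : ℝ) = gd b k * res b k x c := congrArg (fun z : E N => z c) hu
  have hvc : (v c : ℝ) = gd b k * gs b k c := congrArg (fun z : E N => z c) hv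
  have hyc : (y c : ℝ) = gd b (k + 1) * res b (k + 1) x c :=
    congrArg (fun z : E N => z c) hy
  have hr : res b (k + 1) x c = res b k x c - inner ℝ (gs b k) x / ‖gs b k‖ ^ 2 * gs b k c := by
    rw [res_succ]; rfl
  rw [hv, inner_smul_right, real_inner_comm] at hacc
  rw [← @Int.cast_inj ℝ]
  push_cast
  rw [huc, hvc, hyc, hr, hacc, hD, hD', gd_succ]
  field_simp

theorem GsInput.gd_nonneg {b n N : ℕ} {Y Z : ℝ} {σ : Mem} (h : GsInput b n N Y Z σ) {k : ℕ}
    (hk : k ≤ n) : 0 ≤ gd (row (σ 10) N) k :=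
  (gd_pos fun i hi => h.gs_ne_zero i (by omega)).le

theorem GsInput.norm_gd_smul_le {b n N : ℕ} {Y Z : ℝ} {σ : Mem} (h : GsInput b n N Y Z σ)
    {i k l : ℕ} (hk : k ≤ n) (hi : i < n) :
    ‖gd (row (σ 10) N) k • res (row (σ 10) N) l (row (σ 10) N i)‖ ≤ Z * Y := by
  rw [norm_smul, Real.norm_of_nonneg (h.gd_nonneg hk)]
  exact mul_le_mul (h.gd_le k hk) ((norm_res_le _ _ _).trans (h.norm_le i hi)) (norm_nonneg _)
    (zero_le_one.trans h.one_le_Z)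

theorem GsInput.ZY_le {b n N : ℕ} {Y Z : ℝ} {σ : Mem} (h : GsInput b n N Y Z σ) :
    Z * Y ≤ 2 ^ b := by
  refine le_trans ?_ h.bound
  have := h.one_le_Z
  have := h.one_le_Y
  exact le_mul_of_one_le_right (by positivity) h.one_le_Y

/-- The inner loop of the orthogonalization. -/
def gsInner : Prog := forTo 16 (V 15)
  (.seq (dotProg 10 (V 15) 11 (V 16))
    (rowProg 11 (V 15) (.div (.sub (.mul (.get 12 (.add (V 16) (.const 1)))
      (entry 11 (V 15) (V 17))) (.mul (V 18) (entry 11 (V 16) (V 17)))) (.get 12 (V 16)))))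

theorem run_gsInner {b n N i : ℕ} {Y Z : ℝ} {σ : Mem} (h : GsInput b n N Y Z σ) (hi : i < n)
    (h15 : σ 15 0 = i) (hd : GsDone N i (row (σ 10) N) σ)
    (hr : row (σ 11) N i = row (σ 10) N i) :
    ∃ τ, Run b gsInner σ τ ∧ (∀ j, j ≠ i → row (τ 11) N j = row (σ 11) N j) ∧
      row (τ 11) N i = gd (row (σ 10) N) i • gs (row (σ 10) N) i := by
  set B := row (σ 10) N with hB
  obtain ⟨τ, h1, h2, h3⟩ := Run.forTo (b := b) (v := 16) (E := V 15)
    (p := .seq (dotProg 10 (V 15) 11 (V 16))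
        (rowProg 11 (V 15) (.div (.sub (.mul (.get 12 (.add (V 16) (.const 1)))
          (entry 11 (V 15) (V 17))) (.mul (V 18) (entry 11 (V 16) (V 17))))
            (.get 12 (V 16))))) (n := i) (σ := σ)
    -- Row i moves through the integral vectors gd_k • res_k (b_i), from b_i at k = 0 to gd_i • gs_i
    -- at k = i.
    (I := fun k τ => (∀ j, j ≠ i → row (τ 11) N j = row (σ 11) N j) ∧
      row (τ 11) N i = gd B k • res B k (B i)) (by have := h.n_le; omega) (by decide)
    (fun k τ z hk => by rw [Mem.write_of_ne (by decide)]; exact hk)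
    ⟨fun _ _ => rfl, by rw [hr, gd_zero, one_smul, res_zero]⟩
    (fun k τ hf _ => by simp only [eval, Int.toNat_zero]; rw [hf 15 (by decide), h15])
    (fun k hk τ hf h16 hI => by
      obtain ⟨hI1, hI2⟩ := hI
      have hck : row (τ 11) N k = gd B k • gs B k := by rw [hI1 k hk.ne, hd.1 k hk]
      obtain ⟨υ, r1, r2, r3⟩ := run_dotProg (b := b) (a := 10) (a' := 11) (i := i) (k := k)
        (N := N) (ei := V 15) (ek := V 16) (σ := τ) (by rw [hf 14 (by decide), h.cols]) h.N_le
        (by decide) (by decide)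
        (fun τ' h' => by
          simp only [eval, Int.toNat_zero]
          rw [h' 15 (by decide) (by decide), hf 15 (by decide), h15])
        (fun τ' h' => by
          simp only [eval, Int.toNat_zero]
          rw [h' 16 (by decide) (by decide), h16])
        (by
          rw [hf 10 (by decide), hck]
          refine le_trans (mul_le_mul (h.norm_le i hi) (?_ : _ ≤ Z * Y) (norm_nonneg _)
            (zero_le_one.trans h.one_le_Y)) (le_trans (le_of_eq ?_) h.bound)
          · rw [gs_eq_res]; exact h.norm_gd_smul_le (by omega) (by omega)
          · ring)
      have hval := gs_step_int (N := N) (b := B) (k := k) (fun j => row_mem _ _ _)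
        (fun j hj => h.gs_ne_zero j (by omega)) (x := B i) (row_mem _ _ _)
        (D := τ 12 k) (D' := τ 12 (k + 1)) (acc := υ 18 0)
        (u := fun c => τ 11 (i * N + c)) (v := fun c => τ 11 (k * N + c))
        (by rw [hf 12 (by decide), hd.2 k hk.le]) (by rw [hf 12 (by decide), hd.2 (k + 1) hk])
        hI2 hck (by rw [r2, hf 10 (by decide)]; rfl)
      obtain ⟨ρ, s1, s2, -, s3, -, s4⟩ := run_rowProg (b := b) (a := 11) (i := i) (N := N)
        (ei := V 15)
        (e := .div (.sub (.mul (.get 12 (.add (V 16) (.const 1)))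
          (entry 11 (V 15) (V 17))) (.mul (V 18) (entry 11 (V 16) (V 17))))
            (.get 12 (V 16))) (σ := υ)
        (g := fun c => (τ 12 (k + 1) * τ 11 (i * N + c) - υ 18 0 * τ 11 (k * N + c)) / τ 12 k)
        (by rw [r3 14 (by decide) (by decide), hf 14 (by decide), h.cols]) h.N_le (by decide)
        (fun τ' h' => by
          simp only [eval, Int.toNat_zero]
          rw [h' 15 (by decide) (by decide), r3 15 (by decide) (by decide), hf 15 (by decide),
            h15])
        (fun c hc τ' h' h17 hk' => by
          have e14 : τ' 14 0 = N := by
            rw [h' 14 (by decide) (by decide), r3 14 (by decide) (by decide), hf 14 (by decide),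
              h.cols]
          have e15 : τ' 15 0 = i := by
            rw [h' 15 (by decide) (by decide), r3 15 (by decide) (by decide), hf 15 (by decide),
              h15]
          have e16 : τ' 16 0 = k := by
            rw [h' 16 (by decide) (by decide), r3 16 (by decide) (by decide), h16]
          have e18 : τ' 18 = υ 18 := h' 18 (by decide) (by decide)
          have e12 : τ' 12 = τ 12 := by
            rw [h' 12 (by decide) (by decide), r3 12 (by decide) (by decide)]
          have ei : τ' 11 (i * N + c) = τ 11 (i * N + c) := by
            rw [hk' _ (Or.inr le_rfl), r3 11 (by decide) (by decide)]
          have ek : τ' 11 (k * N + c) = τ 11 (k * N + c) := by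
            rw [hk' _ (Or.inl _), r3 11 (by decide) (by decide)]
            have : (k + 1) * N ≤ i * N := Nat.mul_le_mul_right N hk
            rw [add_mul, one_mul] at this
            omega
          simp only [entry, eval, Int.toNat_zero, e14, e15, e16, h17, toNat_index, ei, ek, e18,
            e12, Int.toNat_natCast]
          rfl)
        (by rw [hval]; exact (h.norm_gd_smul_le (by omega) hi).trans h.ZY_le)
      refine ⟨ρ, ⟨υ, r1, s1⟩, fun j hj => ?_, by rw [s2, hval]⟩
      rw [s3 j hj, r3 11 (by decide) (by decide), hI1 j hj])
  exact ⟨τ, h1, h2, by rw [h3, ← gs_eq_res]⟩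

/-- Computes the scaled Gram-Schmidt vectors `gd b i • gs b i` of the rows of array `10` in
array `11` and the determinants `gd b i` in array `12`. -/
def gsProg : Prog :=
  .seq (.set 12 (.const 0) (.const 1)) (forTo 15 (V 13)
    (.seq (rowProg 11 (V 15) (entry 10 (V 15) (V 17)))
    (.seq gsInner
    (.seq (dotProg 10 (V 15) 11 (V 15))
      (.set 12 (.add (V 15) (.const 1)) (V 18))))))

theorem run_gsProg {b n N : ℕ} {Y Z : ℝ} {σ : Mem} (h : GsInput b n N Y Z σ) :
    ∃ τ, Run b gsProg σ τ ∧ GsDone N n (row (σ 10) N) τ := by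
  set B := row (σ 10) N with hB
  have hw : ∀ a, a ≠ 12 → σ.write 12 0 1 a = σ a := fun a ha => Mem.write_of_ne ha _ _
  obtain ⟨τ, h1, h2⟩ := Run.forTo (b := b) (v := 15) (E := V 13)
    (p := .seq (rowProg 11 (V 15) (entry 10 (V 15) (V 17)))
      (.seq gsInner (.seq (dotProg 10 (V 15) 11 (V 15))
        (.set 12 (.add (V 15) (.const 1)) (V 18))))) (n := n) (σ := σ.write 12 0 1)
    (I := fun k τ => GsDone N k B τ) h.n_le (by decide)
    (fun k τ z hk => by
      unfold GsDone; rw [Mem.write_of_ne (by decide), Mem.write_of_ne (by decide)]; exact hk)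
    ⟨by simp, fun j hj => by
      obtain rfl : j = 0 := by omega
      rw [Mem.write_self, gd_zero, Int.cast_one]⟩
    (fun k τ hf _ => by
      simp only [eval, Int.toNat_zero]; rw [hf 13 (by decide), hw 13 (by decide), h.rows])
    (fun i hi τ hf h15 hI => by
      have t10 : τ 10 = σ 10 := by rw [hf 10 (by decide), hw 10 (by decide)]
      have t13 : τ 13 = σ 13 := by rw [hf 13 (by decide), hw 13 (by decide)]
      have t14 : τ 14 = σ 14 := by rw [hf 14 (by decide), hw 14 (by decide)]
      have hτ : GsInput b n N Y Z τ := h.congr t10 t13 t14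
      have hYb : Y ≤ 2 ^ b := by
        refine le_trans ?_ h.ZY_le
        exact le_mul_of_one_le_left (zero_le_one.trans h.one_le_Y) h.one_le_Z
      obtain ⟨υ, s1, s2, -, s3, -, s4⟩ := run_rowProg (b := b) (a := 11) (i := i) (N := N)
        (ei := V 15) (e := entry 10 (V 15) (V 17)) (σ := τ) (g := fun c => τ 10 (i * N + c))
        hτ.cols h.N_le (by decide)
        (fun τ' h' => by
          simp only [eval, Int.toNat_zero]
          rw [h' 15 (by decide) (by decide), h15])
        (fun c hc τ' h' h17 _ => by
          simp only [entry, eval, Int.toNat_zero]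
          rw [h' 15 (by decide) (by decide), h' 14 (by decide) (by decide),
            h' 10 (by decide) (by decide), h17, h15, hτ.cols, toNat_index])
        ((hτ.norm_le i hi).trans hYb)
      have u10 : υ 10 = σ 10 := by rw [s4 10 (by decide) (by decide), t10]
      have hυ : GsInput b n N Y Z υ := h.congr u10
        (by rw [s4 13 (by decide) (by decide), t13]) (by rw [s4 14 (by decide) (by decide), t14])
      have hυd : GsDone N i (row (υ 10) N) υ := by
        rw [u10]
        refine ⟨fun j hj => by rw [s3 j hj.ne, hI.1 j hj], fun j hj => ?_⟩
        rw [s4 12 (by decide) (by decide), hI.2 j hj]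
      obtain ⟨ρ, r1, r2, r3⟩ := run_gsInner hυ hi
        (by rw [s4 15 (by decide) (by decide), h15]) hυd (by rw [s2, u10, ← t10]; rfl)
      rw [u10] at r3
      have f1 : ∀ a, a ∉ gsInner.writes → ρ a = υ a := fun a ha => r1.frame ha
      obtain ⟨π, p1, p2, p3⟩ := run_dotProg (b := b) (a := 10) (a' := 11) (i := i) (k := i)
        (N := N) (ei := V 15) (ek := V 15) (σ := ρ)
        (by rw [f1 14 (by decide), hυ.cols]) h.N_le (by decide) (by decide)
        (fun τ' h' => by
          simp only [eval, Int.toNat_zero]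
          rw [h' 15 (by decide) (by decide), f1 15 (by decide), s4 15 (by decide) (by decide),
            h15])
        (fun τ' h' => by
          simp only [eval, Int.toNat_zero]
          rw [h' 15 (by decide) (by decide), f1 15 (by decide), s4 15 (by decide) (by decide),
            h15])
        (by
          rw [f1 10 (by decide), u10, r3]
          refine le_trans (mul_le_mul (h.norm_le i hi) (?_ : _ ≤ Z * Y) (norm_nonneg _)
            (zero_le_one.trans h.one_le_Y)) (le_trans (le_of_eq ?_) h.bound)
          · rw [gs_eq_res]; exact h.norm_gd_smul_le (by omega) (by omega)
          · ring)
      -- The next determinant is a by-product: ⟨b_i, gd_i • gs_i⟩ = gd_i ‖gs_i‖².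
      have hacc : (π 18 0 : ℝ) = gd B (i + 1) := by
        rw [p2, f1 10 (by decide), u10, r3, inner_smul_right, real_inner_comm, inner_gs_self,
          gd_succ]
      have e15 : π 15 0 = i := by
        rw [p3 15 (by decide) (by decide), f1 15 (by decide), s4 15 (by decide) (by decide), h15]
      refine ⟨_, ⟨υ, s1, ρ, r1, π, p1, ?_, rfl⟩, fun j hj => ?_, fun j hj => ?_⟩
      · refine int_le_of_real_le (x := Z) ?_ ?_
        · simp only [eval, Int.toNat_zero]
          rw [hacc, abs_of_nonneg (h.gd_nonneg (by omega))]
          exact h.gd_le _ (by omega)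
        · exact le_trans (le_mul_of_one_le_right (zero_le_one.trans h.one_le_Z) h.one_le_Y) h.ZY_le
      · rw [Mem.write_of_ne (by decide), p3 11 (by decide) (by decide)]
        rcases Nat.lt_succ_iff_lt_or_eq.1 hj with hj | rfl
        · rw [r2 j hj.ne, s3 j hj.ne, hI.1 j hj]
        · exact r3
      · have ei : ((Expr.add (V 15) (.const 1)).eval π).toNat = i + 1 := by
          simp only [eval, Int.toNat_zero, e15]
          omega
        rw [ei]
        rcases Nat.le_succ_iff.1 hj with hj | rfl
        · rw [Mem.write_of_ne_index _ _ (by omega), p3 12 (by decide) (by decide),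
            f1 12 (by decide), s4 12 (by decide) (by decide), hI.2 j hj]
        · rw [Mem.write_self]
          simp only [eval, Int.toNat_zero]
          exact hacc)
  exact ⟨τ, ⟨_, Run.set_const_zero rfl (by simp [eval, one_le_pow₀]), h1⟩, h2⟩

end LLL

namespace LLL

open InnerProductSpace Finset PostProcess RAM RAM.Expr RAM.Prog

/-! ### Size reduction -/

/-- The number `i - 1 - k` of the row that is subtracted from row `i` in step `k`. -/
def srIndex : Expr := .sub (.sub (V 15) (V 16)) (.const 1)

/-- Size reduction of row `i`, the content of cell `0` of array `15`. -/
def srInner : Prog := forTo 16 (V 15)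
  (.seq (dotProg 10 (V 15) 11 srIndex)
  (.seq (.set 19 (.const 0) (.div
    (.add (.mul (.const 2) (V 18)) (.get 12 (.add srIndex (.const 1))))
    (.mul (.const 2) (.get 12 (.add srIndex (.const 1))))))
  (rowProg 10 (V 15) (.sub (entry 10 (V 15) (V 17)) (.mul (V 19) (entry 10 srIndex (V 17)))))))

/-- Size reduction of all rows of array `10`. -/
def srProg : Prog := forTo 15 (V 13) srInner

/-- `b` and `b'` have the same Gram-Schmidt vectors and generate the same lattice. -/
def SameGs {N : ℕ} (n : ℕ) (b b' : ℕ → E N) : Prop :=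
  (∀ l, gs b' l = gs b l) ∧ lat b' n = lat b n

theorem SameGs.trans {N n : ℕ} {b b' b'' : ℕ → E N} (h : SameGs n b b') (h' : SameGs n b' b'') :
    SameGs n b b'' :=
  ⟨fun l => (h'.1 l).trans (h.1 l), h'.2.trans h.2⟩

/-- Data on the memory needed to run the size reduction; `b₀` is the original basis. -/
structure SrInput (b n N : ℕ) (X Y Z : ℝ) (b₀ : ℕ → E N) (σ : Mem) : Prop where
  rows : σ 13 0 = n
  cols : σ 14 0 = N
  n_le : n ≤ b
  N_le : N ≤ b
  one_le_X : 1 ≤ X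
  one_le_Y : 1 ≤ Y
  one_le_Z : 1 ≤ Z
  bound : Z * Y * Y * (1 + 2 * X ^ n * Y) ^ (n + 1) ≤ 2 ^ b
  X_le_Y : n * X ^ 2 ≤ Y ^ 2
  gs_ne_zero : ∀ i < n, gs b₀ i ≠ 0
  norm_gs_le : ∀ i < n, ‖gs b₀ i‖ ≤ X
  one_le_gd : ∀ i ≤ n, 1 ≤ gd b₀ i
  gd_le : ∀ i ≤ n, gd b₀ i ≤ Z
  done : GsDone N n b₀ σ
  same : SameGs n b₀ (row (σ 10) N)

theorem SrInput.congr {b n N : ℕ} {X Y Z : ℝ} {b₀ : ℕ → E N} {σ τ : Mem}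
    (h : SrInput b n N X Y Z b₀ σ) (h11 : τ 11 = σ 11) (h12 : τ 12 = σ 12) (h13 : τ 13 = σ 13)
    (h14 : τ 14 = σ 14) (hs : SameGs n b₀ (row (τ 10) N)) : SrInput b n N X Y Z b₀ τ :=
  { h with
    rows := by rw [h13, h.rows]
    cols := by rw [h14, h.cols]
    done := by unfold GsDone; rw [h11, h12]; exact h.done
    same := hs }

/-- The Gram-Schmidt data stay valid throughout, since size reduction does not change them. In each
of the at most n steps the row may grow by the factor G = 1 + 2 X^n Y, which explains the power of G
in `bound`. When the row is finished, being size reduced brings its length back below √n X ≤ Y. -/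
theorem run_srInner {b n N i : ℕ} {X Y Z : ℝ} {b₀ : ℕ → E N} {σ : Mem}
    (h : SrInput b n N X Y Z b₀ σ) (hY : ∀ l < n, ‖row (σ 10) N l‖ ≤ Y) (hi : i < n)
    (h15 : σ 15 0 = i) :
    ∃ τ, Run b srInner σ τ ∧ SameGs n b₀ (row (τ 10) N) ∧
      (∀ j, j ≠ i → row (τ 10) N j = row (σ 10) N j) ∧ SizeRed (row (τ 10) N) 0 i := by
  set G := 1 + 2 * X ^ n * Y with hG
  have hX := h.one_le_X
  have hY1 := h.one_le_Y
  have hZ1 := h.one_le_Z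
  have hXn : 1 ≤ X ^ n := one_le_pow₀ hX
  have hG1 : 1 ≤ G := by rw [hG]; nlinarith [mul_nonneg (zero_le_one.trans hXn) (zero_le_one.trans hY1)]
  have hG2 : 2 * X ^ n ≤ G := by rw [hG]; nlinarith [mul_le_mul_of_nonneg_left hY1 (zero_le_one.trans hXn)]
  have hGk : ∀ k ≤ n + 1, Y * G ^ k ≤ 2 ^ b ∧ Y * G ^ k * (Z * Y) ≤ 2 ^ b := by
    intro k hk
    have h1 : G ^ k ≤ G ^ (n + 1) := pow_le_pow_right₀ hG1 hk
    have h2 : Y * G ^ k * (Z * Y) ≤ 2 ^ b := by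
      refine le_trans (le_of_eq_of_le ?_ (mul_le_mul_of_nonneg_left h1 (by positivity :
        0 ≤ Z * Y * Y))) h.bound
      ring
    refine ⟨le_trans (le_mul_of_one_le_right (by positivity) ?_) h2, h2⟩
    nlinarith
  obtain ⟨τ, h1, h2, h3, h4, -⟩ := Run.forTo (b := b) (v := 16) (E := V 15)
    (p := .seq (dotProg 10 (V 15) 11 srIndex)
      (.seq (.set 19 (.const 0) (.div
        (.add (.mul (.const 2) (V 18)) (.get 12 (.add srIndex (.const 1))))
        (.mul (.const 2) (.get 12 (.add srIndex (.const 1))))))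
      (rowProg 10 (V 15) (.sub (entry 10 (V 15) (V 17))
        (.mul (V 19) (entry 10 srIndex (V 17))))))) (n := i) (σ := σ)
    (I := fun k τ => SameGs n b₀ (row (τ 10) N) ∧
      (∀ j, j ≠ i → row (τ 10) N j = row (σ 10) N j) ∧ SizeRed (row (τ 10) N) (i - k) i ∧
      ‖row (τ 10) N i‖ ≤ Y * G ^ k) (by have := h.n_le; omega) (by decide)
    (fun k τ z hk => by rw [Mem.write_of_ne (by decide)]; exact hk)
    ⟨h.same, fun _ _ => rfl, fun j h1 h2 => by omega, by simpa using hY i hi⟩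
    (fun k τ hf _ => by simp only [eval, Int.toNat_zero]; rw [hf 15 (by decide), h15])
    (fun k hk τ hf h16 hI => by
      obtain ⟨hI1, hI2, hI3, hI4⟩ := hI
      have hkn : i - 1 - k < i := by omega
      obtain ⟨j, hj⟩ : ∃ j, j = i - 1 - k := ⟨_, rfl⟩
      have hji : j < i := by omega
      set B := row (τ 10) N with hB
      have hτ : SrInput b n N X Y Z b₀ τ := h.congr (hf 11 (by decide)) (hf 12 (by decide))
        (hf 13 (by decide)) (hf 14 (by decide)) hI1
      have t15 : τ 15 0 = i := by rw [hf 15 (by decide), h15]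
      have hcj : row (τ 11) N j = gd b₀ j • gs b₀ j := hτ.done.1 j (by omega)
      have hidx : ∀ τ' : Mem, τ' 15 = τ 15 → τ' 16 = τ 16 → srIndex.eval τ' = j := by
        intro τ' h1 h2
        simp only [srIndex, eval, Int.toNat_zero, h1, h2, t15, h16]
        omega
      have hgs0 : gs b₀ j ≠ 0 := h.gs_ne_zero j (by omega)
      have hgd0 : 0 < gd b₀ j := gd_pos fun l hl => h.gs_ne_zero l (by omega)
      obtain ⟨υ, r1, r2, r3⟩ := run_dotProg (b := b) (a := 10) (a' := 11) (i := i) (k := j)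
        (N := N) (ei := V 15) (ek := srIndex) (σ := τ) hτ.cols h.N_le
        (by decide) (by decide)
        (fun τ' h' => by
          simp only [eval, Int.toNat_zero]
          rw [h' 15 (by decide) (by decide), t15])
        (fun τ' h' => hidx τ' (h' 15 (by decide) (by decide)) (h' 16 (by decide) (by decide)))
        (by
          rw [hcj, norm_smul, Real.norm_of_nonneg hgd0.le]
          refine le_trans (mul_le_mul hI4 (mul_le_mul (h.gd_le j (by omega)) (?_ : _ ≤ Y)
            (norm_nonneg _) (by positivity)) (by positivity) (by positivity))
            (hGk k (by omega)).2
          refine (h.norm_gs_le j (by omega)).trans ?_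
          refine (sq_le_sq₀ (by positivity) (by positivity)).1 (le_trans ?_ h.X_le_Y)
          have : (1 : ℝ) ≤ n := by exact_mod_cast (by omega : 1 ≤ n)
          nlinarith [sq_nonneg X])
      obtain ⟨d, hd⟩ : ∃ d : ℤ, d = τ 12 (j + 1) := ⟨_, rfl⟩
      have hdr : (d : ℝ) = gd b₀ (j + 1) := by rw [hd, hτ.done.2 (j + 1) (by omega)]
      have hd1 : 1 ≤ gd b₀ (j + 1) := h.one_le_gd _ (by omega)
      have hdpos : 0 < d := by
        have : (0 : ℝ) < d := by rw [hdr]; linarith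
        exact_mod_cast this
      obtain ⟨q, hq⟩ : ∃ q : ℤ, q = (2 * υ 18 0 + d) / (2 * d) := ⟨_, rfl⟩
      have hgsB : ∀ l, gs B l = gs b₀ l := hI1.1
      -- Memory holds gd_j ⟨gs_j, b_i⟩ and gd_(j+1) = gd_j ‖gs_j‖². The common factor gd_j cancels,
      -- so q is the rounded Gram-Schmidt coefficient.
      have hround : |inner ℝ (gs B j) (B i) - q * ‖gs B j‖ ^ 2| ≤ ‖gs B j‖ ^ 2 / 2 := by
        have e := abs_sub_round_le (l := υ 18 0) hdpos
        rw [← hq, r2, hcj, inner_smul_right, hdr, gd_succ, real_inner_comm, ← hgsB] at e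
        have e2 : gd b₀ j * inner ℝ (gs B j) (B i) - q * (gd b₀ j * ‖gs B j‖ ^ 2) =
          gd b₀ j * (inner ℝ (gs B j) (B i) - q * ‖gs B j‖ ^ 2) := by ring
        rw [e2, abs_mul, abs_of_pos hgd0, mul_div_assoc] at e
        exact le_of_mul_le_mul_left e hgd0
      have hBi : 1 ≤ ‖B i‖ := one_le_norm (row_mem _ _ _) fun h0 => by
        have := norm_gs_le B i
        rw [h0, norm_zero, norm_le_zero_iff, hgsB] at this
        exact h.gs_ne_zero i hi this
      have hgX : ∀ l < n, ‖gs B l‖ ≤ X := fun l hl => by rw [hgsB]; exact h.norm_gs_le l hl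
      have hgdB : 1 ≤ gd B (j + 1) := by rw [gd_congr fun l _ => hgsB l]; exact hd1
      have hqle := abs_le_of_round hX hBi (by omega : j < n) hround hgX hgdB
      have hYj : ‖B j‖ ≤ Y := by rw [hI2 j hji.ne]; exact hY j (by omega)
      have hnew := norm_sub_smul_le hX hBi (by omega : j < n) hround hgX hgdB hYj
      have hnew' : ‖B i - q • B j‖ ≤ Y * G ^ (k + 1) := by
        refine hnew.trans ?_
        rw [pow_succ, ← mul_assoc]
        exact mul_le_mul_of_nonneg_right hI4 (by positivity)
      have hrow : intVec (fun c : Fin N => τ 10 (i * N + c) - q * τ 10 (j * N + c)) =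
          B i - q • B j := by
        ext c
        rw [← Int.cast_smul_eq_zsmul ℝ]
        simp [intVec_apply, hB, row_apply]
      have hυ' : ∀ a, a ≠ 19 → υ.write 19 0 q a = υ a := fun a ha => Mem.write_of_ne ha _ _
      obtain ⟨ρ, s1, s2, -, s3, -, s4⟩ := run_rowProg (b := b) (a := 10) (i := i) (N := N)
        (ei := V 15)
        (e := .sub (entry 10 (V 15) (V 17)) (.mul (V 19) (entry 10 srIndex (V 17))))
        (σ := υ.write 19 0 q)
        (g := fun c => τ 10 (i * N + c) - q * τ 10 (j * N + c))
        (by rw [hυ' 14 (by decide), r3 14 (by decide) (by decide), hτ.cols]) h.N_le (by decide)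
        (fun τ' h' => by
          simp only [eval, Int.toNat_zero]
          rw [h' 15 (by decide) (by decide), hυ' 15 (by decide), r3 15 (by decide) (by decide),
            t15])
        (fun c hc τ' h' h17 hk' => by
          have e14 : τ' 14 0 = N := by
            rw [h' 14 (by decide) (by decide), hυ' 14 (by decide), r3 14 (by decide) (by decide),
              hτ.cols]
          have e15 : τ' 15 = τ 15 := by
            rw [h' 15 (by decide) (by decide), hυ' 15 (by decide), r3 15 (by decide) (by decide)]
          have e16 : τ' 16 = τ 16 := by
            rw [h' 16 (by decide) (by decide), hυ' 16 (by decide), r3 16 (by decide) (by decide)]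
          have e19 : τ' 19 0 = q := by rw [h' 19 (by decide) (by decide), Mem.write_self]
          have ei : τ' 10 (i * N + c) = τ 10 (i * N + c) := by
            rw [hk' _ (Or.inr le_rfl), hυ' 10 (by decide), r3 10 (by decide) (by decide)]
          have ek : τ' 10 (j * N + c) = τ 10 (j * N + c) := by
            rw [hk' _ (Or.inl _), hυ' 10 (by decide), r3 10 (by decide) (by decide)]
            have : (j + 1) * N ≤ i * N := Nat.mul_le_mul_right N hji
            rw [add_mul, one_mul] at this
            omega
          simp only [entry, eval, Int.toNat_zero, e14, hidx τ' e15 e16, h17, toNat_index, ek,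
            e19, e15, t15, ei])
        (by rw [hrow]; exact hnew'.trans (hGk _ (by omega)).1)
      rw [hrow] at s2
      have s3' : ∀ l, l ≠ i → row (ρ 10) N l = B l := fun l hl => by
        rw [s3 l hl, hυ' 10 (by decide), r3 10 (by decide) (by decide)]
      refine ⟨ρ, ⟨υ, r1, _, Run.set_const_zero (z := q) ?_ ?_, s1⟩, ?_, ?_, ?_, ?_⟩
      · simp only [eval, Int.toNat_zero]
        rw [hidx υ (r3 15 (by decide) (by decide)) (r3 16 (by decide) (by decide)),
          r3 12 (by decide) (by decide), show ((j : ℤ) + 1).toNat = j + 1 by omega, ← hd, hq]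
      · refine int_le_of_real_le (hqle.trans ?_) (hGk (k + 1) (by omega)).1
        calc 2 * X ^ n * ‖B i‖ ≤ G * (Y * G ^ k) := by gcongr
          _ = Y * G ^ (k + 1) := by rw [pow_succ]; ring
      · exact hI1.trans ⟨gs_sub_smul hji s3' s2, lat_sub_smul hji hi s3' s2⟩
      · intro l hl
        rw [s3' l hl, hI2 l hl]
      · have := sizeRed_sub_smul hji s3' s2 (by rw [show j + 1 = i - k by omega]; exact hI3) hround
        rwa [show i - (k + 1) = j by omega]
      · rw [s2]; exact hnew')
  rw [Nat.sub_self] at h4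
  exact ⟨τ, h1, h2, h3, h4⟩

theorem run_srProg {b n N : ℕ} {X Y Z : ℝ} {b₀ : ℕ → E N} {σ : Mem}
    (h : SrInput b n N X Y Z b₀ σ) (hY : ∀ l < n, ‖row (σ 10) N l‖ ≤ Y) :
    ∃ τ, Run b srProg σ τ ∧ SameGs n b₀ (row (τ 10) N) ∧
      (∀ i < n, SizeRed (row (τ 10) N) 0 i) ∧ ∀ i < n, ‖row (τ 10) N i‖ ≤ Y := by
  have hY1 := h.one_le_Y
  obtain ⟨τ, h1, h2, h3, h4⟩ := Run.forTo (b := b) (v := 15) (E := V 13)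
    (p := srInner) (n := n) (σ := σ)
    (I := fun k τ => SameGs n b₀ (row (τ 10) N) ∧ (∀ i < k, SizeRed (row (τ 10) N) 0 i) ∧
      ∀ i < n, ‖row (τ 10) N i‖ ≤ Y) h.n_le (by decide)
    (fun k τ z hk => by rw [Mem.write_of_ne (by decide)]; exact hk)
    ⟨h.same, by simp, hY⟩
    (fun k τ hf _ => by simp only [eval, Int.toNat_zero]; rw [hf 13 (by decide), h.rows])
    (fun i hi τ hf h15 hI => by
      obtain ⟨hI1, hI2, hI3⟩ := hI
      have hτ : SrInput b n N X Y Z b₀ τ := h.congr (hf 11 (by decide)) (hf 12 (by decide))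
        (hf 13 (by decide)) (hf 14 (by decide)) hI1
      obtain ⟨υ, r1, r2, r3, r4⟩ := run_srInner hτ hI3 hi h15
      have hsr : ∀ l < i + 1, SizeRed (row (υ 10) N) 0 l := by
        intro l hl
        rcases Nat.lt_succ_iff_lt_or_eq.1 hl with hl | rfl
        · intro j h1 h2
          rw [r3 l hl.ne, r2.1, ← hI1.1]
          exact hI2 l hl j h1 h2
        · exact r4
      refine ⟨υ, r1, r2, hsr, fun l hl => ?_⟩
      rcases eq_or_ne l i with rfl | hne
      · refine (sq_le_sq₀ (norm_nonneg _) (by positivity)).1 (le_trans ?_ h.X_le_Y)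
        refine (norm_sq_le_of_sizeRed r4 fun j hj => ?_).trans ?_
        · rw [r2.1]; exact h.gs_ne_zero j (by omega)
        · calc ∑ j ∈ range (l + 1), ‖gs (row (υ 10) N) j‖ ^ 2 ≤ ∑ _j ∈ range (l + 1), X ^ 2 := by
                refine sum_le_sum fun j hj => ?_
                have hj := mem_range.1 hj
                rw [r2.1]
                have := h.norm_gs_le j (by omega)
                gcongr
            _ = (l + 1 : ℕ) * X ^ 2 := by rw [sum_const, card_range, nsmul_eq_mul]
            _ ≤ n * X ^ 2 := by gcongr; omega
      · rw [r3 l hne]; exact hI3 l hl)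
  exact ⟨τ, h1, h2, h3, h4⟩

end LLL

namespace LLL

open InnerProductSpace Finset PostProcess RAM RAM.Expr RAM.Prog

/-! ### Exchange step and main loop -/

/-- Cell `0` of array `20` becomes `k + 1` for an index `k` that calls for an exchange of the
rows `k` and `k + 1`, and `0` if there is none. -/
def findProg : Prog :=
  .seq (.set 20 (.const 0) (.const 0)) (forTo 15 (V 13)
    (.ifPos (.sub (.sub (V 13) (V 15)) (.const 1))
      (.ifPos (.sub (.mul (.get 12 (.add (V 15) (.const 1))) (.get 12 (.add (V 15) (.const 1))))
        (.mul (.const 2) (.mul (.get 12 (V 15)) (.get 12 (.add (V 15) (.const 2))))))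
        (.set 20 (.const 0) (.add (V 15) (.const 1))) .skip) .skip))

/-- The lengths are compared through the determinants: gd_(k+1)² > 2 gd_k gd_(k+2) means ‖gs_k‖² > 2
‖gs_(k+1)‖². -/
theorem run_findProg {b n N : ℕ} {b₀ : ℕ → E N} {σ : Mem} (hn : σ 13 0 = n) (hnb : n ≤ b)
    (h0 : ∀ i < n, gs b₀ i ≠ 0) (hd : GsDone N n b₀ σ) :
    ∃ τ, Run b findProg σ τ ∧
      ((τ 20 0 = 0 ∧ ∀ k, k + 1 < n → ‖gs b₀ k‖ ^ 2 ≤ 2 * ‖gs b₀ (k + 1)‖ ^ 2) ∨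
        ∃ k, k + 1 < n ∧ τ 20 0 = (k + 1 : ℕ) ∧ 2 * ‖gs b₀ (k + 1)‖ ^ 2 ≤ ‖gs b₀ k‖ ^ 2) := by
  have hw : ∀ a, a ≠ 20 → σ.write 20 0 0 a = σ a := fun a ha => Mem.write_of_ne ha _ _
  have hb : n < 2 ^ b := hnb.trans_lt Nat.lt_two_pow_self
  obtain ⟨τ, h1, h2⟩ := Run.forTo (b := b) (v := 15) (E := V 13)
    (p := .ifPos (.sub (.sub (V 13) (V 15)) (.const 1))
      (.ifPos (.sub (.mul (.get 12 (.add (V 15) (.const 1))) (.get 12 (.add (V 15) (.const 1))))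
        (.mul (.const 2) (.mul (.get 12 (V 15)) (.get 12 (.add (V 15) (.const 2))))))
        (.set 20 (.const 0) (.add (V 15) (.const 1))) .skip) .skip) (n := n)
    (σ := σ.write 20 0 0)
    (I := fun i τ => (τ 20 0 = 0 ∧ ∀ k < i, k + 1 < n →
        ‖gs b₀ k‖ ^ 2 ≤ 2 * ‖gs b₀ (k + 1)‖ ^ 2) ∨
        ∃ k, k + 1 < n ∧ τ 20 0 = (k + 1 : ℕ) ∧ 2 * ‖gs b₀ (k + 1)‖ ^ 2 ≤ ‖gs b₀ k‖ ^ 2)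
    hnb (by decide)
    (fun k τ z hk => by rw [Mem.write_of_ne (by decide)]; exact hk)
    (Or.inl ⟨by simp, by simp⟩)
    (fun k τ hf _ => by
      simp only [eval, Int.toNat_zero]; rw [hf 13 (by decide), hw 13 (by decide), hn])
    (fun i hi τ hf h15 hI => by
      have t13 : τ 13 0 = n := by rw [hf 13 (by decide), hw 13 (by decide), hn]
      have t12 : τ 12 = σ 12 := by rw [hf 12 (by decide), hw 12 (by decide)]
      have e1 : ((i : ℤ) + 1).toNat = i + 1 := by omega
      have e2 : ((i : ℤ) + 2).toNat = i + 2 := by omega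
      by_cases hin : i + 1 < n
      · have hgi : 0 < gd b₀ i := gd_pos fun j hj => h0 j (by omega)
        have hA : 0 < ‖gs b₀ i‖ ^ 2 := by have := norm_pos_iff.2 (h0 i hi); positivity
        have hcond : (0 < σ 12 (i + 1) * σ 12 (i + 1) - 2 * (σ 12 i * σ 12 (i + 2))) ↔
            2 * ‖gs b₀ (i + 1)‖ ^ 2 < ‖gs b₀ i‖ ^ 2 := by
          rw [← @Int.cast_lt ℝ]
          push_cast
          rw [hd.2 i hi.le, hd.2 (i + 1) hi, hd.2 (i + 2) hin, gd_succ b₀ (i + 1), gd_succ b₀ i]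
          have e : gd b₀ i * ‖gs b₀ i‖ ^ 2 * (gd b₀ i * ‖gs b₀ i‖ ^ 2) - 2 * (gd b₀ i *
            (gd b₀ i * ‖gs b₀ i‖ ^ 2 * ‖gs b₀ (i + 1)‖ ^ 2)) =
            (gd b₀ i * (gd b₀ i * ‖gs b₀ i‖ ^ 2)) *
              (‖gs b₀ i‖ ^ 2 - 2 * ‖gs b₀ (i + 1)‖ ^ 2) := by ring
          rw [e, mul_pos_iff_of_pos_left (by positivity), sub_pos]
        have hif : 0 < (Expr.sub (.sub (V 13) (V 15)) (.const 1)).eval τ := by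
          simp only [eval, Int.toNat_zero, t13, h15]
          omega
        have hev : (Expr.sub (.mul (.get 12 (.add (V 15) (.const 1)))
            (.get 12 (.add (V 15) (.const 1)))) (.mul (.const 2) (.mul (.get 12 (V 15))
            (.get 12 (.add (V 15) (.const 2)))))).eval τ =
            σ 12 (i + 1) * σ 12 (i + 1) - 2 * (σ 12 i * σ 12 (i + 2)) := by
          simp only [eval, Int.toNat_zero, h15, e1, e2, t12, Int.toNat_natCast]
        by_cases hs : 2 * ‖gs b₀ (i + 1)‖ ^ 2 < ‖gs b₀ i‖ ^ 2
        · refine ⟨_, Or.inl ⟨hif, Or.inl ⟨by rw [hev]; exact hcond.2 hs,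
            Run.set_const_zero (z := (i + 1 : ℕ)) ?_ ?_⟩⟩, Or.inr ⟨i, hin, by simp, hs.le⟩⟩
          · simp only [eval, Int.toNat_zero, h15]; push_cast; rfl
          · rw [Nat.abs_cast]
            exact_mod_cast (by omega : i + 1 ≤ 2 ^ b)
        · refine ⟨τ, Or.inl ⟨hif, Or.inr ⟨by rw [hev]; exact fun h => hs (hcond.1 h), rfl⟩⟩, ?_⟩
          rcases hI with hI | hI
          · refine Or.inl ⟨hI.1, fun k hk hkn => ?_⟩
            rcases Nat.lt_succ_iff_lt_or_eq.1 hk with hk | rfl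
            · exact hI.2 k hk hkn
            · exact not_lt.1 hs
          · exact Or.inr hI
      · refine ⟨τ, Or.inr ⟨?_, rfl⟩, ?_⟩
        · simp only [eval, Int.toNat_zero, t13, h15]
          omega
        · rcases hI with hI | hI
          · exact Or.inl ⟨hI.1, fun k hk hkn => hI.2 k (by omega) hkn⟩
          · exact Or.inr hI)
  refine ⟨τ, ⟨_, Run.set_const_zero (z := 0) rfl (by simp), h1⟩, ?_⟩
  rcases h2 with h2 | h2
  · exact Or.inl ⟨h2.1, fun k hk => h2.2 k (by omega) hk⟩
  · exact Or.inr h2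

/-- Exchange of the rows `k` and `k + 1` if cell `0` of array `20` holds `k + 1`. -/
def swapProg : Prog :=
  .ifPos (V 20)
    (.seq (rowProg 21 (.const 0) (entry 10 (.sub (V 20) (.const 1)) (V 17)))
    (.seq (rowProg 10 (.sub (V 20) (.const 1)) (entry 10 (V 20) (V 17)))
      (rowProg 10 (V 20) (entry 21 (.const 0) (V 17))))) .skip

theorem run_swapProg {b N k : ℕ} {Y : ℝ} {σ : Mem} (hN : σ 14 0 = N) (hNb : N ≤ b)
    (h20 : σ 20 0 = (k + 1 : ℕ)) (hY : Y ≤ 2 ^ b) (h1 : ‖row (σ 10) N k‖ ≤ Y)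
    (h2 : ‖row (σ 10) N (k + 1)‖ ≤ Y) :
    ∃ τ, Run b swapProg σ τ ∧
      ∀ l, row (τ 10) N l = row (σ 10) N (Equiv.swap k (k + 1) l) := by
  have e20 : ((k + 1 : ℕ) : ℤ) - 1 = k := by push_cast; ring
  obtain ⟨τ, r1, r2, r2', -, -, r3⟩ := run_rowProg (b := b) (a := 21) (i := 0) (N := N)
    (ei := .const 0) (e := entry 10 (.sub (V 20) (.const 1)) (V 17)) (σ := σ)
    (g := fun c => σ 10 (k * N + c)) hN hNb (by decide) (fun _ _ => rfl)
    (fun c hc τ' h' h17 _ => by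
      simp only [entry, eval, Int.toNat_zero]
      rw [h' 20 (by decide) (by decide), h' 14 (by decide) (by decide),
        h' 10 (by decide) (by decide), h17, h20, hN, e20, toNat_index])
    (h1.trans hY)
  obtain ⟨υ, s1, s2, -, s3, s3', s4⟩ := run_rowProg (b := b) (a := 10) (i := k) (N := N)
    (ei := .sub (V 20) (.const 1)) (e := entry 10 (V 20) (V 17)) (σ := τ)
    (g := fun c => σ 10 ((k + 1) * N + c)) (by rw [r3 14 (by decide) (by decide), hN]) hNb
    (by decide)
    (fun τ' h' => by
      simp only [eval, Int.toNat_zero]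
      rw [h' 20 (by decide) (by decide), r3 20 (by decide) (by decide), h20, e20])
    (fun c hc τ' h' h17 hk => by
      simp only [entry, eval, Int.toNat_zero]
      rw [h' 20 (by decide) (by decide), h' 14 (by decide) (by decide),
        r3 20 (by decide) (by decide), r3 14 (by decide) (by decide), h17, h20, hN, toNat_index,
        hk _ (Or.inr (by rw [add_mul]; omega)), r3 10 (by decide) (by decide)])
    (h2.trans hY)
  obtain ⟨ρ, t1, t2, -, t3, -, t4⟩ := run_rowProg (b := b) (a := 10) (i := k + 1) (N := N)
    (ei := V 20) (e := entry 21 (.const 0) (V 17)) (σ := υ)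
    (g := fun c => σ 10 (k * N + c))
    (by rw [s4 14 (by decide) (by decide), r3 14 (by decide) (by decide), hN]) hNb
    (by decide)
    (fun τ' h' => by
      simp only [eval, Int.toNat_zero]
      rw [h' 20 (by decide) (by decide), s4 20 (by decide) (by decide),
        r3 20 (by decide) (by decide), h20])
    (fun c hc τ' h' h17 hk => by
      simp only [entry, eval, Int.toNat_zero]
      have e := toNat_index 0 N c
      rw [Nat.cast_zero] at e
      rw [h' 14 (by decide) (by decide), s4 14 (by decide) (by decide),
        r3 14 (by decide) (by decide), h17, hN, e, h' 21 (by decide) (by decide),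
        s4 21 (by decide) (by decide), r2' c hc])
    (h1.trans hY)
  refine ⟨ρ, Or.inl ⟨?_, τ, r1, υ, s1, t1⟩, fun l => ?_⟩
  · simp only [eval, Int.toNat_zero]
    rw [h20]; positivity
  · rcases eq_or_ne l (k + 1) with rfl | hl
    · rw [Equiv.swap_apply_right]; exact t2
    · rw [t3 l hl]
      rcases eq_or_ne l k with rfl | hl'
      · rw [Equiv.swap_apply_left]; exact s2
      · rw [Equiv.swap_apply_of_ne_of_ne hl' hl, s3 l hl', r3 10 (by decide) (by decide)]

/-- Lattice reduction of the rows of the matrix in array `10`, whose numbers of rows and columns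
are in the cells `0` of the arrays `13` and `14`. -/
def lllProg : Prog :=
  .seq (.set 20 (.const 0) (.const 1))
    (.whilePos (V 20) (.seq gsProg (.seq srProg (.seq findProg swapProg))))

/-- The invariant of the main loop, with at most `f` iterations to go. -/
structure LLLInv (n N : ℕ) (X Y : ℝ) (L : Submodule ℤ (E N)) (g : ℝ) (f : ℕ) (σ : Mem) :
    Prop where
  rows : σ 13 0 = n
  cols : σ 14 0 = N
  gs_ne_zero : ∀ i < n, gs (row (σ 10) N) i ≠ 0
  norm_gs_le : ∀ i < n, ‖gs (row (σ 10) N) i‖ ≤ X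
  norm_le : ∀ i < n, ‖row (σ 10) N i‖ ≤ Y
  lat_eq : lat (row (σ 10) N) n = L
  gd_eq : gd (row (σ 10) N) n = g
  flag_nonneg : 0 ≤ σ 20 0
  reduced : σ 20 0 = 0 → IsReduced (row (σ 10) N) n
  pot_le : 0 < σ 20 0 → 0 < f ∧ pot (row (σ 10) N) n ≤ (4 / 3) ^ (f - 1)

/-- Each round orthogonalizes from scratch, size reduces all rows and makes at most one exchange.
The fuel f is a logarithm of the potential to base 4/3: an exchange multiplies the potential by at
most 3/4, and a round without exchange ends the loop. -/
theorem run_lllStep {b n N f : ℕ} {X Y : ℝ} {L : Submodule ℤ (E N)} {g : ℝ} {σ : Mem}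
    (hn : n ≤ b) (hN : N ≤ b) (hX : 1 ≤ X) (hY : 1 ≤ Y) (hXY : n * X ^ 2 ≤ Y ^ 2)
    (hb : X ^ (2 * n) * Y * Y * (1 + 2 * X ^ n * Y) ^ (n + 1) ≤ 2 ^ b)
    (h : LLLInv n N X Y L g f σ) (hpos : 0 < σ 20 0) :
    ∃ f' < f, ∃ τ, Run b (.seq gsProg (.seq srProg (.seq findProg swapProg))) σ τ ∧
      LLLInv n N X Y L g f' τ := by
  set B := row (σ 10) N with hB
  set Z := X ^ (2 * n) with hZ
  have hZ1 : 1 ≤ Z := one_le_pow₀ hX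
  have hgdZ : ∀ i ≤ n, gd B i ≤ Z := fun i hi =>
    (gd_le fun j hj => h.norm_gs_le j (by omega)).trans (pow_le_pow_right₀ hX (by omega))
  have hG1 : 1 ≤ (1 + 2 * X ^ n * Y) ^ (n + 1) := one_le_pow₀ (by
    have : 0 ≤ X ^ n * Y := by positivity
    linarith)
  have hb' : Z * Y * Y ≤ 2 ^ b := le_trans (le_mul_of_one_le_right (by positivity) hG1) hb
  have hYb : Y ≤ 2 ^ b := by
    refine le_trans ?_ hb'
    rw [mul_assoc, mul_comm Z, mul_assoc]
    refine le_mul_of_one_le_right (by positivity) ?_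
    nlinarith
  have hgi : GsInput b n N Y Z σ := ⟨h.rows, h.cols, hn, hN, hY, hZ1, hb', h.gs_ne_zero,
    h.norm_le, hgdZ⟩
  obtain ⟨τ, a1, a2⟩ := run_gsProg hgi
  have f1 : ∀ a, a ∉ gsProg.writes → τ a = σ a := fun a ha => a1.frame ha
  have t10 : τ 10 = σ 10 := f1 10 (by decide)
  have hsi : SrInput b n N X Y Z B τ := ⟨by rw [f1 13 (by decide), h.rows],
    by rw [f1 14 (by decide), h.cols], hn, hN, hX, hY, hZ1, hb, hXY, h.gs_ne_zero,
    h.norm_gs_le, fun i hi => one_le_gd intVecs_inner (fun j _ => row_mem _ _ _)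
      fun j hj => h.gs_ne_zero j (by omega), hgdZ, a2, by rw [t10]; exact ⟨fun _ => rfl, rfl⟩⟩
  obtain ⟨υ, b1, b2, b3, b4⟩ := run_srProg hsi (by rw [t10]; exact h.norm_le)
  have f2 : ∀ a, a ∉ srProg.writes → υ a = τ a := fun a ha => b1.frame ha
  have u13 : υ 13 0 = n := by rw [f2 13 (by decide), hsi.rows]
  have u14 : υ 14 0 = N := by rw [f2 14 (by decide), hsi.cols]
  set B' := row (υ 10) N with hB'
  have hgs : ∀ l, gs B' l = gs B l := b2.1
  obtain ⟨ρ, c1, c2⟩ := run_findProg (b := b) (n := n) (N := N) (b₀ := B) u13 hn h.gs_ne_zero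
    (by unfold GsDone; rw [f2 11 (by decide), f2 12 (by decide)]; exact a2)
  have f3 : ∀ a, a ∉ findProg.writes → ρ a = υ a := fun a ha => c1.frame ha
  have r10 : ρ 10 = υ 10 := f3 10 (by decide)
  have hne' : ∀ i < n, gs B' i ≠ 0 := fun i hi => by rw [hgs]; exact h.gs_ne_zero i hi
  have hX' : ∀ i < n, ‖gs B' i‖ ≤ X := fun i hi => by rw [hgs]; exact h.norm_gs_le i hi
  obtain ⟨hf, hpot⟩ := h.pot_le hpos
  have hpot' : pot B' n = pot B n := prod_congr rfl fun j _ => gd_congr fun i _ => hgs i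
  rcases c2 with ⟨c2, c3⟩ | ⟨k, hk, c2, c3⟩
  · refine ⟨0, hf, ρ, ⟨τ, a1, υ, b1, ρ, c1, Or.inr ⟨?_, rfl⟩⟩, ?_⟩
    · simp only [eval, Int.toNat_zero]; rw [c2]; norm_num
    · refine ⟨by rw [f3 13 (by decide), u13], by rw [f3 14 (by decide), u14], by rwa [r10],
        by rwa [r10], by rwa [r10], by rw [r10, ← h.lat_eq]; exact b2.2, ?_, c2.ge,
        fun _ => ⟨by rwa [r10], by rwa [r10], fun i hi => ?_⟩, fun h0 => ?_⟩
      · rw [r10, ← h.gd_eq]; exact gd_congr fun i _ => hgs i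
      · rw [r10, ← hB', hgs, hgs]; exact c3 i hi
      · rw [c2] at h0; exact absurd h0 (lt_irrefl _)
  · obtain ⟨π, d1, d2⟩ := run_swapProg (b := b) (N := N) (k := k) (Y := Y) (σ := ρ)
      (by rw [f3 14 (by decide), u14]) hN c2 hYb (by rw [r10]; exact b4 k (by omega))
      (by rw [r10]; exact b4 (k + 1) hk)
    have f4 : ∀ a, a ∉ swapProg.writes → π a = ρ a := fun a ha => d1.frame ha
    rw [r10] at d2
    have hkr : |inner ℝ (gs B' k) (B' (k + 1))| ≤ ‖gs B' k‖ ^ 2 / 2 :=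
      b3 (k + 1) hk k (Nat.zero_le _) (Nat.lt_succ_self k)
    rw [← hgs, ← hgs] at c3
    have hne'' := swap_gs_ne_zero d2 (by omega : k + 2 ≤ n) hne'
    have hpl := swap_pot_le d2 (by omega : k + 2 ≤ n) hne' hkr c3
    have hp1 : 1 ≤ pot (row (π 10) N) n :=
      one_le_pot intVecs_inner (fun i _ => row_mem _ _ _) hne''
    -- With f = 1 the potential would be at most 1 before the exchange and at most 3/4 after it,
    -- although it is a product of positive integers.
    have hf2 : 2 ≤ f := by
      by_contra hcon
      obtain rfl : f = 1 := by omega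
      rw [Nat.sub_self, pow_zero] at hpot
      rw [hpot'] at hpl
      linarith
    refine ⟨f - 1, by omega, π, ⟨τ, a1, υ, b1, ρ, c1, d1⟩, ?_⟩
    have p20 : π 20 0 = (k + 1 : ℕ) := by rw [f4 20 (by decide), c2]
    refine ⟨by rw [f4 13 (by decide), f3 13 (by decide), u13],
      by rw [f4 14 (by decide), f3 14 (by decide), u14], hne'',
      swap_norm_gs_le d2 (by omega : k + 2 ≤ n) (hne' k (by omega)) hkr c3 hX', fun i hi => ?_,
      ?_, ?_, by rw [p20]; positivity, fun h0 => ?_, fun _ => ⟨by omega, ?_⟩⟩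
    · rw [d2]
      refine b4 _ ?_
      rw [Equiv.swap_apply_def]
      split_ifs <;> omega
    · rw [swap_lat d2 (by omega), ← h.lat_eq]; exact b2.2
    · rw [swap_gd_of_ne d2 (by omega) hne' (by omega), ← h.gd_eq]
      exact gd_congr fun i _ => hgs i
    · rw [p20] at h0
      exact absurd h0 (by positivity)
    · rw [hpot'] at hpl
      have e : (4 / 3 : ℝ) ^ (f - 1) = 4 / 3 * (4 / 3) ^ (f - 1 - 1) := by
        rw [← pow_succ']; congr 1; omega
      rw [e] at hpot
      linarith

theorem run_lllProg {b n N F : ℕ} {X Y : ℝ} {σ : Mem}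
    (hn : n ≤ b) (hN : N ≤ b) (hX : 1 ≤ X) (hY : 1 ≤ Y) (hXY : n * X ^ 2 ≤ Y ^ 2)
    (hb : X ^ (2 * n) * Y * Y * (1 + 2 * X ^ n * Y) ^ (n + 1) ≤ 2 ^ b)
    (hF : X ^ (2 * n * (n + 1)) ≤ (4 / 3) ^ F) (hFb : F + 1 ≤ b)
    (h13 : σ 13 0 = n) (h14 : σ 14 0 = N) (hne : ∀ i < n, gs (row (σ 10) N) i ≠ 0)
    (hXb : ∀ i < n, ‖row (σ 10) N i‖ ≤ X) :
    ∃ τ, Run b lllProg σ τ ∧ IsReduced (row (τ 10) N) n ∧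
      lat (row (τ 10) N) n = lat (row (σ 10) N) n ∧
      gd (row (τ 10) N) n = gd (row (σ 10) N) n ∧ ∀ i < n, ‖row (τ 10) N i‖ ≤ Y := by
  have hw : ∀ a, a ≠ 20 → σ.write 20 0 1 a = σ a := fun a ha => Mem.write_of_ne ha _ _
  have hgX : ∀ i < n, ‖gs (row (σ 10) N) i‖ ≤ X := fun i hi => (norm_gs_le _ _).trans (hXb i hi)
  have h0 : LLLInv n N X Y (lat (row (σ 10) N) n) (gd (row (σ 10) N) n) (F + 1)
      (σ.write 20 0 1) := by
    refine ⟨by rw [hw 13 (by decide), h13], by rw [hw 14 (by decide), h14],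
      by rwa [hw 10 (by decide)], by rwa [hw 10 (by decide)], fun i hi => ?_,
      by rw [hw 10 (by decide)], by rw [hw 10 (by decide)], by simp, by simp, fun _ =>
      ⟨by omega, ?_⟩⟩
    · rw [hw 10 (by decide)]
      refine (sq_le_sq₀ (norm_nonneg _) (by positivity)).1 (le_trans ?_ hXY)
      have h1 : (1 : ℝ) ≤ n := by exact_mod_cast (by omega : 1 ≤ n)
      have h2 : ‖row (σ 10) N i‖ ^ 2 ≤ X ^ 2 := by have := hXb i hi; gcongr
      nlinarith
    · rw [hw 10 (by decide), Nat.add_sub_cancel]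
      exact (pot_le hX hgX).trans hF
  obtain ⟨τ, h1, f, h2, h3⟩ := Run.while (b := b) (e := V 20)
    (p := .seq gsProg (.seq srProg (.seq findProg swapProg)))
    (fun f σ' hI hpos => run_lllStep hn hN hX hY hXY hb hI hpos) hFb h0
  refine ⟨τ, ⟨_, Run.set_const_zero (z := 1) rfl (by simp [one_le_pow₀]), h1⟩, h2.reduced ?_,
    h2.lat_eq, h2.gd_eq, h2.norm_le⟩
  have := h2.flag_nonneg
  simp only [eval, Int.toNat_zero] at h3
  omega

/-- Lattice reduction with explicit bounds for the numbers and the running time. -/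
theorem run_lllProg_of_le {b n N x : ℕ} {σ : Mem} (hN : N ≤ b) (hb : 8 * (n + x + 1) ^ 3 ≤ b)
    (h13 : σ 13 0 = n) (h14 : σ 14 0 = N) (hne : ∀ i < n, gs (row (σ 10) N) i ≠ 0)
    (hXb : ∀ i < n, ‖row (σ 10) N i‖ ≤ 2 ^ x) :
    ∃ τ, Run b lllProg σ τ ∧ IsReduced (row (τ 10) N) n ∧
      lat (row (τ 10) N) n = lat (row (σ 10) N) n ∧
      gd (row (τ 10) N) n = gd (row (σ 10) N) n ∧ ∀ i < n, ‖row (τ 10) N i‖ ≤ 2 ^ (n + x) := by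
  obtain ⟨s, hs⟩ : ∃ s, s = n + x + 1 := ⟨_, rfl⟩
  have hs1 : 1 ≤ s := by omega
  have hs2 : s ≤ s ^ 2 := by nlinarith
  have hs3 : s ^ 2 ≤ s ^ 3 := Nat.pow_le_pow_right hs1 (by norm_num)
  rw [← hs] at hb
  have h2n : (n : ℝ) ≤ 2 ^ n := by exact_mod_cast Nat.lt_two_pow_self.le
  -- The factor 3 in F comes from (4/3)³ ≥ 2. The row bound Y = 2^(n+x) dominates √n · 2^x.
  refine run_lllProg (F := 3 * (x * (2 * n * (n + 1)))) (X := 2 ^ x) (Y := 2 ^ (n + x))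
    (by nlinarith) hN (one_le_pow₀ (by norm_num)) (one_le_pow₀ (by norm_num)) ?_ ?_ ?_ ?_
    h13 h14 hne hXb
  · rw [pow_add, mul_pow]
    gcongr
    nlinarith [one_le_pow₀ (n := n) (by norm_num : (1 : ℝ) ≤ 2)]
  · have hG : (1 + 2 * (2 ^ x) ^ n * 2 ^ (n + x) : ℝ) ≤ 2 ^ (2 + x * n + (n + x)) := by
      have e : (2 : ℝ) ^ (2 + x * n + (n + x)) = 4 * (2 ^ (x * n) * 2 ^ (n + x)) := by
        rw [add_assoc, pow_add, pow_add _ (x * n)]; norm_num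
      rw [← pow_mul, e]
      have : (1 : ℝ) ≤ 2 ^ (x * n) * 2 ^ (n + x) := by
        rw [← pow_add]; exact one_le_pow₀ (by norm_num)
      nlinarith
    calc _ ≤ ((2 ^ x) ^ (2 * n) * 2 ^ (n + x) * 2 ^ (n + x) *
          (2 ^ (2 + x * n + (n + x))) ^ (n + 1) : ℝ) := by gcongr
      _ = 2 ^ (x * (2 * n) + (n + x) + (n + x) + (2 + x * n + (n + x)) * (n + 1)) := by
          rw [← pow_mul, ← pow_mul]; simp only [pow_add]
      _ ≤ 2 ^ b := by
          refine pow_le_pow_right₀ (by norm_num) (le_trans ?_ hb)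
          have e1 : x * n ≤ s ^ 2 := by nlinarith
          have e2 : (2 + x * n + (n + x)) * (n + 1) ≤ (2 + s ^ 2 + s) * s :=
            Nat.mul_le_mul (by omega) (by omega)
          nlinarith
  · have h43 : (2 : ℝ) ≤ (4 / 3) ^ 3 := by norm_num
    rw [← pow_mul, pow_mul (4 / 3 : ℝ)]
    exact pow_le_pow_left₀ (by norm_num) h43 _
  · refine le_trans ?_ hb
    have e1 : n * (n + 1) ≤ s * s := Nat.mul_le_mul (by omega) (by omega)
    have e2 : x * (n * (n + 1)) ≤ s * (s * s) := Nat.mul_le_mul (by omega) e1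
    nlinarith

end LLL

namespace LLL

open InnerProductSpace Finset PostProcess

/-! ### The lattice of the runs -/

/-- If `gs b i` vanished, `b i` would lie in the span of its predecessors, on which φ is zero. With
coordinates as functionals this gives independence of triangular matrices. -/
theorem gs_ne_zero_of_functional {V : Type*} [NormedAddCommGroup V] [InnerProductSpace ℝ V]
    {b : ℕ → V} {i : ℕ} (φ : V →ₗ[ℝ] ℝ) (h : ∀ j < i, φ (b j) = 0) (hi : φ (b i) ≠ 0) :
    gs b i ≠ 0 := by
  intro h0
  have hm : b i ∈ spn b i := by
    have := sub_res_mem b i (b i)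
    rwa [← gs_eq_res, h0, sub_zero] at this
  have hle : spn b i ≤ LinearMap.ker φ :=
    Submodule.span_le.2 (by rintro _ ⟨j, hj, rfl⟩; exact h j hj)
  exact hi (hle hm)

/-- The coordinate `c` as a linear functional. -/
noncomputable def coord {N : ℕ} (c : Fin N) : E N →ₗ[ℝ] ℝ :=
  LinearMap.proj c ∘ₗ (WithLp.linearEquiv 2 ℝ (Fin N → ℝ)).toLinearMap

theorem coord_apply {N : ℕ} (c : Fin N) (v : E N) : coord c v = v c := rfl

/-- The basis vectors of the (scaled) lattice of the runs. -/
structure IsRunBasis {d m : ℕ} (s D : ℝ) (w : Fin m → Fin d → ℝ) (b : ℕ → E (d + m)) : Prop where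
  left_left : ∀ (j : Fin m) (c : Fin d), b j (Fin.castAdd m c) = 0
  left_right : ∀ j k : Fin m, b j (Fin.natAdd d k) = if k = j then s * D else 0
  right_left : ∀ i c : Fin d, b (m + i) (Fin.castAdd m c) = if c = i then D else 0
  right_right : ∀ (i : Fin d) (k : Fin m), b (m + i) (Fin.natAdd d k) = s * D * w k i

/-- Squared norm of the vector of the lattice of the runs with coefficients `a` and `y`. -/
noncomputable def runNormSq {d m : ℕ} (s : ℝ) (w : Fin m → Fin d → ℝ) (a : Fin d → ℤ)
    (y : Fin m → ℤ) : ℝ :=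
  ∑ i, (a i : ℝ) ^ 2 + s ^ 2 * ∑ k, (∑ i, (a i : ℝ) * w k i + y k) ^ 2

/-- `z` is the vector of the lattice of the runs with coefficients `a` and `y`. -/
def IsRunVec {d m : ℕ} (s D : ℝ) (w : Fin m → Fin d → ℝ) (a : Fin d → ℤ) (y : Fin m → ℤ)
    (z : E (d + m)) : Prop :=
  (∀ c, z (Fin.castAdd m c) = D * a c) ∧
    ∀ k, z (Fin.natAdd d k) = s * D * (∑ i, (a i : ℝ) * w k i + y k)

section RunBasis

variable {d m : ℕ} {s D : ℝ} {w : Fin m → Fin d → ℝ} {b : ℕ → E (d + m)}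

theorem IsRunVec.norm_sq {a : Fin d → ℤ} {y : Fin m → ℤ} {z : E (d + m)}
    (h : IsRunVec s D w a y z) : ‖z‖ ^ 2 = D ^ 2 * runNormSq s w a y := by
  rw [EuclideanSpace.real_norm_sq_eq, Fin.sum_univ_add, runNormSq, mul_add, mul_sum, mul_sum,
    mul_sum]
  congr 1
  · exact sum_congr rfl fun i _ => by rw [h.1]; ring
  · exact sum_congr rfl fun i _ => by rw [h.2]; ring

/-- The shifts come first, so the matrix is triangular up to the order of its columns: the
functional for a shift is its right coordinate, and for a later row its left coordinate. -/
theorem IsRunBasis.gs_ne_zero (h : IsRunBasis s D w b) (hs : s ≠ 0) (hD : D ≠ 0) :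
    ∀ i < d + m, gs b i ≠ 0 := by
  intro r hr
  by_cases hrm : r < m
  · refine gs_ne_zero_of_functional (coord (Fin.natAdd d ⟨r, hrm⟩)) (fun j hj => ?_) ?_
    · have := h.left_right ⟨j, hj.trans hrm⟩ ⟨r, hrm⟩
      rw [coord_apply, this, if_neg]
      intro e
      have := congrArg Fin.val e
      simp only at this
      omega
    · have := h.left_right ⟨r, hrm⟩ ⟨r, hrm⟩
      rw [coord_apply, this, if_pos rfl]
      exact mul_ne_zero hs hD
  · obtain ⟨i, rfl⟩ : ∃ i, r = m + i := ⟨r - m, by omega⟩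
    have hi : i < d := by omega
    refine gs_ne_zero_of_functional (coord (Fin.castAdd m ⟨i, hi⟩)) (fun j hj => ?_) ?_
    · rw [coord_apply]
      by_cases hjm : j < m
      · exact h.left_left ⟨j, hjm⟩ _
      · obtain ⟨i', rfl⟩ : ∃ i', j = m + i' := ⟨j - m, by omega⟩
        rw [h.right_left ⟨i', by omega⟩ ⟨i, hi⟩, if_neg]
        intro e
        have := congrArg Fin.val e
        simp only at this
        omega
    · rw [coord_apply, h.right_left ⟨i, hi⟩ ⟨i, hi⟩, if_pos rfl]
      exact hD

theorem IsRunBasis.exists_vec (h : IsRunBasis s D w b) (a : Fin d → ℤ) (y : Fin m → ℤ) :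
    ∃ z ∈ lat b (d + m), IsRunVec s D w a y z := by
  refine ⟨∑ i : Fin d, a i • b (m + i) + ∑ j : Fin m, y j • b j, ?_, fun c => ?_, fun k => ?_⟩
  · refine Submodule.add_mem _ (Submodule.sum_mem _ fun i _ => Submodule.smul_mem _ _
      (mem_lat b (by omega))) (Submodule.sum_mem _ fun i _ => Submodule.smul_mem _ _
      (mem_lat b (by omega)))
  · rw [← coord_apply, map_add, map_sum, map_sum]
    simp only [map_zsmul, coord_apply, h.right_left, h.left_left]
    simp [mul_comm]
  · rw [← coord_apply, map_add, map_sum, map_sum]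
    simp only [map_zsmul, coord_apply, h.right_right, h.left_right]
    simp only [zsmul_eq_mul, mul_ite, mul_zero, sum_ite_eq, mem_univ, if_true, mul_add, mul_sum]
    congr 1
    · exact sum_congr rfl fun i _ => by ring
    · ring

theorem IsRunBasis.exists_coeff (h : IsRunBasis s D w b) {z : E (d + m)}
    (hz : z ∈ lat b (d + m)) : ∃ a y, IsRunVec s D w a y z := by
  induction hz using Submodule.span_induction with
  | mem z hz =>
    obtain ⟨r, hr, rfl⟩ := hz
    have hr : r < d + m := hr
    by_cases hrm : r < m
    · refine ⟨0, Pi.single ⟨r, hrm⟩ 1, fun c => ?_, fun k => ?_⟩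
      · rw [h.left_left ⟨r, hrm⟩]; simp
      · rw [h.left_right ⟨r, hrm⟩]; simp [Pi.single_apply]
    · obtain ⟨i, rfl⟩ : ∃ i, r = m + i := ⟨r - m, by omega⟩
      have hi : i < d := by omega
      refine ⟨Pi.single ⟨i, hi⟩ 1, 0, fun c => ?_, fun k => ?_⟩
      · rw [h.right_left ⟨i, hi⟩]; simp [Pi.single_apply]
      · rw [h.right_right ⟨i, hi⟩]; simp [Pi.single_apply]
  | zero => exact ⟨0, 0, fun c => by simp, fun k => by simp⟩
  | add u v _ _ hu hv =>
    obtain ⟨a, y, h1, h2⟩ := hu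
    obtain ⟨a', y', h3, h4⟩ := hv
    refine ⟨a + a', y + y', fun c => ?_, fun k => ?_⟩
    · rw [PiLp.add_apply, h1, h3]; simp only [Pi.add_apply]; push_cast; ring
    · rw [PiLp.add_apply, h2, h4]
      simp only [Pi.add_apply]; push_cast
      simp only [add_mul, sum_add_distrib]
      ring
  | smul t u _ hu =>
    obtain ⟨a, y, h1, h2⟩ := hu
    refine ⟨t • a, t • y, fun c => ?_, fun k => ?_⟩
    · rw [← Int.cast_smul_eq_zsmul ℝ, PiLp.smul_apply, h1]; simp; ring
    · rw [← Int.cast_smul_eq_zsmul ℝ, PiLp.smul_apply, h2]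
      simp only [Pi.smul_apply, smul_eq_mul]; push_cast
      simp only [mul_assoc, ← mul_sum]
      ring

/-- The selected rows of a reduced basis generate the lattice. -/
theorem IsRunBasis.span_short (h : IsRunBasis s D w b) (hD : 0 < D) {z : ℕ → E (d + m)}
    (hz : IsReduced z (d + m)) (hlat : lat z (d + m) = lat b (d + m)) {R T : ℝ}
    {L : Submodule ℤ (E d)} (hL : ∀ a y, runNormSq s w a y ≤ R ^ 2 → intVec a ∈ L)
    (hT0 : 0 ≤ T) (hT : (d + m : ℕ) * 2 ^ (d + m) * T ^ 2 ≤ R ^ 2)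
    (hL' : L ≤ Submodule.span ℤ {v | ∃ a y, v = intVec a ∧ runNormSq s w a y ≤ T ^ 2})
    {x : ℕ → Fin d → ℤ} (hx : ∀ r < d + m, ∀ c, z r (Fin.castAdd m c) = D * x r c) :
    Submodule.span ℤ {v | ∃ r < d + m, ‖z r‖ ^ 2 ≤ D ^ 2 * R ^ 2 ∧ v = intVec (x r)} = L := by
  have hxa : ∀ r < d + m, ∀ a y, IsRunVec s D w a y (z r) → x r = a := by
    intro r hr a y hay
    funext c
    have h1 := hx r hr c
    rw [hay.1 c] at h1
    exact_mod_cast (mul_left_cancel₀ hD.ne' h1).symm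
  apply le_antisymm
  · refine Submodule.span_le.2 ?_
    rintro _ ⟨r, hr, hzr, rfl⟩
    obtain ⟨a, y, hay⟩ := h.exists_coeff (hlat ▸ mem_lat z hr)
    rw [hxa r hr a y hay]
    refine hL a y ?_
    rw [hay.norm_sq] at hzr
    exact le_of_mul_le_mul_left hzr (by positivity)
  · refine hL'.trans (Submodule.span_le.2 ?_)
    rintro _ ⟨a, y, rfl, hay⟩
    obtain ⟨u, hu, huv⟩ := h.exists_vec a y
    have hnu : ‖u‖ ≤ D * T := by
      refine (sq_le_sq₀ (norm_nonneg _) (by positivity)).1 ?_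
      rw [huv.norm_sq, mul_pow]
      gcongr
    -- By `hT`, the rows of this initial segment all pass the selection threshold D R, although the
    -- segment itself is not known to the algorithm.
    obtain ⟨j, hj, h1, h2⟩ := hz.exists_short (D * T)
    have huj := h2 u (hlat ▸ hu) hnu
    have hshort : ∀ i < j, ‖z i‖ ^ 2 ≤ D ^ 2 * R ^ 2 := by
      intro i hi
      refine (h1 i hi).trans ?_
      calc _ = D ^ 2 * ((d + m : ℕ) * 2 ^ (d + m) * T ^ 2) := by ring
        _ ≤ _ := by gcongr
    -- Taking left parts is additive, so it suffices that the generating rows of the segment are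
    -- selected.
    have key : ∀ u ∈ lat z j, ∀ a : Fin d → ℤ, (∀ c, u (Fin.castAdd m c) = D * a c) →
        intVec a ∈ Submodule.span ℤ {v | ∃ r < d + m, ‖z r‖ ^ 2 ≤ D ^ 2 * R ^ 2 ∧
          v = intVec (x r)} := by
      intro u hu
      induction hu using Submodule.span_induction with
      | mem u hu =>
        obtain ⟨r, hr, rfl⟩ := hu
        have hr : r < j := hr
        intro a ha
        have : a = x r := by
          funext c
          have h1 := ha c
          rw [hx r (by omega) c] at h1
          exact_mod_cast (mul_left_cancel₀ hD.ne' h1).symm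
        rw [this]
        exact Submodule.subset_span ⟨r, by omega, hshort r hr, rfl⟩
      | zero =>
        intro a ha
        have : intVec a = 0 := by
          ext c
          have := ha c
          rw [PiLp.zero_apply, zero_eq_mul] at this
          rcases this with h0 | h0
          · exact absurd h0 hD.ne'
          · rw [intVec_apply, h0, PiLp.zero_apply]
        rw [this]
        exact Submodule.zero_mem _
      | add u v hu hv hu' hv' =>
        intro a ha
        have hlat' : lat z j ≤ lat b (d + m) := hlat ▸ lat_mono z hj
        obtain ⟨a1, y1, h1⟩ := h.exists_coeff (hlat' hu)
        obtain ⟨a2, y2, h2⟩ := h.exists_coeff (hlat' hv)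
        have : intVec a = intVec a1 + intVec a2 := by
          ext c
          have := ha c
          rw [PiLp.add_apply, h1.1, h2.1, ← mul_add] at this
          rw [PiLp.add_apply, intVec_apply, intVec_apply, intVec_apply]
          exact (mul_left_cancel₀ hD.ne' this).symm
        rw [this]
        exact Submodule.add_mem _ (hu' a1 h1.1) (hv' a2 h2.1)
      | smul t u hu hu' =>
        intro a ha
        have hlat' : lat z j ≤ lat b (d + m) := hlat ▸ lat_mono z hj
        obtain ⟨a1, y1, h1⟩ := h.exists_coeff (hlat' hu)
        have : intVec a = t • intVec a1 := by
          ext c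
          have := ha c
          rw [← Int.cast_smul_eq_zsmul ℝ, PiLp.smul_apply, h1.1, smul_eq_mul,
            mul_left_comm] at this
          rw [← Int.cast_smul_eq_zsmul ℝ, PiLp.smul_apply, intVec_apply, intVec_apply, smul_eq_mul]
          exact (mul_left_cancel₀ hD.ne' this).symm
        rw [this]
        exact Submodule.smul_mem _ _ (hu' a1 h1.1)
    exact key u huj a huv.1

end RunBasis

end LLL

namespace LLL

open InnerProductSpace Finset PostProcess

/-! ### Extracting a basis from generators -/

/-- The rows `(Q x_t | e_t)`. -/
structure IsGenBasis {d k : ℕ} (Q : ℝ) (x : ℕ → Fin d → ℤ) (b : ℕ → E (d + k)) : Prop where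
  left : ∀ t < k, ∀ c : Fin d, b t (Fin.castAdd k c) = Q * x t c
  right : ∀ t u : Fin k, b t (Fin.natAdd d u) = if u = t then 1 else 0

section GenBasis

variable {d k : ℕ} {Q : ℝ} {x : ℕ → Fin d → ℤ} {b : ℕ → E (d + k)}

theorem IsGenBasis.gs_ne_zero (h : IsGenBasis Q x b) : ∀ i < k, gs b i ≠ 0 := by
  intro r hr
  refine gs_ne_zero_of_functional (coord (Fin.natAdd d ⟨r, hr⟩)) (fun j hj => ?_) ?_
  · have := h.right ⟨j, hj.trans hr⟩ ⟨r, hr⟩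
    rw [coord_apply, this, if_neg]
    intro e
    have := congrArg Fin.val e
    simp only at this
    omega
  · have := h.right ⟨r, hr⟩ ⟨r, hr⟩
    rw [coord_apply, this, if_pos rfl]
    exact one_ne_zero

/-- The Gram matrix is I + Y Yᵀ of size k, and its determinant equals that of I + Yᵀ Y, which has
size only d. The Leibniz formula then bounds it by the d-th power of an entry bound, whatever k is.
-/
theorem IsGenBasis.gd_le (h : IsGenBasis Q x b) {s : ℝ}
    (hx : ∀ t < k, ∀ c, |(x t c : ℝ)| ≤ s) :
    gd b k ≤ d.factorial * (1 + k * (Q * s) ^ 2) ^ d := by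
  let Y : Matrix (Fin k) (Fin d) ℝ := Matrix.of fun t c => Q * x t c
  have hG : gramMat b k = 1 + Y * Y.transpose := by
    ext t u
    rw [gramMat, Matrix.of_apply, PiLp.inner_apply, Fin.sum_univ_add, add_comm, Matrix.add_apply]
    congr 1
    · simp only [h.right]
      rw [Matrix.one_apply]
      simp [eq_comm]
    · rw [Matrix.mul_apply]
      refine sum_congr rfl fun c _ => ?_
      rw [h.left t t.2, h.left u u.2]
      simp [Y]
      ring
  rw [← det_gramMat h.gs_ne_zero, hG, Matrix.det_one_add_mul_comm]
  have hM : ∀ i j : Fin d, (AbsoluteValue.abs : AbsoluteValue ℝ ℝ)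
      ((1 + Y.transpose * Y : Matrix (Fin d) (Fin d) ℝ) i j) ≤
      1 + k * (Q * s) ^ 2 := by
    intro i j
    rw [AbsoluteValue.abs_apply, Matrix.add_apply, Matrix.mul_apply]
    refine (abs_add_le _ _).trans (add_le_add ?_ ?_)
    · rw [Matrix.one_apply]; split_ifs <;> simp
    · refine (abs_sum_le_sum_abs _ _).trans ?_
      calc ∑ t, |Y.transpose i t * Y t j| ≤ ∑ _t : Fin k, (Q * s) ^ 2 := by
            refine sum_le_sum fun t _ => ?_
            have h1 := hx t t.2 i
            have h2 := hx t t.2 j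
            have hs : 0 ≤ s := (abs_nonneg _).trans h1
            simp only [Y, Matrix.transpose_apply, Matrix.of_apply, abs_mul]
            calc |Q| * |(x t i : ℝ)| * (|Q| * |(x t j : ℝ)|) ≤ |Q| * s * (|Q| * s) := by gcongr
              _ = (Q * s) ^ 2 := by rw [← sq_abs (Q * s), abs_mul, abs_of_nonneg hs]; ring
        _ = k * (Q * s) ^ 2 := by simp
  have := Matrix.det_le hM
  rw [Fintype.card_fin, nsmul_eq_mul] at this
  exact (le_abs_self _).trans this

/-- The projection to the first `d` coordinates. -/
noncomputable def leftPart (d k : ℕ) : E (d + k) →ₗ[ℝ] E d :=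
  (WithLp.linearEquiv 2 ℝ (Fin d → ℝ)).symm.toLinearMap ∘ₗ
    LinearMap.pi fun c => coord (Fin.castAdd k c)

theorem leftPart_apply {d k : ℕ} (v : E (d + k)) (c : Fin d) :
    leftPart d k v c = v (Fin.castAdd k c) := rfl

theorem norm_leftPart_le {d k : ℕ} (v : E (d + k)) : ‖leftPart d k v‖ ≤ ‖v‖ := by
  refine (sq_le_sq₀ (norm_nonneg _) (norm_nonneg _)).1 ?_
  rw [EuclideanSpace.real_norm_sq_eq, EuclideanSpace.real_norm_sq_eq, Fin.sum_univ_add]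
  simp only [leftPart_apply]
  exact le_add_of_nonneg_right (sum_nonneg fun _ _ => sq_nonneg _)

theorem IsGenBasis.leftPart_lat (h : IsGenBasis Q x b) {v : E (d + k)} (hv : v ∈ lat b k) :
    ∃ a : Fin d → ℤ, leftPart d k v = Q • intVec a ∧
      intVec a ∈ Submodule.span ℤ {v | ∃ t < k, v = intVec (x t)} := by
  induction hv using Submodule.span_induction with
  | mem v hv =>
    obtain ⟨t, ht, rfl⟩ := hv
    refine ⟨x t, ?_, Submodule.subset_span ⟨t, ht, rfl⟩⟩
    ext c
    rw [leftPart_apply, h.left t ht]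
    rfl
  | zero => exact ⟨0, by ext; simp [intVec], by
      rw [show intVec (0 : Fin d → ℤ) = 0 by ext; simp [intVec]]; exact Submodule.zero_mem _⟩
  | add u v _ _ hu hv =>
    obtain ⟨a, h1, h2⟩ := hu
    obtain ⟨a', h3, h4⟩ := hv
    have e : intVec (a + a') = intVec a + intVec a' := by ext; simp [intVec]
    exact ⟨a + a', by rw [map_add, h1, h3, e, smul_add], by rw [e]; exact Submodule.add_mem _ h2 h4⟩
  | smul t u _ hu =>
    obtain ⟨a, h1, h2⟩ := hu
    have e : intVec (t • a) = t • intVec a := by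
      rw [← Int.cast_smul_eq_zsmul ℝ t (intVec a)]; ext c; simp [intVec]
    exact ⟨t • a, by rw [map_zsmul, h1, e, smul_comm], by rw [e]; exact Submodule.smul_mem _ _ h2⟩

variable {z : ℕ → E (d + k)}

/-- If z_j is the first reduced vector with non-zero left part, its Gram-Schmidt vector has length
at least Q, and by reducedness the k - j > d vectors from there on have squared length at least
Q²/2^k. The Gram determinant would then be at least the (d + 1)-st power of this number, against
`gd_le`. -/
theorem IsGenBasis.leftPart_eq_zero (h : IsGenBasis Q x b) (hz : IsReduced z k)
    (hzi : ∀ i, z i ∈ intVecs (d + k)) (hlat : lat z k = lat b k) (hgd : gd z k = gd b k)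
    {s : ℝ} (hx : ∀ t < k, ∀ c, |(x t c : ℝ)| ≤ s) (hQ0 : (2 : ℝ) ^ k ≤ Q ^ 2)
    (hQ : d.factorial * (1 + k * (Q * s) ^ 2) ^ d < (Q ^ 2 / 2 ^ k) ^ (d + 1)) {j : ℕ}
    (hj : j + d < k) : leftPart d k (z j) = 0 := by
  induction j using Nat.strong_induction_on with
  | _ j ih =>
    by_contra hne
    have hspn : ∀ v ∈ spn z j, leftPart d k v = 0 := by
      have : spn z j ≤ LinearMap.ker (leftPart d k) :=
        Submodule.span_le.2 (by rintro _ ⟨l, hl, rfl⟩; exact ih l hl (by simp at hl; omega))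
      exact fun v hv => this hv
    -- The vectors before z_j have zero left part, so orthogonalization leaves the left part of z_j
    -- unchanged.
    have hgs : leftPart d k (gs z j) = leftPart d k (z j) := by
      have := hspn _ (sub_res_mem z j (z j))
      rw [map_sub, ← gs_eq_res, sub_eq_zero] at this
      exact this.symm
    obtain ⟨a, ha, -⟩ := h.leftPart_lat (hlat ▸ mem_lat z (by omega : j < k))
    have hgQ : Q ^ 2 ≤ ‖gs z j‖ ^ 2 := by
      have h1 : leftPart d k (z j) = Q • intVec a := ha
      have h2 : intVec a ≠ 0 := by
        intro h0
        rw [h0, smul_zero] at h1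
        exact hne h1
      have h3 := one_le_norm (intVec_mem a) h2
      have h4 := norm_leftPart_le (gs z j)
      rw [hgs, h1, norm_smul, Real.norm_eq_abs] at h4
      rw [← sq_abs]
      refine pow_le_pow_left₀ (abs_nonneg _) (le_trans ?_ h4) 2
      exact le_mul_of_one_le_right (abs_nonneg _) h3
    have hQk : 1 ≤ Q ^ 2 / 2 ^ k := by rwa [one_le_div (by positivity)]
    have hge : ∀ i, j ≤ i → i < k → Q ^ 2 / 2 ^ k ≤ ‖gs z i‖ ^ 2 := by
      intro i hji hik
      rw [div_le_iff₀ (by positivity), mul_comm]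
      refine hgQ.trans ((hz.norm_sq_gs_le hji hik).trans ?_)
      gcongr
      · norm_num
      · omega
    have hgdge : ∀ t, j + t ≤ k → (Q ^ 2 / 2 ^ k) ^ t ≤ gd z (j + t) := by
      intro t
      induction t with
      | zero =>
        intro _
        rw [pow_zero, add_zero]
        exact one_le_gd intVecs_inner (fun i _ => hzi i) fun i hi => hz.gs_ne_zero i (by omega)
      | succ t iht =>
        intro ht
        rw [pow_succ, ← add_assoc, gd_succ]
        exact mul_le_mul (iht (by omega)) (hge _ (by omega) (by omega)) (by positivity)
          (gd_pos fun i hi => hz.gs_ne_zero i (by omega)).le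
    have h5 := hgdge (k - j) (by omega)
    rw [show j + (k - j) = k by omega, hgd] at h5
    have h6 : (Q ^ 2 / 2 ^ k) ^ (d + 1) ≤ (Q ^ 2 / 2 ^ k) ^ (k - j) :=
      pow_le_pow_right₀ hQk (by omega)
    linarith [h.gd_le hx]

theorem le_of_span_eq_top {L : Submodule ℤ (E d)}
    (hL : Submodule.span ℤ {v | ∃ t < k, v = intVec (x t)} = L)
    (hLtop : Submodule.span ℝ (L : Set (E d)) = ⊤) : d ≤ k := by
  have h1 : Submodule.span ℝ (Set.range fun t : Fin k => intVec (x t)) = ⊤ := by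
    rw [eq_top_iff, ← hLtop, ← hL]
    refine Submodule.span_le.2 fun v hv => ?_
    have : Submodule.span ℤ {v | ∃ t < k, v = intVec (x t)} ≤
        (Submodule.span ℝ (Set.range fun t : Fin k => intVec (x t))).restrictScalars ℤ :=
      Submodule.span_le.2 (by
        rintro _ ⟨t, ht, rfl⟩
        exact Submodule.subset_span ⟨⟨t, ht⟩, rfl⟩)
    exact this hv
  have h2 := finrank_range_le_card (R := ℝ) fun t : Fin k => intVec (x t)
  rw [Set.finrank, h1, finrank_top, finrank_euclideanSpace, Fintype.card_fin,
    Fintype.card_fin] at h2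
  exact h2

/-- All but the last d reduced rows have zero left part, so the left parts of the last d rows
generate Q L. Since L spans a space of dimension d, these d generators are independent. -/
theorem IsGenBasis.isBasisOf (h : IsGenBasis Q x b) (hz : IsReduced z k)
    (hzi : ∀ i, z i ∈ intVecs (d + k)) (hlat : lat z k = lat b k) (hgd : gd z k = gd b k)
    {s : ℝ} (hx : ∀ t < k, ∀ c, |(x t c : ℝ)| ≤ s) (hQ0 : (2 : ℝ) ^ k ≤ Q ^ 2)
    (hQ : d.factorial * (1 + k * (Q * s) ^ 2) ^ d < (Q ^ 2 / 2 ^ k) ^ (d + 1))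
    (hQpos : Q ≠ 0) {L : Submodule ℤ (E d)}
    (hL : Submodule.span ℤ {v | ∃ t < k, v = intVec (x t)} = L)
    (hLtop : Submodule.span ℝ (L : Set (E d)) = ⊤) {M : Matrix (Fin d) (Fin d) ℤ}
    (hM : ∀ (i : Fin d) a, leftPart d k (z (k - d + i)) = Q • intVec a → M i = a) :
    IsBasisOf L M := by
  have hdk : d ≤ k := le_of_span_eq_top hL hLtop
  have hrow : ∀ i : Fin d, leftPart d k (z (k - d + i)) = Q • intVec (M i) ∧
      intVec (M i) ∈ L := by
    intro i
    obtain ⟨a, h1, h2⟩ := h.leftPart_lat (hlat ▸ mem_lat z (by omega : k - d + i < k))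
    rw [hM i a h1]
    exact ⟨h1, hL ▸ h2⟩
  have hspan : Submodule.span ℤ (Set.range fun i => intVec (M i)) = L := by
    apply le_antisymm
    · exact Submodule.span_le.2 (by rintro _ ⟨i, rfl⟩; exact (hrow i).2)
    · rw [← hL]
      refine Submodule.span_le.2 ?_
      rintro _ ⟨t, ht, rfl⟩
      have key : ∀ v ∈ lat z k, ∃ u ∈ Submodule.span ℤ (Set.range fun i => intVec (M i)),
          leftPart d k v = Q • u := by
        intro v hv
        induction hv using Submodule.span_induction with
        | mem v hv =>
          obtain ⟨l, hl, rfl⟩ := hv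
          have hl : l < k := hl
          by_cases hld : l + d < k
          · exact ⟨0, Submodule.zero_mem _, by
              rw [h.leftPart_eq_zero hz hzi hlat hgd hx hQ0 hQ hld, smul_zero]⟩
          · have := (hrow ⟨l - (k - d), by omega⟩).1
            rw [show k - d + ((⟨l - (k - d), by omega⟩ : Fin d) : ℕ) = l by
              simp only; omega] at this
            exact ⟨_, Submodule.subset_span ⟨_, rfl⟩, this⟩
        | zero => exact ⟨0, Submodule.zero_mem _, by simp⟩
        | add u v _ _ hu hv =>
          obtain ⟨u', h1, h2⟩ := hu
          obtain ⟨v', h3, h4⟩ := hv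
          exact ⟨u' + v', Submodule.add_mem _ h1 h3, by rw [map_add, h2, h4, smul_add]⟩
        | smul t u _ hu =>
          obtain ⟨u', h1, h2⟩ := hu
          exact ⟨t • u', Submodule.smul_mem _ _ h1, by rw [map_zsmul, h2, smul_comm]⟩
      obtain ⟨u, h1, h2⟩ := key (b t) (hlat ▸ mem_lat b ht)
      have h3 : leftPart d k (b t) = Q • intVec (x t) := by
        ext c
        rw [leftPart_apply, h.left t ht]
        rfl
      rw [h3] at h2
      have h4 : intVec (x t) = u := smul_right_injective _ hQpos h2
      rw [h4]
      exact h1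
  refine ⟨?_, hspan⟩
  have htop : Submodule.span ℝ (Set.range fun i => intVec (M i)) = ⊤ := by
    rw [eq_top_iff, ← hLtop, ← hspan]
    exact Submodule.span_le.2 (Submodule.span_subset_span ℤ ℝ _)
  have hli : LinearIndependent ℝ fun i => intVec (M i) :=
    linearIndependent_of_top_le_span_of_card_eq_finrank htop.ge (by simp)
  exact hli.restrict_scalars' ℤ

end GenBasis

end LLL

namespace LLL

open InnerProductSpace Finset PostProcess RAM RAM.Expr RAM.Prog

/-! ### The post-processing program -/

/-- The dimension, the number of runs and the scaling parameter in the input. -/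
def dimE : Expr := .get 0 (.const 0)
def runsE : Expr := .get 0 (.const 1)
def scaleE : Expr := .add (.get 0 (.const 2)) (.const 1)

/-- `1` if `e = 0`, and `0` otherwise. -/
def indE (e : Expr) : Expr := .div (.const 1) (.add (.const 1) (.mul e e))

/-- The Euclidean quotient of 1 by 1 + e² vanishes unless e = 0. Entries of diagonal blocks thereby
become single expressions without branching. -/
theorem eval_indE (e : Expr) (σ : Mem) : (indE e).eval σ = if e.eval σ = 0 then 1 else 0 := by
  simp only [indE, eval]
  split_ifs with h
  · simp [h]
  · refine Int.ediv_eq_zero_of_lt (by norm_num) ?_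
    have : 0 < e.eval σ * e.eval σ := mul_self_pos.2 h
    omega

/-- `acc = ∏ v < E, e`. -/
def prodTo (acc : ℕ) (E e : Expr) : Prog :=
  .seq (.set acc (.const 0) (.const 1)) (forTo 15 E (.set acc (.const 0) (.mul (V acc) e)))

theorem run_prodTo {b acc : ℕ} {E e : Expr} {N : ℕ} {f : ℕ → ℤ} {σ : Mem}
    (hN : N ≤ b) (hne : 15 ≠ acc)
    (hE : ∀ τ : Mem, (∀ a, a ≠ acc → a ≠ 15 → τ a = σ a) → E.eval τ = N)
    (he : ∀ c < N, ∀ τ : Mem, (∀ a, a ≠ acc → a ≠ 15 → τ a = σ a) → τ 15 0 = c → e.eval τ = f c)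
    (hf : ∀ k ≤ N, |∏ c ∈ range k, f c| ≤ 2 ^ b) :
    ∃ τ, Run b (prodTo acc E e) σ τ ∧ τ acc 0 = ∏ c ∈ range N, f c ∧
      ∀ a, a ≠ acc → a ≠ 15 → τ a = σ a := by
  have hfr : ∀ τ : Mem, (∀ a, a ∉ 15 :: (Prog.set acc (.const 0) (.mul (V acc) e)).writes →
      τ a = σ.write acc 0 1 a) → ∀ a, a ≠ acc → a ≠ 15 → τ a = σ a := by
    intro τ h a h1 h2
    rw [h a (by simp [writes, h1, h2]), Mem.write_of_ne h1]
  obtain ⟨τ, h1, h2⟩ := Run.forTo (b := b) (v := 15) (E := E)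
    (p := .set acc (.const 0) (.mul (V acc) e)) (n := N) (σ := σ.write acc 0 1)
    (I := fun k τ => k ≤ N → τ acc 0 = ∏ c ∈ range k, f c) hN (by simp [writes, hne])
    (fun k τ z h hk => by rw [Mem.write_of_ne hne.symm, h hk]) (by simp)
    (fun k τ h _ => hE τ (hfr τ h))
    (fun k hk τ h hv hI => by
      have hev : (Expr.mul (V acc) e).eval τ = ∏ c ∈ range (k + 1), f c := by
        simp only [eval, Int.toNat_zero]
        rw [he k hk τ (hfr τ h) hv, hI hk.le, prod_range_succ]
      exact ⟨_, Run.set_const_zero hev (hf _ (by omega)), fun _ => by simp⟩)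
  refine ⟨τ, ⟨_, Run.set_const_zero (z := 1) rfl (by simp [one_le_pow₀]), h1⟩, h2 le_rfl,
    fun a ha hv => ?_⟩
  rw [h1.frame (by simp [Prog.forTo, writes, ha, hv]), Mem.write_of_ne ha]

/-- The dimensions, the common denominator, the selection threshold and the weight of the second
reduction. -/
def initProg : Prog :=
  .seq (.set 13 (.const 0) (.add dimE runsE))
  (.seq (.set 14 (.const 0) (.add dimE runsE))
  (.seq (prodTo 30 (.mul runsE dimE) (.get 2 (V 15)))
  (.seq (prodTo 31 dimE (.const 2))
  (.seq (.set 32 (.const 0) (.mul (.mul (.const 2) (.add (V 13) (.const 1))) scaleE))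
  (prodTo 33 (.mul (.add (V 13) (.const 2)) (.add (V 13) (.const 2))) (V 32))))))

/-- The first part of the memory is an input with dimension `d`, number of runs `m` and scaling
parameter `s - 1`. -/
structure HasInput (d m s : ℕ) (σ : Mem) : Prop where
  dim : σ 0 0 = d
  runs : σ 0 1 = m
  scale : σ 0 2 = s - 1

theorem HasInput.congr {d m s : ℕ} {σ τ : Mem} (h : HasInput d m s σ) (h0 : τ 0 = σ 0) :
    HasInput d m s τ :=
  ⟨by rw [h0, h.dim], by rw [h0, h.runs], by rw [h0, h.scale]⟩

theorem HasInput.eval_dimE {d m s : ℕ} {σ τ : Mem} (h : HasInput d m s σ) (h0 : τ 0 = σ 0) :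
    dimE.eval τ = d := by simp only [dimE, eval, Int.toNat_zero]; rw [h0, h.dim]

theorem HasInput.eval_runsE {d m s : ℕ} {σ τ : Mem} (h : HasInput d m s σ) (h0 : τ 0 = σ 0) :
    runsE.eval τ = m := by simp only [runsE, eval]; rw [h0]; exact h.runs

theorem HasInput.eval_scaleE {d m s : ℕ} {σ τ : Mem} (h : HasInput d m s σ) (h0 : τ 0 = σ 0) :
    scaleE.eval τ = s := by
  simp only [scaleE, eval]
  rw [h0, show (2 : ℤ).toNat = 2 from rfl, h.scale]
  ring

theorem run_initProg {b d m s D : ℕ} {σ : Mem} (h : HasInput d m s σ)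
    (hden : ∀ t, ∃ c : ℕ, σ 2 t = c) (hD : (D : ℤ) = ∏ t ∈ range (m * d), σ 2 t)
    (hdm : d + m ≤ b) (hmd : m * d ≤ b) (hn : (d + m + 2) * (d + m + 2) ≤ b) (hDb : D ≤ 2 ^ b)
    (hD0 : D ≠ 0)
    (hQ : (2 * (d + m + 1) * s) ^ ((d + m + 2) * (d + m + 2)) ≤ 2 ^ b) (hs : 1 ≤ s) :
    ∃ τ, Run b initProg σ τ ∧ τ 13 0 = (d + m : ℕ) ∧ τ 14 0 = (d + m : ℕ) ∧ τ 30 0 = D ∧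
      τ 31 0 = 2 ^ d ∧
      τ 33 0 = ((2 * (d + m + 1) * s) ^ ((d + m + 2) * (d + m + 2)) : ℕ) := by
  set G := 2 * (d + m + 1) * s with hG
  have hG1 : 1 ≤ G := by rw [hG]; exact Nat.mul_pos (by omega) hs
  have hGb : G ≤ 2 ^ b := le_trans (Nat.le_self_pow (by positivity) G) hQ
  have hdmb : d + m ≤ 2 ^ b := hdm.trans Nat.lt_two_pow_self.le
  have hbd : |((d + m : ℕ) : ℤ)| ≤ 2 ^ b := by rw [Nat.abs_cast]; exact_mod_cast hdmb
  set σ1 := σ.write 13 0 ((d + m : ℕ) : ℤ) with hσ1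
  set σ2 := σ1.write 14 0 ((d + m : ℕ) : ℤ) with hσ2
  have w1 : ∀ a, a ≠ 13 → σ1 a = σ a := fun a ha => Mem.write_of_ne ha _ _
  have w2 : ∀ a, a ≠ 14 → σ2 a = σ1 a := fun a ha => Mem.write_of_ne ha _ _
  have e1 : (Expr.add dimE runsE).eval σ = (d + m : ℕ) := by
    simp only [eval, h.eval_dimE rfl, h.eval_runsE rfl]; push_cast; rfl
  have h1 := h.congr (w1 0 (by decide))
  have e2 : (Expr.add dimE runsE).eval σ1 = (d + m : ℕ) := by
    simp only [eval, h1.eval_dimE rfl, h1.eval_runsE rfl]; push_cast; rfl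
  have h2 := h1.congr (w2 0 (by decide))
  have z2 : ∀ t, σ2 2 t = σ 2 t := fun t => by rw [w2 2 (by decide), w1 2 (by decide)]
  choose dn hdn using hden
  have hDn : D = ∏ t ∈ range (m * d), dn t := by
    simp only [hdn] at hD
    exact_mod_cast hD
  obtain ⟨τ1, r1, r2, r3⟩ := run_prodTo (b := b) (acc := 30) (E := .mul runsE dimE)
    (e := .get 2 (V 15)) (N := m * d) (f := fun t => σ 2 t) (σ := σ2) hmd (by decide)
    (fun τ h' => by
      simp only [eval, h2.eval_runsE (h' 0 (by decide) (by decide)),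
        h2.eval_dimE (h' 0 (by decide) (by decide))]
      push_cast; rfl)
    (fun c hc τ h' h15 => by
      simp only [eval, Int.toNat_zero, h15, Int.toNat_natCast]
      rw [h' 2 (by decide) (by decide), z2])
    (fun k hk => by
      simp only [hdn]
      rw [← Nat.cast_prod, Nat.abs_cast]
      have : ∏ t ∈ range k, dn t ≤ D := by
        refine Nat.le_of_dvd (Nat.pos_of_ne_zero hD0) ?_
        rw [hDn]
        exact prod_dvd_prod_of_subset _ _ _ (range_mono hk)
      exact_mod_cast this.trans hDb)
  have h3 := h2.congr (r3 0 (by decide) (by decide))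
  obtain ⟨τ2, s1, s2, s3⟩ := run_prodTo (b := b) (acc := 31) (E := dimE)
    (e := .const 2) (N := d) (f := fun _ => 2) (σ := τ1) (by omega) (by decide)
    (fun τ h' => h3.eval_dimE (h' 0 (by decide) (by decide)))
    (fun c hc τ h' h15 => rfl)
    (fun k hk => by
      rw [prod_const, card_range, abs_pow, abs_two]
      exact pow_le_pow_right₀ (by norm_num) (by omega))
  have h4 := h3.congr (s3 0 (by decide) (by decide))
  have t13 : τ2 13 0 = (d + m : ℕ) := by
    rw [s3 13 (by decide) (by decide), r3 13 (by decide) (by decide), w2 13 (by decide),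
      hσ1, Mem.write_self]
  set τ3 := τ2.write 32 0 (G : ℤ) with hτ3
  have w3 : ∀ a, a ≠ 32 → τ3 a = τ2 a := fun a ha => Mem.write_of_ne ha _ _
  have e3 : (Expr.mul (.mul (.const 2) (.add (V 13) (.const 1))) scaleE).eval τ2 = G := by
    simp only [eval, Int.toNat_zero, h4.eval_scaleE rfl, t13]
    rw [hG]; push_cast; rfl
  obtain ⟨τ4, t1, t2, t3⟩ := run_prodTo (b := b) (acc := 33)
    (E := .mul (.add (V 13) (.const 2)) (.add (V 13) (.const 2)))
    (e := V 32) (N := (d + m + 2) * (d + m + 2)) (f := fun _ => (G : ℤ)) (σ := τ3) hn (by decide)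
    (fun τ h' => by
      simp only [eval, Int.toNat_zero]
      rw [h' 13 (by decide) (by decide), w3 13 (by decide), t13]
      push_cast; rfl)
    (fun c hc τ h' h15 => by
      simp only [eval, Int.toNat_zero]
      rw [h' 32 (by decide) (by decide), hτ3, Mem.write_self])
    (fun k hk => by
      rw [prod_const, card_range, abs_pow, Nat.abs_cast]
      have : G ^ k ≤ G ^ ((d + m + 2) * (d + m + 2)) := Nat.pow_le_pow_right hG1 hk
      exact_mod_cast this.trans hQ)
  refine ⟨τ4, ⟨_, Run.set_const_zero e1 hbd, _, Run.set_const_zero e2 hbd, _, r1, _, s1, _,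
    Run.set_const_zero e3 (by rw [Nat.abs_cast]; exact_mod_cast hGb), t1⟩, ?_, ?_, ?_, ?_, ?_⟩
  · rw [t3 13 (by decide) (by decide), w3 13 (by decide), t13]
  · rw [t3 14 (by decide) (by decide), w3 14 (by decide), s3 14 (by decide) (by decide),
      r3 14 (by decide) (by decide), hσ2, Mem.write_self]
  · rw [t3 30 (by decide) (by decide), w3 30 (by decide), s3 30 (by decide) (by decide), r2, ← hD]
  · rw [t3 31 (by decide) (by decide), w3 31 (by decide), s2, prod_const, card_range]
  · rw [t2, prod_const, card_range]; push_cast; rfl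

theorem norm_intVec_le {N : ℕ} {g : Fin N → ℤ} {A : ℝ} (hA : 0 ≤ A)
    (h : ∀ c, |(g c : ℝ)| ≤ A) : ‖intVec g‖ ≤ N * A := by
  refine (sq_le_sq₀ (norm_nonneg _) (by positivity)).1 ?_
  rw [EuclideanSpace.real_norm_sq_eq]
  calc ∑ c, (intVec g c) ^ 2 ≤ ∑ _c : Fin N, A ^ 2 := sum_le_sum fun c _ => by
        rw [intVec_apply, ← sq_abs]
        have := h c
        gcongr
    _ = N * A ^ 2 := by simp
    _ ≤ N * N * A ^ 2 := by
        have : (N : ℝ) ≤ N * N := by exact_mod_cast Nat.le_mul_self N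
        gcongr
    _ = _ := by ring

theorem outside_row {N i j c : ℕ} (hc : c < N) (hj : j ≠ i) :
    j * N + c < i * N ∨ i * N + N ≤ j * N + c := by
  rcases lt_or_gt_of_ne hj with h | h
  · left
    have : (j + 1) * N ≤ i * N := Nat.mul_le_mul_right N h
    rw [add_mul, one_mul] at this
    omega
  · right
    have : (i + 1) * N ≤ j * N := Nat.mul_le_mul_right N h
    rw [add_mul, one_mul] at this
    omega

/-- The rows of the first matrix that belong to the integral shifts. -/
def shiftProg : Prog := forTo 15 runsE
  (rowProg 10 (V 15) (.mul (.mul scaleE (V 30)) (indE (.sub (V 17) (.add dimE (V 15))))))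

theorem run_shiftProg {b d m s D : ℕ} {σ : Mem} (h : HasInput d m s σ) (h14 : σ 14 0 = (d + m : ℕ))
    (h30 : σ 30 0 = D) (hb : d + m ≤ b) (hsD : ((d + m) * (s * D) : ℝ) ≤ 2 ^ b) :
    ∃ τ, Run b shiftProg σ τ ∧ ∀ r < m, ∀ c < d + m,
      τ 10 (r * (d + m) + c) = if c = d + r then (s * D : ℤ) else 0 := by
  obtain ⟨τ, h1, h2⟩ := Run.forTo (b := b) (v := 15) (E := runsE)
    (p := rowProg 10 (V 15) (.mul (.mul scaleE (V 30)) (indE (.sub (V 17) (.add dimE (V 15))))))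
    (n := m) (σ := σ)
    (I := fun k τ => ∀ r < k, ∀ c < d + m,
      τ 10 (r * (d + m) + c) = if c = d + r then (s * D : ℤ) else 0) (by omega) (by decide)
    (fun k τ z hk => by rw [Mem.write_of_ne (by decide)]; exact hk) (by simp)
    (fun k τ hf _ => h.eval_runsE (hf 0 (by decide)))
    (fun i hi τ hf h15 hI => by
      have hτ := h.congr (hf 0 (by decide))
      obtain ⟨υ, r1, -, r2, -, r3, -⟩ := run_rowProg (b := b) (a := 10) (i := i) (N := d + m)
        (ei := V 15)
        (e := .mul (.mul scaleE (V 30)) (indE (.sub (V 17) (.add dimE (V 15))))) (σ := τ)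
        (g := fun c => if c = d + i then (s * D : ℤ) else 0)
        (by rw [hf 14 (by decide), h14]) hb (by decide)
        (fun τ' h' => by
          simp only [eval, Int.toNat_zero]
          rw [h' 15 (by decide) (by decide), h15])
        (fun c hc τ' h' h17 _ => by
          have h0 := h' 0 (by decide) (by decide)
          simp only [eval, Int.toNat_zero, eval_indE, hτ.eval_scaleE h0, hτ.eval_dimE h0, h17]
          rw [h' 15 (by decide) (by decide), h' 30 (by decide) (by decide), hf 30 (by decide), h30,
            h15]
          by_cases hc' : c = d + i
          · subst hc'; simp
          · rw [if_neg hc', if_neg (by omega), mul_zero])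
        (by
          refine (norm_intVec_le (A := s * D) (by positivity) fun c => ?_).trans
            (by push_cast; exact hsD)
          split_ifs
          · push_cast; rw [abs_of_nonneg (by positivity)]
          · simp; positivity)
      refine ⟨υ, r1, fun r hr c hc => ?_⟩
      rcases Nat.lt_succ_iff_lt_or_eq.1 hr with hr | rfl
      · rw [r3 _ (outside_row hc hr.ne), hI r hr c hc]
      · exact r2 c hc)
  exact ⟨τ, h1, h2⟩

/-- The remaining rows of the first matrix. -/
def vectorProg : Prog := forTo 15 dimE
  (.seq (rowProg 10 (.add runsE (V 15)) (.mul (V 30) (indE (.sub (V 17) (V 15)))))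
    (vecTo 10 17 runsE (.add (.mul (.add runsE (V 15)) (V 14)) (.add dimE (V 17)))
      (.mul (.mul scaleE (.get 1 (.add (.mul (V 17) dimE) (V 15))))
        (.div (V 30) (.get 2 (.add (.mul (V 17) dimE) (V 15)))))))

/-- Each row is first set to D times a unit vector, which also clears its right block. The right
block is then filled with s · num · (D / den), an integer form of s D w. -/
theorem run_vectorProg {b d m s D : ℕ} {σ : Mem} (h : HasInput d m s σ)
    (h14 : σ 14 0 = (d + m : ℕ))
    (h30 : σ 30 0 = D) (hb : d + m ≤ b) (hsD : ((d + m) * D : ℝ) ≤ 2 ^ b)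
    (hnum : ∀ k < m, ∀ i < d, |s * σ 1 (k * d + i) * (D / σ 2 (k * d + i))| ≤ 2 ^ b) :
    ∃ τ, Run b vectorProg σ τ ∧
      (∀ r < m, ∀ c < d + m, τ 10 (r * (d + m) + c) = σ 10 (r * (d + m) + c)) ∧
      ∀ i < d, (∀ c < d, τ 10 ((m + i) * (d + m) + c) = if c = i then (D : ℤ) else 0) ∧
        ∀ k < m, τ 10 ((m + i) * (d + m) + (d + k)) =
          s * σ 1 (k * d + i) * (D / σ 2 (k * d + i)) := by
  obtain ⟨τ, h1, h2⟩ := Run.forTo (b := b) (v := 15) (E := dimE)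
    (p := .seq (rowProg 10 (.add runsE (V 15)) (.mul (V 30) (indE (.sub (V 17) (V 15)))))
      (vecTo 10 17 runsE (.add (.mul (.add runsE (V 15)) (V 14)) (.add dimE (V 17)))
        (.mul (.mul scaleE (.get 1 (.add (.mul (V 17) dimE) (V 15))))
          (.div (V 30) (.get 2 (.add (.mul (V 17) dimE) (V 15)))))))
    (n := d) (σ := σ)
    (I := fun j τ => (∀ r < m, ∀ c < d + m, τ 10 (r * (d + m) + c) = σ 10 (r * (d + m) + c)) ∧
      ∀ i < j, (∀ c < d, τ 10 ((m + i) * (d + m) + c) = if c = i then (D : ℤ) else 0) ∧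
        ∀ k < m, τ 10 ((m + i) * (d + m) + (d + k)) =
          s * σ 1 (k * d + i) * (D / σ 2 (k * d + i))) (by omega) (by decide)
    (fun k τ z hk => by rw [Mem.write_of_ne (by decide)]; exact hk)
    ⟨fun _ _ _ _ => rfl, by simp⟩
    (fun k τ hf _ => h.eval_dimE (hf 0 (by decide)))
    (fun i hi τ hf h15 hI => by
      have hτ := h.congr (hf 0 (by decide))
      obtain ⟨υ, r1, -, r2, -, r3, r4⟩ := run_rowProg (b := b) (a := 10) (i := m + i)
        (N := d + m) (ei := .add runsE (V 15))
        (e := .mul (V 30) (indE (.sub (V 17) (V 15)))) (σ := τ)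
        (g := fun c => if c = i then (D : ℤ) else 0)
        (by rw [hf 14 (by decide), h14]) hb (by decide)
        (fun τ' h' => by
          simp only [eval, Int.toNat_zero, hτ.eval_runsE (h' 0 (by decide) (by decide))]
          rw [h' 15 (by decide) (by decide), h15]
          push_cast; rfl)
        (fun c hc τ' h' h17 _ => by
          simp only [eval, Int.toNat_zero, eval_indE, h17]
          rw [h' 15 (by decide) (by decide), h' 30 (by decide) (by decide), hf 30 (by decide), h30,
            h15]
          by_cases hc' : c = i
          · subst hc'; simp
          · rw [if_neg hc', if_neg (by omega), mul_zero])
        (by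
          refine (norm_intVec_le (A := D) (by positivity) fun c => ?_).trans
            (by push_cast; exact hsD)
          split_ifs
          · push_cast; rw [abs_of_nonneg (by positivity)]
          · simp)
      have hυ := hτ.congr (r4 0 (by decide) (by decide))
      obtain ⟨ρ, s1, s2, s3, s4⟩ := Run.vecTo (b := b) (a := 10) (v := 17) (E := runsE)
        (i := .add (.mul (.add runsE (V 15)) (V 14)) (.add dimE (V 17)))
        (e := .mul (.mul scaleE (.get 1 (.add (.mul (V 17) dimE) (V 15))))
          (.div (V 30) (.get 2 (.add (.mul (V 17) dimE) (V 15)))))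
        (N := m) (base := (m + i) * (d + m) + d) (σ := υ)
        (g := fun k => s * σ 1 (k * d + i) * (D / σ 2 (k * d + i)))
        (by omega) (by decide)
        (fun τ' h' => hυ.eval_runsE (h' 0 (by decide) (by decide)))
        (fun c hc τ' h' h17 => by
          have h0 := h' 0 (by decide) (by decide)
          simp only [eval, Int.toNat_zero, hυ.eval_runsE h0, hυ.eval_dimE h0, h17]
          rw [h' 15 (by decide) (by decide), h' 14 (by decide) (by decide),
            r4 15 (by decide) (by decide), r4 14 (by decide) (by decide), hf 14 (by decide), h14,
            h15]
          push_cast; ring)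
        (fun c hc τ' h' h17 _ => by
          have h0 := h' 0 (by decide) (by decide)
          have e15 : τ' 15 0 = i := by
            rw [h' 15 (by decide) (by decide), r4 15 (by decide) (by decide), h15]
          have e30 : τ' 30 0 = D := by
            rw [h' 30 (by decide) (by decide), r4 30 (by decide) (by decide), hf 30 (by decide),
              h30]
          have e1 : τ' 1 = σ 1 := by
            rw [h' 1 (by decide) (by decide), r4 1 (by decide) (by decide), hf 1 (by decide)]
          have e2 : τ' 2 = σ 2 := by
            rw [h' 2 (by decide) (by decide), r4 2 (by decide) (by decide), hf 2 (by decide)]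
          simp only [eval, Int.toNat_zero, hυ.eval_scaleE h0, hυ.eval_dimE h0, h17, e15, e30, e1,
            e2, toNat_index])
        (fun k hk => hnum k hk i hi)
      refine ⟨ρ, ⟨υ, r1, s1⟩, fun r hr c hc => ?_, fun j hj => ?_⟩
      · have ho := outside_row (i := m + i) hc (by omega : r ≠ m + i)
        rw [s3 _ (by omega), r3 _ ho, hI.1 r hr c hc]
      · rcases Nat.lt_succ_iff_lt_or_eq.1 hj with hj | rfl
        · refine ⟨fun c hc => ?_, fun k hk => ?_⟩
          · have ho := outside_row (i := m + i) (j := m + j) (by omega : c < d + m) (by omega)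
            rw [s3 _ (by omega), r3 _ ho, (hI.2 j hj).1 c hc]
          · have ho := outside_row (i := m + i) (j := m + j) (by omega : d + k < d + m) (by omega)
            rw [s3 _ (by omega), r3 _ ho, (hI.2 j hj).2 k hk]
        · refine ⟨fun c hc => ?_, fun k hk => ?_⟩
          · rw [s3 _ (by omega), r2 c (by omega)]
          · rw [← add_assoc, s2 k hk])
  exact ⟨τ, h1, h2⟩

end LLL

namespace LLL

open InnerProductSpace Finset PostProcess RAM RAM.Expr RAM.Prog

/-! ### Selecting short rows, building the second matrix, and writing the output -/

theorem abs_ediv_le {z D : ℤ} {b : ℕ} (h : |z| ≤ 2 ^ b) : |z / D| ≤ 2 ^ b := by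
  refine le_trans ?_ h
  have h1 := Int.natAbs_ediv_le_natAbs z D
  rw [Int.abs_eq_natAbs, Int.abs_eq_natAbs]
  exact_mod_cast h1

/-- Append the left part of row `V 15`, divided by the common denominator, to array `35`. -/
def appendProg : Prog :=
  .seq (vecTo 35 17 dimE (.add (.mul (V 34) dimE) (V 17)) (.div (entry 10 (V 15) (V 17)) (V 30)))
    (.set 34 (.const 0) (.add (V 34) (.const 1)))

theorem run_appendProg {b d m s D N i k : ℕ} {σ : Mem} (h : HasInput d m s σ) (h14 : σ 14 0 = N)
    (h15 : σ 15 0 = i) (h30 : σ 30 0 = D) (h34 : σ 34 0 = k) (hb : d ≤ b) (hk : k < b)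
    (hdN : d ≤ N) (hz : ‖row (σ 10) N i‖ ≤ 2 ^ b) :
    ∃ τ, Run b appendProg σ τ ∧ τ 34 0 = (k + 1 : ℕ) ∧
      (∀ c < d, τ 35 (k * d + c) = σ 10 (i * N + c) / D) ∧
      ∀ j < k, ∀ c < d, τ 35 (j * d + c) = σ 35 (j * d + c) := by
  obtain ⟨τ, h1, h2, h3, h4⟩ := Run.vecTo (b := b) (a := 35) (v := 17) (E := dimE)
    (i := .add (.mul (V 34) dimE) (V 17)) (e := .div (entry 10 (V 15) (V 17)) (V 30))
    (N := d) (base := k * d) (g := fun c => σ 10 (i * N + c) / D) (σ := σ) hb (by decide)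
    (fun τ h' => h.eval_dimE (h' 0 (by decide) (by decide)))
    (fun c hc τ h' h17 => by
      simp only [eval, Int.toNat_zero, h.eval_dimE (h' 0 (by decide) (by decide)), h17]
      rw [h' 34 (by decide) (by decide), h34]
      push_cast; rfl)
    (fun c hc τ h' h17 _ => by
      simp only [entry, eval, Int.toNat_zero, h17]
      rw [h' 10 (by decide) (by decide), h' 14 (by decide) (by decide),
        h' 15 (by decide) (by decide), h' 30 (by decide) (by decide), h14, h15, h30,
        toNat_index])
    (fun c hc => abs_ediv_le (int_le_of_real_le (abs_le_norm_row _ _ (hc.trans_le hdN)) hz))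
  refine ⟨_, ⟨τ, h1, Run.set_const_zero (z := (k + 1 : ℕ)) ?_ ?_⟩, Mem.write_self _ _ _ _,
    fun c hc => ?_, fun j hj c hc => ?_⟩
  · simp only [eval, Int.toNat_zero]
    rw [h4 34 (by decide) (by decide), h34]
    push_cast; rfl
  · rw [Nat.abs_cast]
    have : k + 1 ≤ 2 ^ b := (Nat.succ_le_of_lt hk).trans Nat.lt_two_pow_self.le
    exact_mod_cast this
  · rw [Mem.write_of_ne (by decide), h2 c hc]
  · rw [Mem.write_of_ne (by decide), h3]
    have := outside_row hc hj.ne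
    exact this

/-- Row `r` of the matrix `f` with `N` columns is short enough to be kept. -/
def IsShortRow (f : ℕ → ℤ) (N d s D r : ℕ) : Prop :=
  (16 * 2 ^ d) ^ 2 * ‖row f N r‖ ^ 2 ≤ (s * D : ℝ) ^ 2

/-- Collect the left parts of the short rows in array `35`, and count them in array `34`. -/
def selProg : Prog :=
  .seq (.set 34 (.const 0) (.const 0)) (forTo 15 (V 13)
    (.seq (dotProg 10 (V 15) 10 (V 15))
      (.ifPos (.sub (.add (.mul (.mul scaleE (V 30)) (.mul scaleE (V 30))) (.const 1))
        (.mul (.mul (.mul (.const 16) (V 31)) (.mul (.const 16) (V 31))) (V 18)))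
        appendProg .skip)))

theorem run_selProg {b d m s D N : ℕ} {σ : Mem} (h : HasInput d m s σ) (h13 : σ 13 0 = N)
    (h14 : σ 14 0 = N) (h30 : σ 30 0 = D) (h31 : σ 31 0 = 2 ^ d) (hdN : d ≤ N) (hNb : N ≤ b)
    (hz : ∀ r < N, ‖row (σ 10) N r‖ * ‖row (σ 10) N r‖ ≤ 2 ^ b)
    (hz' : ∀ r < N, ‖row (σ 10) N r‖ ≤ 2 ^ b) :
    ∃ τ, Run b selProg σ τ ∧ ∃ k ≤ N, τ 34 0 = k ∧
      (∀ t < k, ∃ r < N, IsShortRow (σ 10) N d s D r ∧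
        ∀ c < d, τ 35 (t * d + c) = σ 10 (r * N + c) / D) ∧
      ∀ r < N, IsShortRow (σ 10) N d s D r →
        ∃ t < k, ∀ c < d, τ 35 (t * d + c) = σ 10 (r * N + c) / D := by
  obtain ⟨τ, h1, h2⟩ := Run.forTo (b := b) (v := 15) (E := V 13)
    (p := .seq (dotProg 10 (V 15) 10 (V 15))
      (.ifPos (.sub (.add (.mul (.mul scaleE (V 30)) (.mul scaleE (V 30))) (.const 1))
        (.mul (.mul (.mul (.const 16) (V 31)) (.mul (.const 16) (V 31))) (V 18)))
        appendProg .skip))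
    (n := N) (σ := σ.write 34 0 0)
    (I := fun i τ => ∃ k ≤ i, τ 34 0 = k ∧
      (∀ t < k, ∃ r < i, IsShortRow (σ 10) N d s D r ∧
        ∀ c < d, τ 35 (t * d + c) = σ 10 (r * N + c) / D) ∧
      ∀ r < i, IsShortRow (σ 10) N d s D r →
        ∃ t < k, ∀ c < d, τ 35 (t * d + c) = σ 10 (r * N + c) / D) hNb (by decide)
    (fun k τ z hk => by
      rw [Mem.write_of_ne (by decide), Mem.write_of_ne (by decide)]; exact hk)
    ⟨0, le_rfl, by simp, by simp, by simp⟩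
    (fun k τ hf _ => by
      simp only [eval, Int.toNat_zero]
      rw [hf 13 (by decide), Mem.write_of_ne (by decide), h13])
    (fun i hi τ hf h15 hI => by
      have hfr : ∀ a, a ∉ 15 :: (Prog.seq (dotProg 10 (V 15) 10 (V 15))
          (.ifPos (.sub (.add (.mul (.mul scaleE (V 30)) (.mul scaleE (V 30))) (.const 1))
            (.mul (.mul (.mul (.const 16) (V 31)) (.mul (.const 16) (V 31))) (V 18)))
            appendProg .skip)).writes → a ≠ 34 → τ a = σ a := fun a ha h34 => by
        rw [hf a ha, Mem.write_of_ne h34]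
      have t10 := hfr 10 (by decide) (by decide)
      have t14 : τ 14 0 = N := by rw [hfr 14 (by decide) (by decide), h14]
      obtain ⟨υ, r1, r2, r3⟩ := run_dotProg (b := b) (a := 10) (a' := 10) (i := i) (k := i)
        (N := N) (ei := V 15) (ek := V 15) (σ := τ) t14 hNb (by decide) (by decide)
        (fun τ' h' => by
          simp only [eval, Int.toNat_zero]; rw [h' 15 (by decide) (by decide), h15])
        (fun τ' h' => by
          simp only [eval, Int.toNat_zero]; rw [h' 15 (by decide) (by decide), h15])
        (by rw [t10]; exact hz i hi)
      have u0 : υ 0 = σ 0 := by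
        rw [r3 0 (by decide) (by decide), hfr 0 (by decide) (by decide)]
      have u30 : υ 30 0 = D := by
        rw [r3 30 (by decide) (by decide), hfr 30 (by decide) (by decide), h30]
      have u31 : υ 31 0 = 2 ^ d := by
        rw [r3 31 (by decide) (by decide), hfr 31 (by decide) (by decide), h31]
      have u10 : υ 10 = σ 10 := by rw [r3 10 (by decide) (by decide), t10]
      have u14 : υ 14 0 = N := by rw [r3 14 (by decide) (by decide), t14]
      have u15 : υ 15 0 = i := by rw [r3 15 (by decide) (by decide), h15]
      have u34 : υ 34 = τ 34 := r3 34 (by decide) (by decide)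
      have u35 : υ 35 = τ 35 := r3 35 (by decide) (by decide)
      obtain ⟨k, hk, hk1, hk2, hk3⟩ := hI
      rw [t10, real_inner_self_eq_norm_sq] at r2
      -- Branching tests strict positivity; the added 1 turns it into the non-strict comparison of
      -- integers in `IsShortRow`.
      have hcond : 0 < (Expr.sub (.add (.mul (.mul scaleE (V 30)) (.mul scaleE (V 30))) (.const 1))
          (.mul (.mul (.mul (.const 16) (V 31)) (.mul (.const 16) (V 31))) (V 18))).eval υ ↔
          IsShortRow (σ 10) N d s D i := by
        simp only [eval, Int.toNat_zero, h.eval_scaleE u0, u30, u31, IsShortRow]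
        rw [← r2]
        rw [show ((16 * 2 ^ d) ^ 2 * (υ 18 0 : ℝ) ≤ (s * D : ℝ) ^ 2) ↔
          (16 * 2 ^ d) ^ 2 * (υ 18 0) ≤ (s * D : ℤ) ^ 2 by exact_mod_cast Iff.rfl]
        rw [pow_two (16 * 2 ^ d : ℤ), pow_two (s * D : ℤ)]
        constructor <;> intro h <;> linarith
      by_cases hs : IsShortRow (σ 10) N d s D i
      · obtain ⟨ρ, s1, s2, s3, s4⟩ := run_appendProg (b := b) (i := i) (k := k) (N := N)
          (h.congr u0) u14 u15 u30 (by rw [u34, hk1]) (by omega) (by omega) hdN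
          (by rw [u10]; exact hz' i hi)
        rw [u10] at s3
        rw [u35] at s4
        refine ⟨ρ, ⟨υ, r1, Or.inl ⟨hcond.2 hs, s1⟩⟩, k + 1, by omega, s2, fun t ht => ?_,
          fun r hr hrs => ?_⟩
        · rcases Nat.lt_succ_iff_lt_or_eq.1 ht with ht | rfl
          · obtain ⟨r, hr, hrs, hrc⟩ := hk2 t ht
            exact ⟨r, by omega, hrs, fun c hc => by rw [s4 t ht c hc, hrc c hc]⟩
          · exact ⟨i, by omega, hs, s3⟩
        · rcases Nat.lt_succ_iff_lt_or_eq.1 hr with hr | rfl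
          · obtain ⟨t, ht, htc⟩ := hk3 r hr hrs
            exact ⟨t, by omega, fun c hc => by rw [s4 t ht c hc, htc c hc]⟩
          · exact ⟨k, by omega, s3⟩
      · refine ⟨υ, ⟨υ, r1, Or.inr ⟨fun h => hs (hcond.1 h), rfl⟩⟩, k, by omega, by rw [u34, hk1],
          fun t ht => ?_, fun r hr hrs => ?_⟩
        · obtain ⟨r, hr, hrs, hrc⟩ := hk2 t ht
          exact ⟨r, by omega, hrs, fun c hc => by rw [u35, hrc c hc]⟩
        · rcases Nat.lt_succ_iff_lt_or_eq.1 hr with hr | rfl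
          · obtain ⟨t, ht, htc⟩ := hk3 r hr hrs
            exact ⟨t, by omega, fun c hc => by rw [u35, htc c hc]⟩
          · exact absurd hrs hs)
  exact ⟨τ, ⟨_, Run.set_const_zero (z := 0) rfl (by simp), h1⟩, h2⟩

/-- The rows of the second matrix. -/
def genProg : Prog :=
  .seq (.set 13 (.const 0) (V 34))
  (.seq (.set 14 (.const 0) (.add dimE (V 34)))
  (forTo 15 (V 34)
    (.seq (rowProg 10 (V 15) (indE (.sub (V 17) (.add dimE (V 15)))))
      (vecTo 10 17 dimE (.add (.mul (V 15) (V 14)) (V 17))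
        (.mul (V 33) (.get 35 (.add (.mul (V 15) dimE) (V 17))))))))

theorem run_genProg {b d m s k Q : ℕ} {σ : Mem} (h : HasInput d m s σ) (h33 : σ 33 0 = Q)
    (h34 : σ 34 0 = k) (hb : d + k ≤ b)
    (hx : ∀ t < k, ∀ c < d, |(Q : ℤ) * σ 35 (t * d + c)| ≤ 2 ^ b) :
    ∃ τ, Run b genProg σ τ ∧ τ 13 0 = k ∧ τ 14 0 = (d + k : ℕ) ∧ ∀ t < k,
      (∀ c < d, τ 10 (t * (d + k) + c) = Q * σ 35 (t * d + c)) ∧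
      ∀ u < k, τ 10 (t * (d + k) + (d + u)) = if u = t then 1 else 0 := by
  have hkb : ((d + k : ℕ) : ℤ) ≤ 2 ^ b := by
    exact_mod_cast hb.trans Nat.lt_two_pow_self.le
  set σ1 := σ.write 13 0 (k : ℤ) with hσ1
  set σ2 := σ1.write 14 0 ((d + k : ℕ) : ℤ) with hσ2
  have w2 : ∀ a, a ≠ 13 → a ≠ 14 → σ2 a = σ a := fun a h1 h2 => by
    rw [hσ2, Mem.write_of_ne h2, hσ1, Mem.write_of_ne h1]
  have e1 : (V 34).eval σ = k := by simp only [eval, Int.toNat_zero, h34]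
  have e2 : (Expr.add dimE (V 34)).eval σ1 = (d + k : ℕ) := by
    have h0 : σ1 0 = σ 0 := Mem.write_of_ne (by decide) _ _
    have h4 : σ1 34 = σ 34 := Mem.write_of_ne (by decide) _ _
    simp only [eval, Int.toNat_zero, h.eval_dimE h0, h4, h34]
    push_cast; rfl
  obtain ⟨τ, h1, h2⟩ := Run.forTo (b := b) (v := 15) (E := V 34)
    (p := .seq (rowProg 10 (V 15) (indE (.sub (V 17) (.add dimE (V 15)))))
      (vecTo 10 17 dimE (.add (.mul (V 15) (V 14)) (V 17))
        (.mul (V 33) (.get 35 (.add (.mul (V 15) dimE) (V 17))))))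
    (n := k) (σ := σ2)
    (I := fun j τ => ∀ t < j,
      (∀ c < d, τ 10 (t * (d + k) + c) = Q * σ 35 (t * d + c)) ∧
      ∀ u < k, τ 10 (t * (d + k) + (d + u)) = if u = t then 1 else 0) (by omega) (by decide)
    (fun k τ z hk => by rw [Mem.write_of_ne (by decide)]; exact hk) (by simp)
    (fun j τ hf _ => by
      simp only [eval, Int.toNat_zero]
      rw [hf 34 (by decide), w2 34 (by decide) (by decide), h34])
    (fun i hi τ hf h15 hI => by
      have t0 : τ 0 = σ 0 := by rw [hf 0 (by decide), w2 0 (by decide) (by decide)]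
      have t14 : τ 14 0 = (d + k : ℕ) := by rw [hf 14 (by decide), hσ2, Mem.write_self]
      have t33 : τ 33 0 = Q := by rw [hf 33 (by decide), w2 33 (by decide) (by decide), h33]
      have t35 : τ 35 = σ 35 := by rw [hf 35 (by decide), w2 35 (by decide) (by decide)]
      have ht := h.congr t0
      obtain ⟨υ, r1, -, r2, -, r3, r4⟩ := run_rowProg (b := b) (a := 10) (i := i) (N := d + k)
        (ei := V 15) (e := indE (.sub (V 17) (.add dimE (V 15)))) (σ := τ)
        (g := fun c => if c = d + i then 1 else 0) t14 hb (by decide)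
        (fun τ' h' => by
          simp only [eval, Int.toNat_zero]
          rw [h' 15 (by decide) (by decide), h15])
        (fun c hc τ' h' h17 _ => by
          simp only [eval, Int.toNat_zero, eval_indE, h17,
            ht.eval_dimE (h' 0 (by decide) (by decide))]
          rw [h' 15 (by decide) (by decide), h15]
          by_cases hc' : c = d + i
          · subst hc'; simp
          · rw [if_neg hc', if_neg (by omega)])
        (by
          refine (norm_intVec_le (A := 1) (by positivity) fun c => ?_).trans ?_
          · split_ifs <;> simp
          · rw [mul_one]; exact_mod_cast hkb)
      have hu := ht.congr (r4 0 (by decide) (by decide))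
      obtain ⟨ρ, s1, s2, s3, s4⟩ := Run.vecTo (b := b) (a := 10) (v := 17) (E := dimE)
        (i := .add (.mul (V 15) (V 14)) (V 17))
        (e := .mul (V 33) (.get 35 (.add (.mul (V 15) dimE) (V 17))))
        (N := d) (base := i * (d + k)) (σ := υ) (g := fun c => Q * σ 35 (i * d + c))
        (by omega) (by decide)
        (fun τ' h' => hu.eval_dimE (h' 0 (by decide) (by decide)))
        (fun c hc τ' h' h17 => by
          simp only [eval, Int.toNat_zero, h17]
          rw [h' 15 (by decide) (by decide), h' 14 (by decide) (by decide),
            r4 15 (by decide) (by decide), r4 14 (by decide) (by decide), t14, h15]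
          push_cast; ring)
        (fun c hc τ' h' h17 _ => by
          simp only [eval, Int.toNat_zero, h17, hu.eval_dimE (h' 0 (by decide) (by decide))]
          rw [h' 15 (by decide) (by decide), h' 33 (by decide) (by decide),
            h' 35 (by decide) (by decide), r4 15 (by decide) (by decide),
            r4 33 (by decide) (by decide), r4 35 (by decide) (by decide), t33, t35, h15,
            toNat_index])
        (fun c hc => hx i hi c hc)
      refine ⟨ρ, ⟨υ, r1, s1⟩, fun j hj => ?_⟩
      rcases Nat.lt_succ_iff_lt_or_eq.1 hj with hj | rfl
      · refine ⟨fun c hc => ?_, fun u hu => ?_⟩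
        · have ho := outside_row (i := i) (j := j) (by omega : c < d + k) (by omega)
          rw [s3 _ (by omega), r3 _ ho, (hI j hj).1 c hc]
        · have ho := outside_row (i := i) (j := j) (by omega : d + u < d + k) (by omega)
          rw [s3 _ (by omega), r3 _ ho, (hI j hj).2 u hu]
      · refine ⟨fun c hc => s2 c hc, fun u hu => ?_⟩
        rw [s3 _ (by omega), r2 _ (by omega)]
        simp)
  refine ⟨τ, ⟨σ1, Run.set_const_zero e1 ?_, σ2, Run.set_const_zero e2 ?_, h1⟩, ?_, ?_, h2⟩
  · rw [Nat.abs_cast]; push_cast at hkb; linarith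
  · rw [Nat.abs_cast]; exact hkb
  · rw [h1.frame (by decide), hσ2, Mem.write_of_ne (by decide), hσ1, Mem.write_self]
  · rw [h1.frame (by decide), hσ2, Mem.write_self]

/-- Write the left parts of the last rows, divided by the weight, to array `3`. -/
def outProg : Prog := forTo 15 dimE
  (vecTo 3 17 dimE (.add (.mul dimE (V 15)) (V 17))
    (.div (entry 10 (.add (.sub (V 13) dimE) (V 15)) (V 17)) (V 33)))

/-- The program must also halt cheaply when k < d. The row index may then be negative and the cell
that is read has no meaning, so the written values are controlled by a bound on the whole memory,
and the output is described only for d ≤ k. -/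
theorem run_outProg {b d m s Q N k : ℕ} {σ : Mem} (h : HasInput d m s σ) (h13 : σ 13 0 = k)
    (h14 : σ 14 0 = N) (h33 : σ 33 0 = Q) (hb : d ≤ b) (hσ : ∀ a k, |σ a k| ≤ 2 ^ b) :
    ∃ τ, Run b outProg σ τ ∧ (d ≤ k → ∀ i < d, ∀ c < d,
      τ 3 (d * i + c) = σ 10 ((k - d + i) * N + c) / Q) := by
  obtain ⟨τ, h1, h2⟩ := Run.forTo (b := b) (v := 15) (E := dimE)
    (p := vecTo 3 17 dimE (.add (.mul dimE (V 15)) (V 17))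
      (.div (entry 10 (.add (.sub (V 13) dimE) (V 15)) (V 17)) (V 33)))
    (n := d) (σ := σ)
    (I := fun j τ => d ≤ k → ∀ i < j, ∀ c < d,
      τ 3 (d * i + c) = σ 10 ((k - d + i) * N + c) / Q) hb (by decide)
    (fun k τ z hk => by rw [Mem.write_of_ne (by decide)]; exact hk) (by simp)
    (fun j τ hf _ => h.eval_dimE (hf 0 (by decide)))
    (fun i hi τ hf h15 hI => by
      have ht := h.congr (hf 0 (by decide))
      obtain ⟨ρ, s1, s2, s3, s4⟩ := Run.vecTo (b := b) (a := 3) (v := 17) (E := dimE)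
        (i := .add (.mul dimE (V 15)) (V 17))
        (e := .div (entry 10 (.add (.sub (V 13) dimE) (V 15)) (V 17)) (V 33))
        (N := d) (base := d * i) (σ := τ)
        (g := fun c => σ 10 ((((k : ℤ) - d + i) * N + c).toNat) / Q)
        hb (by decide)
        (fun τ' h' => ht.eval_dimE (h' 0 (by decide) (by decide)))
        (fun c hc τ' h' h17 => by
          simp only [eval, Int.toNat_zero, h17, ht.eval_dimE (h' 0 (by decide) (by decide))]
          rw [h' 15 (by decide) (by decide), h15]
          push_cast; ring)
        (fun c hc τ' h' h17 _ => by
          simp only [entry, eval, Int.toNat_zero, h17, ht.eval_dimE (h' 0 (by decide) (by decide))]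
          rw [h' 15 (by decide) (by decide), h' 33 (by decide) (by decide),
            h' 10 (by decide) (by decide), h' 13 (by decide) (by decide),
            h' 14 (by decide) (by decide), hf 10 (by decide), hf 13 (by decide),
            hf 14 (by decide), hf 33 (by decide), h15, h13, h14, h33])
        (fun c hc => abs_ediv_le (hσ _ _))
      refine ⟨ρ, s1, fun hdk j hj c hc => ?_⟩
      rcases Nat.lt_succ_iff_lt_or_eq.1 hj with hj | rfl
      · have ho := outside_row hc hj.ne
        rw [mul_comm, s3 _ (by rw [mul_comm d i]; exact ho), mul_comm, hI hdk j hj c hc]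
      · rw [s2 c hc]
        congr 2
        obtain ⟨e, rfl⟩ := Nat.exists_eq_add_of_le hdk
        rw [Nat.add_sub_cancel_left]
        rw [show (((d + e : ℕ) : ℤ) - d + j) * N + c = (((e + j) * N + c : ℕ) : ℤ) by
          push_cast; ring]
        exact Int.toNat_natCast _)
  exact ⟨τ, h1, h2⟩

end LLL

namespace LLL

open InnerProductSpace Finset PostProcess RAM RAM.Expr RAM.Prog

/-! ### The input in memory -/

theorem flatten_apply {k n : ℕ} (M : Fin k → Fin n → ℤ) (i : Fin k) (j : Fin n) :
    flatten M (i * n + j) = M i j := by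
  have hn : 0 < n := j.pos
  have h1 : (i * n + j : ℕ) / n = i := by
    rw [mul_comm, Nat.mul_add_div hn, Nat.div_eq_of_lt j.2, add_zero]
  have h2 : (i * n + j : ℕ) % n = j := by
    rw [mul_comm, Nat.mul_add_mod, Nat.mod_eq_of_lt j.2]
  unfold flatten
  simp only [h1, h2]
  rw [dif_pos ⟨i.2, j.2⟩]

theorem load_num (x : Input) (k : Fin x.m) (i : Fin x.d) :
    x.load 1 (k * x.d + i) = (x.w k i).num :=
  flatten_apply (fun i j => (x.w i j).num) k i

theorem load_den (x : Input) (k : Fin x.m) (i : Fin x.d) :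
    x.load 2 (k * x.d + i) = (x.w k i).den := flatten_apply (fun i j => ((x.w i j).den : ℤ)) k i

theorem hasInput_load (x : Input) : HasInput x.d x.m (x.scale + 1) x.load :=
  ⟨rfl, rfl, by simp [Input.load]⟩

theorem flatten_prop {P : ℤ → Prop} {k n : ℕ} {M : Fin k → Fin n → ℤ} (h0 : P 0)
    (h : ∀ i j, P (M i j)) (c : ℕ) : P (flatten M c) := by
  unfold flatten
  split_ifs
  · exact h _ _
  · exact h0

theorem load_den_nat (x : Input) (t : ℕ) : ∃ c : ℕ, x.load 2 t = c :=
  flatten_prop (P := fun z => ∃ c : ℕ, z = c) ⟨0, rfl⟩ (fun i j => ⟨(x.w i j).den, rfl⟩) t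

/-- The product of all denominators. -/
def denProd (x : Input) : ℕ := ∏ k, ∏ i, (x.w k i).den

theorem denProd_ne_zero (x : Input) : denProd x ≠ 0 :=
  prod_ne_zero_iff.2 fun _ _ => prod_ne_zero_iff.2 fun _ _ => Rat.den_nz _

theorem den_dvd_denProd (x : Input) (k : Fin x.m) (i : Fin x.d) : (x.w k i).den ∣ denProd x :=
  (dvd_prod_of_mem (fun i => (x.w k i).den) (mem_univ i)).trans
    (dvd_prod_of_mem (fun k => ∏ i, (x.w k i).den) (mem_univ k))

theorem prod_range_mul {M : Type*} [CommMonoid M] (f : ℕ → M) (m d : ℕ) :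
    ∏ t ∈ range (m * d), f t = ∏ k : Fin m, ∏ i : Fin d, f (k * d + i) := by
  induction m with
  | zero => simp
  | succ m ih =>
    rw [add_mul, one_mul, prod_range_add, ih, Fin.prod_univ_castSucc, prod_range (n := d)]
    rfl

theorem denProd_eq (x : Input) : (denProd x : ℤ) = ∏ t ∈ range (x.m * x.d), x.load 2 t := by
  rw [prod_range_mul, denProd]
  push_cast
  exact prod_congr rfl fun k _ => prod_congr rfl fun i _ => (load_den x k i).symm

theorem le_two_pow_bits (n : ℕ) : n + 1 ≤ 2 ^ (bits n) := by
  have := natAbs_lt_two_pow_bits (n : ℤ)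
  rw [Int.natAbs_natCast] at this
  exact Nat.succ_le_of_lt (this.trans_le (Nat.pow_le_pow_right (by norm_num) (Nat.sub_le _ _)))

theorem sum_bits_le_size (x : Input) :
    (∑ i, ∑ j, bits (x.w i j).num) + ∑ i, ∑ j, bits (x.w i j).den ≤ x.size := by
  unfold Input.size
  simp only [sum_add_distrib]
  omega

theorem denProd_le (x : Input) : denProd x ≤ 2 ^ x.size := by
  calc denProd x ≤ ∏ k, ∏ i, 2 ^ bits (x.w k i).den :=
        prod_le_prod' fun k _ => prod_le_prod' fun i _ =>
          (Nat.le_succ _).trans (le_two_pow_bits _)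
    _ = 2 ^ ∑ k, ∑ i, bits (x.w k i).den := by simp only [prod_pow_eq_pow_sum]
    _ ≤ _ := Nat.pow_le_pow_right (by norm_num) (by have := sum_bits_le_size x; omega)

theorem abs_le_two_pow_bits (z : ℤ) : |z| ≤ 2 ^ bits z := by
  rw [Int.abs_eq_natAbs]
  have := (natAbs_lt_two_pow_bits z).le.trans
    (Nat.pow_le_pow_right (by norm_num) (Nat.sub_le (bits z) 1))
  exact_mod_cast this

theorem bits_num_le_size (x : Input) (k : Fin x.m) (i : Fin x.d) :
    bits (x.w k i).num + bits (x.w k i).den ≤ x.size := by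
  unfold Input.size
  have h1 := single_le_sum (f := fun j => bits (x.w k j).num + bits (x.w k j).den)
    (fun _ _ => Nat.zero_le _) (mem_univ i)
  have h2 := single_le_sum (f := fun k => ∑ j, (bits (x.w k j).num + bits (x.w k j).den))
    (fun _ _ => Nat.zero_le _) (mem_univ k)
  exact h1.trans (h2.trans (Nat.le_add_left _ _))

theorem abs_num_le (x : Input) (k : Fin x.m) (i : Fin x.d) : |(x.w k i).num| ≤ 2 ^ x.size :=
  (abs_le_two_pow_bits _).trans
    (pow_le_pow_right₀ (by norm_num) (by have := bits_num_le_size x k i; omega))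

theorem scale_le (x : Input) : x.scale + 1 ≤ 2 ^ x.size :=
  (le_two_pow_bits _).trans
    (Nat.pow_le_pow_right (by norm_num) (by unfold Input.size; omega))

theorem abs_load_le (x : Input) (a c : ℕ) : |x.load a c| ≤ 2 ^ x.size := by
  have h0 : |(0 : ℤ)| ≤ 2 ^ x.size := by simp
  have hn : ∀ n : ℕ, n ≤ x.size → |(n : ℤ)| ≤ 2 ^ x.size := fun n hn => by
    rw [Nat.abs_cast]
    exact_mod_cast hn.trans Nat.lt_two_pow_self.le
  unfold Input.load
  split_ifs
  · exact hn _ (by unfold Input.size; omega)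
  · exact hn _ (by unfold Input.size; omega)
  · rw [Nat.abs_cast]
    exact_mod_cast (Nat.le_succ _).trans (scale_le x)
  · exact h0
  · exact flatten_prop (P := fun z => |z| ≤ 2 ^ x.size) h0 (abs_num_le x) c
  · refine flatten_prop (P := fun z => |z| ≤ 2 ^ x.size) h0 (fun k i => (abs_le_two_pow_bits _).trans
      (pow_le_pow_right₀ (by norm_num) (by have := bits_num_le_size x k i; omega))) c
  · exact h0

/-! ### Generators of the lattice -/

/-- The basis of the lattice of the runs. -/
def matrixProg : Prog := .seq initProg (.seq shiftProg vectorProg)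

/-- The conditions on the lattice of the runs under which the algorithm finds `L`. -/
structure Recovers (x : Input) (L : Submodule ℤ (E x.d)) : Prop where
  span_top : Submodule.span ℝ (L : Set (E x.d)) = ⊤
  mem : ∀ a y, runNormSq (x.scale + 1 : ℕ) (fun k i => (x.w k i : ℝ)) a y ≤
    ((x.scale + 1 : ℕ) / (16 * 2 ^ x.d)) ^ 2 → intVec a ∈ L
  le_span : ∃ T : ℝ, 0 ≤ T ∧ (x.d + x.m : ℕ) * 2 ^ (x.d + x.m) * T ^ 2 ≤
      ((x.scale + 1 : ℕ) / (16 * 2 ^ x.d)) ^ 2 ∧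
    L ≤ Submodule.span ℤ {v | ∃ a y, v = intVec a ∧
      runNormSq (x.scale + 1 : ℕ) (fun k i => (x.w k i : ℝ)) a y ≤ T ^ 2}

/-- The weight of the second reduction. -/
def weight (n s : ℕ) : ℕ := (2 * (n + 1) * s) ^ ((n + 2) * (n + 2))

theorem weight_le {n s z : ℕ} (hn : n ≤ 2 * z) (hs : s ≤ 2 ^ z) :
    weight n s ≤ 2 ^ (8 * (z + 1) ^ 3) := by
  have hz : z + 1 ≤ 2 ^ z := Nat.lt_two_pow_self
  have h1 : 2 * (n + 1) * s ≤ 2 ^ (2 * z + 2) := by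
    calc 2 * (n + 1) * s ≤ 2 * (2 * (z + 1)) * 2 ^ z := by gcongr; omega
      _ ≤ 2 * (2 * 2 ^ z) * 2 ^ z := by gcongr
      _ = 2 ^ (2 * z + 2) := by ring
  calc weight n s ≤ (2 ^ (2 * z + 2)) ^ ((n + 2) * (n + 2)) := Nat.pow_le_pow_left h1 _
    _ = 2 ^ ((2 * z + 2) * ((n + 2) * (n + 2))) := (pow_mul _ _ _).symm
    _ ≤ 2 ^ ((2 * z + 2) * ((2 * z + 2) * (2 * z + 2))) := by gcongr; norm_num
    _ = _ := by congr 1; ring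

/-- The common bound 13824 (z + 1)^9 = 8 (12 (z + 1)³)³, with z the input size, is dictated by the
second reduction, whose entries have about (z + 1)³ bits. Here it leaves ample room. -/
theorem run_matrixProg {x : Input} {b : ℕ} (hb : 13824 * (x.size + 1) ^ 9 ≤ b) :
    ∃ τ, Run b matrixProg x.load τ ∧ HasInput x.d x.m (x.scale + 1) τ ∧
      τ 13 0 = (x.d + x.m : ℕ) ∧ τ 14 0 = (x.d + x.m : ℕ) ∧ τ 30 0 = denProd x ∧
      τ 31 0 = 2 ^ x.d ∧ τ 33 0 = weight (x.d + x.m) (x.scale + 1) ∧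
      IsRunBasis (x.scale + 1 : ℕ) (denProd x) (fun k i => (x.w k i : ℝ))
        (row (τ 10) (x.d + x.m)) ∧
      ∀ r < x.d + x.m, ‖row (τ 10) (x.d + x.m) r‖ ≤ 2 ^ (4 * x.size) := by
  have hy : ∀ e, 1 ≤ e → e ≤ 9 → (x.size + 1) ^ e ≤ (x.size + 1) ^ 9 := fun e _ he =>
    Nat.pow_le_pow_right (by omega) he
  have hy1 := hy 1 (by norm_num) (by norm_num)
  have hy2 := hy 2 (by norm_num) (by norm_num)
  have hy3 := hy 3 (by norm_num) (by norm_num)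
  rw [pow_one] at hy1
  have hdm : x.d + x.m ≤ x.size := by unfold Input.size; omega
  have hsz := scale_le x
  have hDz := denProd_le x
  have hDu := abs_num_le x
  have hdvd := den_dvd_denProd x
  have hDe := denProd_eq x
  have hD0 := denProd_ne_zero x
  have hin := hasInput_load x
  have hW := weight_le (hdm.trans (Nat.le_mul_of_pos_left x.size two_pos)) hsz
  generalize hz : x.size = z at *
  generalize hs : x.scale + 1 = s at *
  generalize hD : denProd x = D at *
  have hs1 : 1 ≤ s := by omega
  have hzb : 8 * (z + 1) ^ 3 ≤ b := by omega
  have hpb : ∀ e ≤ 1728 * (z + 1), (2 : ℝ) ^ e ≤ 2 ^ b := fun e he =>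
    pow_le_pow_right₀ (by norm_num) (by omega)
  have hzz : (2 * (z + 1)) * (2 * (z + 1)) ≤ b := by
    rw [show (2 * (z + 1)) * (2 * (z + 1)) = 4 * (z + 1) ^ 2 by ring]
    omega
  have hNz : ((x.d + x.m : ℕ) : ℝ) ≤ 2 ^ z := by exact_mod_cast hdm.trans Nat.lt_two_pow_self.le
  have hsR : (s : ℝ) ≤ 2 ^ z := by exact_mod_cast hsz
  have hDR : (D : ℝ) ≤ 2 ^ z := by exact_mod_cast hDz
  have hsD : ((x.d + x.m : ℕ) : ℝ) * (s * D) ≤ 2 ^ b := by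
    calc _ ≤ (2 : ℝ) ^ z * (2 ^ z * 2 ^ z) := by gcongr
      _ = 2 ^ (3 * z) := by ring
      _ ≤ _ := hpb _ (by omega)
  have hNb : x.d + x.m ≤ b := by omega
  obtain ⟨σ1, a1, a2, a3, a4, a5, a6⟩ := run_initProg (b := b) (D := D) hin (load_den_nat x) hDe
    hNb ((Nat.mul_le_mul (by omega) (by omega)).trans hzz)
    ((Nat.mul_le_mul (by omega) (by omega)).trans hzz) (hDz.trans (Nat.pow_le_pow_right (by norm_num) (by omega)))
    hD0 (hW.trans (Nat.pow_le_pow_right (by norm_num) hzb)) hs1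
  have h1 := hin.congr (a1.frame (a := 0) (by decide))
  obtain ⟨σ2, b1, b2⟩ := run_shiftProg (b := b) h1 a3 a4 hNb (by exact_mod_cast hsD)
  have h2 := h1.congr (b1.frame (a := 0) (by decide))
  have e1 : σ2 1 = x.load 1 := by rw [b1.frame (by decide), a1.frame (by decide)]
  have e2 : σ2 2 = x.load 2 := by rw [b1.frame (by decide), a1.frame (by decide)]
  have hent : ∀ (k : Fin x.m) (i : Fin x.d),
      |s * σ2 1 (k * x.d + i) * (D / σ2 2 (k * x.d + i))| ≤ 2 ^ (3 * z) := by
    intro k i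
    rw [e1, e2, load_num, load_den, abs_mul, abs_mul]
    have h4 : |((D : ℤ) / ((x.w k i).den : ℤ))| ≤ 2 ^ z :=
      abs_ediv_le (by rw [Nat.abs_cast]; exact_mod_cast hDz)
    have h5 : |(s : ℤ)| ≤ 2 ^ z := by rw [Nat.abs_cast]; exact_mod_cast hsz
    calc _ ≤ (2 : ℤ) ^ z * 2 ^ z * 2 ^ z := by gcongr; exact hDu k i
      _ = _ := by ring
  obtain ⟨σ3, c1, c2, c3⟩ := run_vectorProg (b := b) h2
    (by rw [b1.frame (by decide), a3]) (D := D) (by rw [b1.frame (by decide), a4]) hNb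
    (by
      refine le_trans ?_ hsD
      push_cast
      gcongr
      exact le_mul_of_one_le_left (by positivity) (by exact_mod_cast hs1))
    (fun k hk i hi => (hent ⟨k, hk⟩ ⟨i, hi⟩).trans
      (pow_le_pow_right₀ (by norm_num) (by omega)))
  have hbd : ∀ r < x.d + x.m, ∀ c : Fin (x.d + x.m),
      |σ3 10 (r * (x.d + x.m) + c)| ≤ 2 ^ (3 * z) := by
    have p0 : |(0 : ℤ)| ≤ 2 ^ (3 * z) := by simp
    have p1 : |(D : ℤ)| ≤ 2 ^ (3 * z) := by
      rw [Nat.abs_cast]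
      exact_mod_cast hDz.trans (Nat.pow_le_pow_right (by norm_num) (by omega))
    have p2 : |(s * D : ℤ)| ≤ 2 ^ (3 * z) := by
      rw [← Nat.cast_mul, Nat.abs_cast]
      have : s * D ≤ 2 ^ (3 * z) := by
        calc s * D ≤ 2 ^ z * 2 ^ z := Nat.mul_le_mul hsz hDz
          _ = 2 ^ (2 * z) := by ring
          _ ≤ _ := Nat.pow_le_pow_right (by norm_num) (by omega)
      exact_mod_cast this
    intro r hr c
    by_cases hrm : r < x.m
    · rw [c2 r hrm c c.2, b2 r hrm c c.2]
      split_ifs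
      · exact p2
      · exact p0
    · obtain ⟨i, rfl⟩ : ∃ i, r = x.m + i := ⟨r - x.m, by omega⟩
      have hi : i < x.d := by omega
      obtain ⟨q1, q2⟩ := c3 i hi
      by_cases hc : (c : ℕ) < x.d
      · rw [q1 c hc]
        split_ifs
        · exact p1
        · exact p0
      · obtain ⟨k, hk⟩ : ∃ k, (c : ℕ) = x.d + k := ⟨c - x.d, by omega⟩
        rw [hk, q2 k (by omega)]
        exact hent ⟨k, by omega⟩ ⟨i, hi⟩
  refine ⟨σ3, ⟨σ1, a1, σ2, b1, c1⟩, h2.congr (c1.frame (a := 0) (by decide)), ?_, ?_, ?_, ?_, ?_,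
    ⟨fun j c => ?_, fun j k => ?_, fun i c => ?_, fun i k => ?_⟩, fun r hr => ?_⟩
  · rw [c1.frame (by decide), b1.frame (by decide), a2]
  · rw [c1.frame (by decide), b1.frame (by decide), a3]
  · rw [c1.frame (by decide), b1.frame (by decide), a4]
  · rw [c1.frame (by decide), b1.frame (by decide), a5]
  · rw [c1.frame (by decide), b1.frame (by decide), a6]; rfl
  · rw [row_apply, c2 j j.2 _ (Fin.is_lt _), b2 j j.2 _ (Fin.is_lt _), if_neg, Int.cast_zero]
    simp only [Fin.val_castAdd]
    omega
  · rw [row_apply, c2 j j.2 _ (Fin.is_lt _), b2 j j.2 _ (Fin.is_lt _)]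
    simp only [Fin.val_natAdd, Nat.add_left_cancel_iff, Fin.val_inj]
    split_ifs <;> simp
  · rw [row_apply]
    simp only [Fin.val_castAdd]
    rw [(c3 i i.2).1 c c.2]
    simp only [Fin.val_inj]
    split_ifs <;> simp
  · rw [row_apply]
    simp only [Fin.val_natAdd]
    rw [(c3 i i.2).2 k k.2, e1, e2, load_num, load_den]
    have hden : ((x.w k i).den : ℝ) ≠ 0 := by exact_mod_cast (x.w k i).den_nz
    obtain ⟨q, hq⟩ := hdvd k i
    have hq' : (D : ℤ) / ((x.w k i).den : ℤ) = q := by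
      rw [← Int.natCast_div, hq, Nat.mul_div_cancel_left _ (x.w k i).den_pos]
    rw [hq', hq, Rat.cast_def]
    push_cast
    field_simp
  · calc _ ≤ ((x.d + x.m : ℕ) : ℝ) * 2 ^ (3 * z) :=
          norm_intVec_le (by positivity) fun c => by exact_mod_cast hbd r hr c
      _ ≤ 2 ^ z * 2 ^ (3 * z) := by gcongr
      _ = _ := by ring

end LLL

namespace LLL

open InnerProductSpace Finset PostProcess RAM RAM.Expr RAM.Prog

/-- Computation of generators of the lattice. -/
def selectProg : Prog := .seq matrixProg (.seq lllProg selProg)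

theorem row_castAdd (f : ℕ → ℤ) {d m : ℕ} (r : ℕ) (c : Fin d) :
    row f (d + m) r (Fin.castAdd m c) = f (r * (d + m) + c) := rfl

theorem isShortRow_iff {f : ℕ → ℤ} {N d s D r : ℕ} :
    IsShortRow f N d s D r ↔ ‖row f N r‖ ^ 2 ≤ (D : ℝ) ^ 2 * ((s : ℝ) / (16 * 2 ^ d)) ^ 2 := by
  unfold IsShortRow
  rw [div_pow, ← mul_div_assoc, le_div_iff₀ (by positivity),
    mul_comm (‖row f N r‖ ^ 2), ← mul_pow (D : ℝ), mul_comm (D : ℝ)]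

/-- Termination and the bound s on the entries of the selected vectors hold for every input; only
the last statement depends on `Recovers`. The entry bound follows from the selection threshold and
keeps the second matrix small even on meaningless inputs. -/
theorem run_selectProg {x : Input} {b : ℕ} (hb : 13824 * (x.size + 1) ^ 9 ≤ b) :
    ∃ τ, Run b selectProg x.load τ ∧ HasInput x.d x.m (x.scale + 1) τ ∧
      τ 33 0 = weight (x.d + x.m) (x.scale + 1) ∧
      ∃ k ≤ x.d + x.m, τ 34 0 = k ∧
      (∀ t < k, ∀ c < x.d, |(τ 35 (t * x.d + c))| ≤ (x.scale + 1 : ℕ)) ∧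
      ∀ L, Recovers x L → Submodule.span ℤ
        {v | ∃ t < k, v = intVec fun c : Fin x.d => τ 35 (t * x.d + c)} = L := by
  obtain ⟨σ, a1, a2, a3, a4, a5, a6, a7, a8, a9⟩ := run_matrixProg hb
  have hdm : x.d + x.m ≤ x.size := by unfold Input.size; omega
  have hD0 : (0 : ℝ) < denProd x := by exact_mod_cast Nat.pos_of_ne_zero (denProd_ne_zero x)
  have hs0 : (0 : ℝ) < (x.scale + 1 : ℕ) := Nat.cast_pos.2 (Nat.succ_pos _)
  have hy3 : (x.size + 1) ≤ (x.size + 1) ^ 9 := Nat.le_self_pow (by norm_num) _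
  have hy4 : (x.size + 1) ^ 3 ≤ (x.size + 1) ^ 9 := Nat.pow_le_pow_right (by omega) (by norm_num)
  have hlb : 8 * (x.d + x.m + 4 * x.size + 1) ^ 3 ≤ b := by
    calc 8 * (x.d + x.m + 4 * x.size + 1) ^ 3 ≤ 8 * (6 * (x.size + 1)) ^ 3 := by
          gcongr; omega
      _ = 1728 * (x.size + 1) ^ 3 := by ring
      _ ≤ b := by omega
  obtain ⟨υ, b1, b2, b3, -, b5⟩ := run_lllProg_of_le (b := b) (n := x.d + x.m) (N := x.d + x.m)
    (by omega) hlb a3 a4 (a8.gs_ne_zero hs0.ne' hD0.ne') a9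
  have hu : HasInput x.d x.m (x.scale + 1) υ := a2.congr (b1.frame (by decide))
  have hpow : ∀ e ≤ 13824 * (x.size + 1), (2 : ℝ) ^ e ≤ 2 ^ b := fun e he =>
    pow_le_pow_right₀ (by norm_num) (by omega)
  obtain ⟨τ, c1, k, hk, c2, c3, c4⟩ := run_selProg (b := b) (N := x.d + x.m) hu
    (by rw [b1.frame (by decide), a3]) (by rw [b1.frame (by decide), a4])
    (D := denProd x) (by rw [b1.frame (by decide), a5]) (by rw [b1.frame (by decide), a6])
    (Nat.le_add_right _ _) (by omega)
    (fun r hr => by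
      refine (mul_le_mul (b5 r hr) (b5 r hr) (norm_nonneg _) (pow_nonneg zero_le_two _)).trans ?_
      rw [← pow_add]
      exact hpow _ (by omega))
    (fun r hr => (b5 r hr).trans (hpow _ (by omega)))
  -- Left parts of lattice vectors are multiples of the common denominator, so the divisions made
  -- while collecting rows are exact.
  have hcoef : ∀ r < x.d + x.m, ∀ c : Fin x.d, ∃ a : ℤ,
      υ 10 (r * (x.d + x.m) + c) = denProd x * a := by
    intro r hr c
    obtain ⟨a, y, hay⟩ := a8.exists_coeff (b3 ▸ mem_lat (row (υ 10) (x.d + x.m)) hr)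
    refine ⟨a c, ?_⟩
    have := hay.1 c
    rw [row_castAdd] at this
    rw [← @Int.cast_inj ℝ, Int.cast_mul, Int.cast_natCast]
    exact this
  have hdiv : ∀ r < x.d + x.m, ∀ c : Fin x.d, υ 10 (r * (x.d + x.m) + c) =
      denProd x * (υ 10 (r * (x.d + x.m) + c) / denProd x) := by
    intro r hr c
    obtain ⟨a, ha⟩ := hcoef r hr c
    rw [ha, Int.mul_ediv_cancel_left _ (by exact_mod_cast denProd_ne_zero x)]
  refine ⟨τ, ⟨σ, a1, υ, b1, c1⟩, hu.congr (c1.frame (by decide)),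
    by rw [c1.frame (by decide), b1.frame (by decide), a7], k, hk, c2, fun t ht c hc => ?_,
    fun L hL => ?_⟩
  · obtain ⟨r, hr, hrs, hrc⟩ := c3 t ht
    rw [hrc c hc]
    have h1 := abs_le_norm_row (υ 10) r (by omega : c < x.d + x.m)
    have h2 := hdiv r hr ⟨c, hc⟩
    simp only at h2
    have h3 : ‖row (υ 10) (x.d + x.m) r‖ ≤ denProd x * (x.scale + 1 : ℕ) := by
      refine (sq_le_sq₀ (norm_nonneg _) (mul_pos hD0 hs0).le).1 ((isShortRow_iff.1 hrs).trans ?_)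
      rw [mul_pow]
      gcongr
      refine div_le_self hs0.le ?_
      have : (1 : ℝ) ≤ 2 ^ x.d := one_le_pow₀ (by norm_num)
      linarith
    rw [h2, Int.cast_mul, abs_mul, Int.cast_natCast, abs_of_pos hD0] at h1
    have h4 := le_of_mul_le_mul_left (h1.trans h3) hD0
    exact_mod_cast h4
  · obtain ⟨T, hT0, hT, hT'⟩ := hL.le_span
    rw [← a8.span_short hD0 b2 b3 hL.mem hT0 hT hT'
      (x := fun r (c : Fin x.d) => υ 10 (r * (x.d + x.m) + c) / denProd x)
      (fun r hr c => by
        have := congrArg (Int.cast : ℤ → ℝ) (hdiv r hr c)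
        rwa [Int.cast_mul, Int.cast_natCast] at this)]
    congr 1
    ext v
    constructor
    · rintro ⟨t, ht, rfl⟩
      obtain ⟨r, hr, hrs, hrc⟩ := c3 t ht
      exact ⟨r, hr, isShortRow_iff.1 hrs, by congr 1; exact funext fun c => hrc c c.2⟩
    · rintro ⟨r, hr, hrs, rfl⟩
      obtain ⟨t, ht, htc⟩ := c4 r hr (isShortRow_iff.2 hrs)
      exact ⟨t, ht, by congr 1; exact funext fun c => (htc c c.2).symm⟩

/-! ### The complete algorithm -/

/-- Computation of a basis of the lattice. -/
def postProg : Prog := .seq selectProg (.seq genProg (.seq lllProg outProg))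

/-- With G = 2(n + 1)s and Q = G^((n+2)²), the right side has one factor Q² more than the left. This
spare factor absorbs the rest, d!, the powers of k and s, and 2^(k(d+1)), which together contribute
at most G^(2d + k(d+1)). -/
theorem weight_bounds {n s k d : ℕ} (hs : 1 ≤ s) (hk : k ≤ n) (hd : d ≤ n) :
    2 ^ k ≤ (weight n s) ^ 2 ∧
    (d.factorial * (1 + k * (weight n s * s) ^ 2) ^ d : ℝ) <
      ((weight n s : ℝ) ^ 2 / 2 ^ k) ^ (d + 1) := by
  obtain ⟨G, hG⟩ : ∃ G, G = 2 * (n + 1) * s := ⟨_, rfl⟩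
  have hG2 : 2 ≤ G := by rw [hG]; nlinarith
  have hQ : weight n s = G ^ ((n + 2) * (n + 2)) := by rw [hG]; rfl
  obtain ⟨Q, hQe⟩ : ∃ Q, Q = weight n s := ⟨_, rfl⟩
  have hQ1 : 1 ≤ Q := by rw [hQe, hQ]; exact Nat.one_le_pow _ _ (by omega)
  have h2G : ∀ e, 2 ^ e ≤ G ^ e := fun e => Nat.pow_le_pow_left hG2 e
  rw [← hQe]
  have hkQ : 2 ^ k ≤ Q ^ 2 := by
    calc 2 ^ k ≤ G ^ k := h2G k
      _ ≤ G ^ ((n + 2) * (n + 2) * 2) := Nat.pow_le_pow_right (by omega) (by nlinarith)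
      _ = Q ^ 2 := by rw [hQe, hQ, pow_mul]
  refine ⟨hkQ, ?_⟩
  have key : d.factorial * (1 + k * (Q * s) ^ 2) ^ d * 2 ^ (k * (d + 1)) < (Q ^ 2) ^ (d + 1) := by
    have h1 : d.factorial ≤ (n + 1) ^ d :=
      (Nat.factorial_le_pow d).trans (Nat.pow_le_pow_left (by omega) d)
    have hQs : 1 ≤ (Q * s) ^ 2 := Nat.one_le_pow _ _ (Nat.mul_pos hQ1 hs)
    have h2 : 1 + k * (Q * s) ^ 2 ≤ (n + 1) * (Q * s) ^ 2 := by
      have := Nat.mul_le_mul_right ((Q * s) ^ 2) hk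
      rw [add_mul, one_mul]
      omega
    have h3 : (n + 1) * ((n + 1) * (Q * s) ^ 2) ≤ Q ^ 2 * G ^ 2 := by
      rw [hG]
      calc (n + 1) * ((n + 1) * (Q * s) ^ 2) = Q ^ 2 * (((n + 1) * s) ^ 2) := by ring
        _ ≤ Q ^ 2 * ((2 * ((n + 1) * s)) ^ 2) :=
            Nat.mul_le_mul_left _ (Nat.pow_le_pow_left (by omega) 2)
        _ = _ := by ring
    have h4 : 2 * d + k * (d + 1) < (n + 2) * (n + 2) * 2 := by
      have : k * (d + 1) ≤ n * (n + 1) := Nat.mul_le_mul hk (by omega)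
      nlinarith
    calc _ ≤ (n + 1) ^ d * ((n + 1) * (Q * s) ^ 2) ^ d * G ^ (k * (d + 1)) := by
          gcongr
      _ = ((n + 1) * ((n + 1) * (Q * s) ^ 2)) ^ d * G ^ (k * (d + 1)) := by rw [← mul_pow]
      _ ≤ (Q ^ 2 * G ^ 2) ^ d * G ^ (k * (d + 1)) := by gcongr
      _ = (Q ^ 2) ^ d * G ^ (2 * d + k * (d + 1)) := by
          rw [mul_pow, ← pow_mul G, mul_assoc, ← pow_add]
      _ < (Q ^ 2) ^ d * G ^ ((n + 2) * (n + 2) * 2) := by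
          refine Nat.mul_lt_mul_of_pos_left (Nat.pow_lt_pow_right (by omega) h4) ?_
          positivity
      _ = (Q ^ 2) ^ (d + 1) := by rw [pow_succ (Q ^ 2), pow_mul, ← hQ, ← hQe]
  rw [div_pow, lt_div_iff₀ (by positivity), ← pow_mul]
  exact_mod_cast key

theorem run_postProg (x : Input) : ∃ τ, Run (13824 * (x.size + 1) ^ 9) postProg x.load τ ∧
    ∀ L, Recovers x L → IsBasisOf L (Matrix.of fun i j : Fin x.d => τ 3 (x.d * i + j)) := by
  obtain ⟨b, hb⟩ : ∃ b, b = 13824 * (x.size + 1) ^ 9 := ⟨_, rfl⟩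
  rw [← hb]
  have hy1 : (x.size + 1) ≤ (x.size + 1) ^ 9 := Nat.le_self_pow (by norm_num) _
  have hy3 : (x.size + 1) ^ 3 ≤ (x.size + 1) ^ 9 := Nat.pow_le_pow_right (by omega) (by norm_num)
  have hy2 : (x.size + 1) ≤ (x.size + 1) ^ 3 := Nat.le_self_pow (by norm_num) _
  have hload : ∀ a k, |x.load a k| ≤ 2 ^ b := fun a k =>
    (abs_load_le x a k).trans (pow_le_pow_right₀ (by norm_num) (by omega))
  obtain ⟨σ, a1, a2, a3, k, hk, a5, a4, a6⟩ := run_selectProg hb.ge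
  obtain ⟨Q, hQ⟩ : ∃ Q, Q = weight (x.d + x.m) (x.scale + 1) := ⟨_, rfl⟩
  obtain ⟨q1, q2⟩ := weight_bounds (s := x.scale + 1) (by omega) hk (Nat.le_add_right x.d x.m)
  have hdm : x.d + x.m ≤ x.size := by unfold Input.size; omega
  have hsz := scale_le x
  have hQz : Q ≤ 2 ^ (8 * (x.size + 1) ^ 3) := hQ ▸ weight_le (by omega) hsz
  rw [← hQ] at a3 q1 q2
  have hQs : Q * (x.scale + 1) ≤ 2 ^ (9 * (x.size + 1) ^ 3) := by
    calc Q * (x.scale + 1) ≤ 2 ^ (8 * (x.size + 1) ^ 3) * 2 ^ x.size := Nat.mul_le_mul hQz hsz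
      _ = 2 ^ (8 * (x.size + 1) ^ 3 + x.size) := (pow_add _ _ _).symm
      _ ≤ _ := Nat.pow_le_pow_right (by norm_num) (by omega)
  have hQx : ∀ t < k, ∀ c < x.d,
      |(Q : ℤ) * σ 35 (t * x.d + c)| ≤ 2 ^ (9 * (x.size + 1) ^ 3) := by
    intro t ht c hc
    rw [abs_mul, Nat.abs_cast]
    calc _ ≤ (Q : ℤ) * (x.scale + 1 : ℕ) :=
          mul_le_mul_of_nonneg_left (a4 t ht c hc) (Nat.cast_nonneg _)
      _ ≤ _ := by exact_mod_cast hQs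
  obtain ⟨υ, b1, b2, b3, b4⟩ := run_genProg (b := b) a2 a3 a5 (by omega)
    (fun t ht c hc => (hQx t ht c hc).trans (pow_le_pow_right₀ (by norm_num) (by omega)))
  have hgen : IsGenBasis (d := x.d) (k := k) (Q : ℝ)
      (fun t (c : Fin x.d) => σ 35 (t * x.d + c)) (row (υ 10) (x.d + k)) := by
    refine ⟨fun t ht c => ?_, fun t u => ?_⟩
    · rw [row_castAdd, (b4 t ht).1 c c.2]
      push_cast; rfl
    · rw [row_apply, Fin.val_natAdd, (b4 t t.2).2 u u.2]
      simp only [Fin.val_inj]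
      split_ifs <;> simp
  have hnorm : ∀ t < k, ‖row (υ 10) (x.d + k) t‖ ≤ 2 ^ (10 * (x.size + 1) ^ 3 + x.size) := by
    intro t ht
    have h1 : ((x.d + k : ℕ) : ℝ) ≤ 2 ^ (x.size + x.size) := by
      have h2 : x.d + k ≤ 2 ^ (x.size + x.size) :=
        (by omega : x.d + k ≤ x.size + x.size).trans Nat.lt_two_pow_self.le
      exact_mod_cast h2
    refine (norm_intVec_le (A := 2 ^ (9 * (x.size + 1) ^ 3)) (pow_nonneg zero_le_two _) fun c => ?_).trans ?_
    · by_cases hc : (c : ℕ) < x.d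
      · rw [(b4 t ht).1 c hc]
        exact_mod_cast hQx t ht c hc
      · obtain ⟨u, hu⟩ : ∃ u, (c : ℕ) = x.d + u := ⟨c - x.d, by omega⟩
        rw [hu, (b4 t ht).2 u (by omega)]
        have : (1 : ℝ) ≤ 2 ^ (9 * (x.size + 1) ^ 3) := one_le_pow₀ (by norm_num)
        split_ifs <;> simp [this]
    · calc _ ≤ (2 : ℝ) ^ (x.size + x.size) * 2 ^ (9 * (x.size + 1) ^ 3) :=
          mul_le_mul_of_nonneg_right h1 (pow_nonneg zero_le_two _)
        _ = 2 ^ (x.size + x.size + 9 * (x.size + 1) ^ 3) := (pow_add _ _ _).symm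
        _ ≤ _ := pow_le_pow_right₀ (by norm_num) (by omega)
  have hlb : 8 * (k + (10 * (x.size + 1) ^ 3 + x.size) + 1) ^ 3 ≤ b := by
    calc _ ≤ 8 * (12 * (x.size + 1) ^ 3) ^ 3 :=
          Nat.mul_le_mul_left _ (Nat.pow_le_pow_left (by omega) 3)
      _ = b := by rw [hb]; ring
  obtain ⟨ρ, c1, c2, c3, c4, c5⟩ := run_lllProg_of_le (b := b) (n := k) (N := x.d + k)
    (by omega) hlb b2 b3 hgen.gs_ne_zero hnorm
  have hr : HasInput x.d x.m (x.scale + 1) ρ :=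
    a2.congr (by rw [c1.frame (by decide), b1.frame (by decide)])
  -- The part of the program run so far is composed only to obtain from `Run.exec` the bound on all
  -- cells that `run_outProg` requires.
  have hrun : Run b (.seq selectProg (.seq genProg lllProg)) x.load ρ := ⟨σ, a1, υ, b1, c1⟩
  obtain ⟨τ, d1, d2⟩ := run_outProg (b := b) (k := k) (N := x.d + k) (Q := Q) hr
    (by rw [c1.frame (by decide), b2]) (by rw [c1.frame (by decide), b3])
    (by rw [c1.frame (by decide), b1.frame (by decide), a3]) (by omega) (hrun.exec hload).1
  refine ⟨τ, ⟨σ, a1, υ, b1, ρ, c1, d1⟩, fun L hL => ?_⟩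
  have hQ1 : Q ≠ 0 := by
    rintro rfl
    simp at q1
  have hdk : x.d ≤ k := le_of_span_eq_top (a6 L hL) hL.span_top
  refine hgen.isBasisOf c2 (row_mem _ _) c3 c4 (s := (x.scale + 1 : ℕ))
    (fun t ht c => by exact_mod_cast a4 t ht c c.2) (by exact_mod_cast q1)
    q2 (by exact_mod_cast hQ1) (a6 L hL) hL.span_top fun i a ha => ?_
  ext c
  rw [Matrix.of_apply, d2 hdk i i.2 c c.2]
  have h1 := congrArg (fun v : E x.d => v c) ha
  simp only [leftPart_apply, row_castAdd, PiLp.smul_apply, intVec_apply, smul_eq_mul] at h1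
  have h2 : ρ 10 ((k - x.d + i) * (x.d + k) + c) = Q * a c := by exact_mod_cast h1
  rw [h2, Int.mul_ediv_cancel_left _ (by exact_mod_cast hQ1)]

/-- The algorithm is defined as whatever the program leaves in array 3, which makes sense because
the program halts on every input. The time bound is `timePoly` composed with the bound b as a
polynomial in the input size. -/
theorem exists_polyTime_recovers : ∃ A : (x : Input) → Matrix (Fin x.d) (Fin x.d) ℤ,
    PolyTime A ∧ ∀ x L, Recovers x L → IsBasisOf L (A x) := by
  choose τ h1 h2 using run_postProg
  refine ⟨fun x => Matrix.of fun i j : Fin x.d => τ x 3 (x.d * i + j),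
    ⟨postProg, postProg.timePoly.comp (13824 * (Polynomial.X + 1) ^ 9 + 2), fun x => ?_⟩, h2⟩
  have hload : ∀ a k, |x.load a k| ≤ 2 ^ (13824 * (x.size + 1) ^ 9) := fun a k =>
    (abs_load_le x a k).trans (pow_le_pow_right₀ (by norm_num) (by
      have : (x.size + 1) ≤ (x.size + 1) ^ 9 := Nat.le_self_pow (by norm_num) _
      omega))
  obtain ⟨t, ht, he⟩ := ((h1 x).exec hload).2
  refine ⟨t, τ x, he, ht.trans_eq ?_, fun i j => rfl⟩
  simp [Polynomial.eval_comp]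

end LLL

namespace LLL

open InnerProductSpace Finset PostProcess

/-! ### Short vectors in the lattice of the runs -/

theorem mem_intLattice_iff {d : ℕ} {x : E d} : x ∈ intLattice d ↔ ∃ a, x = intVec a := by
  constructor
  · intro h
    have : intLattice d ≤ (intVecs d).toIntSubmodule := by
      refine Submodule.span_le.2 ?_
      rintro _ ⟨i, rfl⟩
      refine ⟨Pi.single i 1, ?_⟩
      ext j
      rw [intVec_apply, EuclideanSpace.basisFun_apply, PiLp.single_apply, Pi.single_apply]
      split_ifs <;> simp
    obtain ⟨a, ha⟩ := this h
    exact ⟨a, ha.symm⟩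
  · rintro ⟨a, rfl⟩
    have : intVec a = ∑ i, a i • EuclideanSpace.basisFun (Fin d) ℝ i := by
      ext j
      rw [← coord_apply, ← coord_apply, map_sum]
      simp only [map_zsmul, coord_apply, EuclideanSpace.basisFun_apply, PiLp.single_apply,
        intVec_apply]
      simp
    rw [this]
    exact Submodule.sum_mem _ fun i _ =>
      Submodule.smul_mem _ _ (Submodule.subset_span ⟨i, rfl⟩)

theorem inner_intVec_ratVec {d : ℕ} (a : Fin d → ℤ) (w : Fin d → ℚ) :
    inner ℝ (intVec a) (ratVec w) = ∑ i, (a i : ℝ) * w i := by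
  rw [PiLp.inner_apply]
  exact sum_congr rfl fun i _ => by simp [intVec, ratVec, mul_comm]

theorem mem_dualLattice_iff {d : ℕ} {L : Submodule ℤ (E d)} {y : E d} :
    y ∈ dualLattice L ↔ ∀ x ∈ L, ∃ N : ℤ, inner ℝ y x = (N : ℝ) := by
  unfold dualLattice
  rw [LinearMap.BilinForm.mem_dualSubmodule]
  refine forall₂_congr fun x _ => ?_
  rw [Submodule.mem_one]
  simp [eq_comm]

/-- The torus distance is an infimum, so a representative is only taken within a strictly larger
radius. Below, this radius is 2δ. -/
theorem DualQuotient.exists_mem_dist_lt {d : ℕ} {L : Submodule ℤ (E d)} {v : DualQuotient L}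
    {x : E d} {δ r : ℝ} (h : torusDist x v ≤ δ) (hr : δ < r) : ∃ y ∈ v.toSet, ‖x - y‖ < r := by
  have hne : v.toSet.Nonempty := by
    obtain ⟨y, hy⟩ := Submodule.Quotient.mk_surjective _ v
    exact ⟨y, y.2, hy⟩
  obtain ⟨y, hy, h1⟩ := (Metric.infDist_lt_iff hne).1 (h.trans_lt hr)
  exact ⟨y, hy, by rwa [← dist_eq_norm]⟩

/-- For every integer vector outside the lattice, one of the cosets `v i` has inner products far
from the integers. -/
def Separates {d n : ℕ} {L : Submodule ℤ (E d)} (v : Fin n → DualQuotient L) : Prop :=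
  ∀ a, intVec a ∉ L → ∃ i, ∀ y ∈ (v i).toSet, ∀ N : ℤ,
    1 / (3 * 2 ^ d) < |inner ℝ (intVec a) y - N|

section Runs

variable {d m m₁ m₂ : ℕ} {L : Submodule ℤ (E d)} {δ S : ℝ}

/-- The algorithm knows only ⌊S⌋; these bounds show that s = ⌊S⌋ + 1 replaces S at the cost of a
factor at most 2. -/
theorem floor_add_one_bounds (hS1 : 1 ≤ S) :
    S < (⌊S⌋₊ + 1 : ℕ) ∧ ((⌊S⌋₊ + 1 : ℕ) : ℝ) ≤ 2 * S := by
  have h1 := Nat.lt_floor_add_one S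
  have h2 := Nat.floor_le (by linarith : 0 ≤ S)
  push_cast
  constructor <;> linarith

/-- For a ∉ L, take a separating run i and a representative z of its coset. The right coordinate of
the vector gives |⟨a, w_i⟩ + y_i| ≤ 1/(16·2^d), and replacing w_i by z costs at most ‖a‖ · 2δ ≤
4/(16·2^d), because sδ ≤ 2. -/
theorem mem_of_runNormSq_le {v : Fin m₁ → DualQuotient L} {wG : Fin m₁ → Fin d → ℚ}
    (hv : Separates v) (hδ : 0 < δ) {s : ℝ} (hs : 0 < s) (hsδ : s * δ ≤ 2)
    (hG : ∀ i, torusDist (ratVec (wG i)) (v i) ≤ δ) {w : Fin m → Fin d → ℝ} {f : Fin m₁ → Fin m}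
    (hf : ∀ i c, w (f i) c = wG i c) {a : Fin d → ℤ} {y : Fin m → ℤ}
    (h : runNormSq s w a y ≤ (s / (16 * 2 ^ d)) ^ 2) : intVec a ∈ L := by
  by_contra hL
  obtain ⟨i, hi⟩ := hv a hL
  obtain ⟨z, hz, hzd⟩ := DualQuotient.exists_mem_dist_lt (hG i) (by linarith : δ < 2 * δ)
  have h2 := hi z hz (-y (f i))
  have hR : 0 < s / (16 * 2 ^ d) := by positivity
  have ha : ‖intVec a‖ ≤ s / (16 * 2 ^ d) := by
    refine (sq_le_sq₀ (norm_nonneg _) hR.le).1 (le_trans ?_ h)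
    rw [EuclideanSpace.real_norm_sq_eq, runNormSq]
    exact le_add_of_nonneg_right (by positivity)
  have hy : |∑ c, (a c : ℝ) * w (f i) c + y (f i)| ≤ 1 / (16 * 2 ^ d) := by
    have h3 : s ^ 2 * (∑ c, (a c : ℝ) * w (f i) c + y (f i)) ^ 2 ≤ (s / (16 * 2 ^ d)) ^ 2 := by
      refine le_trans ?_ h
      rw [runNormSq]
      refine le_trans ?_ (le_add_of_nonneg_left (by positivity))
      gcongr
      exact single_le_sum (f := fun k => (∑ c, (a c : ℝ) * w k c + y k) ^ 2)
        (fun _ _ => sq_nonneg _) (mem_univ (f i))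
    refine abs_le_of_sq_le_sq ?_ (by positivity)
    rw [div_eq_mul_one_div s, mul_pow] at h3
    exact le_of_mul_le_mul_left h3 (by positivity)
  have hin : ∑ c, (a c : ℝ) * w (f i) c = inner ℝ (intVec a) (ratVec (wG i)) := by
    rw [inner_intVec_ratVec]
    exact sum_congr rfl fun c _ => by rw [hf]
  have hdiff : |inner ℝ (intVec a) (ratVec (wG i) - z)| ≤ s / (16 * 2 ^ d) * (2 * δ) :=
    (abs_real_inner_le_norm _ _).trans (mul_le_mul ha hzd.le (norm_nonneg _) hR.le)
  rw [hin] at hy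
  rw [inner_sub_right] at hdiff
  have h5 : s / (16 * 2 ^ d) * (2 * δ) ≤ 4 / (16 * 2 ^ d) := by
    rw [div_mul_eq_mul_div]
    gcongr
    linarith
  have h6 : |inner ℝ (intVec a) z - ((-y (f i) : ℤ) : ℝ)| ≤ 5 / (16 * 2 ^ d) := by
    have h7 : inner ℝ (intVec a) z - ((-y (f i) : ℤ) : ℝ) =
      (inner ℝ (intVec a) (ratVec (wG i)) + y (f i)) -
        (inner ℝ (intVec a) (ratVec (wG i)) - inner ℝ (intVec a) z) := by push_cast; ring
    rw [h7]
    refine (abs_sub _ _).trans ?_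
    calc _ ≤ 1 / (16 * 2 ^ d) + 4 / (16 * 2 ^ d) := add_le_add hy (hdiff.trans h5)
      _ = _ := by ring
  -- Here 5/16 < 1/3, which is what the constants 16 and 3 are chosen for.
  have h8 : (5 : ℝ) / (16 * 2 ^ d) < 1 / (3 * 2 ^ d) := by
    rw [div_lt_div_iff₀ (by positivity) (by positivity)]
    have : (0 : ℝ) < 2 ^ d := by positivity
    linarith
  linarith

/-- Coefficients of a vector of the lattice generated by the error matrix. -/
theorem exists_of_mem_errorLattice {B : Fin d → E d} (hB : ∀ k, B k ∈ L) {F : Fin m₂ → Fin d → ℚ}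
    {z : EuclideanSpace ℝ (Fin d ⊕ Fin m₂)} (hz : z ∈ errorLattice B S F) :
    ∃ u ∈ L, ∃ y : Fin m₂ → ℤ, (∀ i, z (Sum.inl i) = u i) ∧
      ∀ j, z (Sum.inr j) = S * (inner ℝ u (ratVec (F j)) + y j) := by
  induction hz using Submodule.span_induction with
  | mem z hz =>
    obtain ⟨k | j, rfl⟩ := hz
    · exact ⟨B k, hB k, 0, fun i => rfl, fun j => by simp⟩
    · refine ⟨0, L.zero_mem, Pi.single j 1, fun i => by simp, fun j' => ?_⟩
      simp only [Sum.elim_inr, PiLp.single_apply, Sum.inr.injEq, Pi.single_apply, inner_zero_left]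
      split_ifs <;> simp
  | zero => exact ⟨0, L.zero_mem, 0, by simp, by simp⟩
  | add z z' _ _ h h' =>
    obtain ⟨u, hu, y, h1, h2⟩ := h
    obtain ⟨u', hu', y', h1', h2'⟩ := h'
    refine ⟨u + u', L.add_mem hu hu', y + y', fun i => ?_, fun j => ?_⟩
    · rw [PiLp.add_apply, h1, h1', PiLp.add_apply]
    · rw [PiLp.add_apply, h2, h2', inner_add_left]
      simp only [Pi.add_apply]
      push_cast
      ring
  | smul t z _ h =>
    obtain ⟨u, hu, y, h1, h2⟩ := h
    refine ⟨t • u, L.smul_mem _ hu, t • y, fun i => ?_, fun j => ?_⟩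
    · rw [← Int.cast_smul_eq_zsmul ℝ, ← Int.cast_smul_eq_zsmul ℝ, PiLp.smul_apply, h1,
        PiLp.smul_apply]
    · rw [← Int.cast_smul_eq_zsmul ℝ, ← Int.cast_smul_eq_zsmul ℝ, PiLp.smul_apply, h2,
        real_inner_smul_left]
      simp only [Pi.smul_apply, smul_eq_mul]
      push_cast
      ring

/-- In a good run ⟨a, z⟩ is an integer for a representative z of the coset, so y can be chosen with
right coordinate at most s · 2δ · T ≤ 4T. In a bad run the shift of the Λ-vector is kept, and
passing from S to s costs a factor 2. Summing gives T² + 16 m T². -/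
theorem runNormSq_le_of_short (hδ : 0 < δ) (hS : S = δ⁻¹) {s : ℝ} (hs0 : 0 < s)
    (hs : s ≤ 2 * S) {v : Fin m₁ → DualQuotient L}
    {wG : Fin m₁ → Fin d → ℚ} {wB : Fin m₂ → Fin d → ℚ}
    (hG : ∀ i, torusDist (ratVec (wG i)) (v i) ≤ δ) (pos : Fin m₁ ⊕ Fin m₂ ≃ Fin m)
    {T : ℝ} {a : Fin d → ℤ} (ha : intVec a ∈ L) {yB : Fin m₂ → ℤ} (h1 : ‖intVec a‖ ≤ T)
    (h2 : ∀ j, |S * (inner ℝ (intVec a) (ratVec (wB j)) + yB j)| ≤ T) :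
    ∃ y, runNormSq s (fun k i => ((Sum.elim wG wB (pos.symm k) i : ℚ) : ℝ)) a y ≤
      16 * (m + 1) * T ^ 2 := by
  have hT : 0 ≤ T := (norm_nonneg _).trans h1
  have hSpos : 0 < S := by rw [hS]; positivity
  have hsδ : s * δ ≤ 2 := by
    calc s * δ ≤ 2 * S * δ := by gcongr
      _ = 2 := by rw [hS, mul_assoc, inv_mul_cancel₀ hδ.ne', mul_one]
  have hy : ∀ r : Fin m₁ ⊕ Fin m₂, ∃ y : ℤ,
      |s * (∑ i, (a i : ℝ) * ((Sum.elim wG wB r i : ℚ) : ℝ) + y)| ≤ 4 * T := by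
    rintro (i | j)
    · obtain ⟨z, ⟨hz, -⟩, hzd⟩ := DualQuotient.exists_mem_dist_lt (hG i) (by linarith : δ < 2 * δ)
      obtain ⟨N, hN⟩ := mem_dualLattice_iff.1 hz _ ha
      refine ⟨-N, ?_⟩
      simp only [Sum.elim_inl]
      rw [← inner_intVec_ratVec]
      push_cast
      rw [← hN, real_inner_comm, ← sub_eq_add_neg, ← inner_sub_left, abs_mul, abs_of_pos hs0]
      calc _ ≤ s * (2 * δ * T) := by
            gcongr
            exact (abs_real_inner_le_norm _ _).trans (mul_le_mul hzd.le h1 (norm_nonneg _) (by positivity))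
        _ = s * δ * (2 * T) := by ring
        _ ≤ 2 * (2 * T) := by gcongr
        _ = _ := by ring
    · refine ⟨yB j, ?_⟩
      simp only [Sum.elim_inr]
      rw [← inner_intVec_ratVec]
      have h3 := h2 j
      rw [abs_mul, abs_of_pos hSpos] at h3
      rw [abs_mul, abs_of_pos hs0]
      calc _ ≤ 2 * S * |inner ℝ (intVec a) (ratVec (wB j)) + yB j| := by gcongr
        _ ≤ 2 * T := by linarith
        _ ≤ _ := by linarith
  choose y hy using hy
  refine ⟨fun k => y (pos.symm k), ?_⟩
  rw [runNormSq, mul_sum]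
  have h3 : ∑ i, (a i : ℝ) ^ 2 ≤ T ^ 2 := by
    have := (sq_le_sq₀ (norm_nonneg _) hT).2 h1
    rwa [EuclideanSpace.real_norm_sq_eq] at this
  have h4 : ∀ k, s ^ 2 * (∑ i, (a i : ℝ) * ((Sum.elim wG wB (pos.symm k) i : ℚ) : ℝ) +
      y (pos.symm k)) ^ 2 ≤ (4 * T) ^ 2 := fun k => by
    rw [← mul_pow, ← sq_abs]
    have := hy (pos.symm k)
    gcongr
  calc _ ≤ T ^ 2 + ∑ _k : Fin m, (4 * T) ^ 2 := add_le_add h3 (sum_le_sum fun k _ => h4 k)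
    _ = T ^ 2 + m * (16 * T ^ 2) := by
        rw [sum_const, card_univ, Fintype.card_fin, nsmul_eq_mul]; ring
    _ ≤ _ := by nlinarith [sq_nonneg T]

/-- Separation bounds the selected vectors from outside. From inside, the left parts of the given
basis of Λ generate L, and each non-zero one lifts to a short vector of the lattice of the runs. -/
theorem recovers_of_separates [DiscreteTopology L] [IsZLattice ℝ L] (hLZ : L ≤ intLattice d)
    (hδ : 0 < δ) (hS : S = δ⁻¹) (hS1 : 1 ≤ S) (B : Module.Basis (Fin d) ℤ L) {T : ℝ}
    (hT : (d + m : ℕ) * 2 ^ (d + m) * (16 * (m + 1) * T ^ 2) ≤ (S / (16 * 2 ^ d)) ^ 2)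
    {v : Fin m₁ → DualQuotient L} {wG : Fin m₁ → Fin d → ℚ} {wB : Fin m₂ → Fin d → ℚ}
    (hG : ∀ i, torusDist (ratVec (wG i)) (v i) ≤ δ) (hv : Separates v)
    (hB : HasShortBasis (errorLattice (fun k => (B k : E d)) S wB) T)
    (pos : Fin m₁ ⊕ Fin m₂ ≃ Fin m) :
    Recovers ⟨d, m, ⌊S⌋₊, fun k => Sum.elim wG wB (pos.symm k)⟩ L := by
  obtain ⟨hs1, hs2⟩ := floor_add_one_bounds hS1
  have hs0 : (0 : ℝ) < (⌊S⌋₊ + 1 : ℕ) := by linarith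
  have hSpos : 0 < S := by linarith
  refine ⟨IsZLattice.span_top, fun a y h => ?_, √(16 * (m + 1) * T ^ 2), Real.sqrt_nonneg _, ?_,
    fun l hl => ?_⟩
  · refine mem_of_runNormSq_le hv hδ hs0 ?_ hG (f := fun i => pos (Sum.inl i))
      (fun i c => by simp) h
    calc _ ≤ 2 * S * δ := by gcongr
      _ = 2 := by rw [hS, mul_assoc, inv_mul_cancel₀ hδ.ne', mul_one]
  · rw [Real.sq_sqrt (by positivity)]
    refine hT.trans ?_
    gcongr
  · rw [Real.sq_sqrt (by positivity)]
    obtain ⟨b, hb⟩ := hB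
    choose u hu y hu1 hu2 using fun r =>
      exists_of_mem_errorLattice (fun k => (B k).2) (b r).2
    -- every vector of `L` is the left part of a vector of the error lattice
    obtain ⟨z, hz, hzl⟩ : ∃ z ∈ errorLattice (fun k => (B k : E d)) S wB,
        ∀ i, z (Sum.inl i) = l i := by
      have : l = ∑ k, B.repr ⟨l, hl⟩ k • (B k : E d) := by
        have h := congrArg Subtype.val (B.sum_repr ⟨l, hl⟩)
        simp only [AddSubmonoidClass.coe_finsetSum, Submodule.coe_smul] at h
        exact h.symm
      refine ⟨∑ k, B.repr ⟨l, hl⟩ k • (WithLp.toLp 2 (Sum.elim (fun i => (B k : E d) i)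
        (fun j => S * inner ℝ (B k : E d) (ratVec (wB j))))),
        Submodule.sum_mem _ fun k _ => Submodule.smul_mem _ _
          (Submodule.subset_span ⟨Sum.inl k, rfl⟩), fun i => ?_⟩
      conv_rhs => rw [this]
      simp only [← Int.cast_smul_eq_zsmul ℝ, WithLp.ofLp_sum, Finset.sum_apply, PiLp.smul_apply,
        Sum.elim_inl]
    obtain ⟨n, hn⟩ : ∃ n : Fin d ⊕ Fin m₂ → ℤ, z = ∑ r, n r • (b r : EuclideanSpace ℝ _) := by
      have h := congrArg Subtype.val (b.sum_repr ⟨z, hz⟩)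
      simp only [AddSubmonoidClass.coe_finsetSum, Submodule.coe_smul] at h
      exact ⟨_, h.symm⟩
    have hlu : l = ∑ r, n r • u r := by
      ext i
      rw [← hzl i, hn]
      simp only [← Int.cast_smul_eq_zsmul ℝ, WithLp.ofLp_sum, Finset.sum_apply, PiLp.smul_apply,
        hu1]
    rw [hlu]
    refine Submodule.sum_mem _ fun r _ => Submodule.smul_mem _ _ ?_
    -- Basis vectors of Λ with zero left part may be long, but they contribute nothing to L.
    by_cases hur : u r = 0
    · rw [hur]; exact Submodule.zero_mem _
    obtain ⟨a, ha⟩ := mem_intLattice_iff.1 (hLZ (hu r))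
    have hbr := hb r (by
      by_contra! h0
      exact hur (by ext i; rw [← hu1 r i, h0 i]; rfl))
    have hn : ‖intVec a‖ ≤ T := by
      refine le_trans ?_ hbr.le
      refine (sq_le_sq₀ (norm_nonneg _) (norm_nonneg _)).1 ?_
      rw [EuclideanSpace.real_norm_sq_eq, EuclideanSpace.real_norm_sq_eq, Fintype.sum_sum_type,
        ← ha]
      simp only [hu1]
      exact le_add_of_nonneg_right (by positivity)
    obtain ⟨y', hy'⟩ := runNormSq_le_of_short hδ hS hs0 hs2 hG pos (ha ▸ hu r) (yB := y r) hn
      (fun j => by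
        rw [← ha, ← hu2 r j]
        exact (PiLp.norm_apply_le _ _).trans hbr.le)
    exact Submodule.subset_span ⟨a, y', ha, hy'⟩

end Runs

end LLL

namespace LLL

open InnerProductSpace Finset PostProcess

/-! ### The index and the characters of the dual quotient -/

theorem intLattice_eq (d : ℕ) : intLattice d =
    Submodule.span ℤ (Set.range (EuclideanSpace.basisFun (Fin d) ℝ).toBasis) := by
  rw [OrthonormalBasis.coe_toBasis, intLattice]

instance (d : ℕ) : DiscreteTopology (intLattice d) := by
  rw [intLattice_eq]; infer_instance

instance (d : ℕ) : IsZLattice ℝ (intLattice d) := by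
  refine ⟨?_⟩
  rw [intLattice_eq]
  exact IsZLattice.span_top

theorem covolume_intLattice (d : ℕ) : ZLattice.covolume (intLattice d) = 1 := by
  have h := ZSpan.isAddFundamentalDomain (EuclideanSpace.basisFun (Fin d) ℝ).toBasis
    (volume : Measure (E d))
  rw [← intLattice_eq] at h
  rw [ZLattice.covolume_eq_measure_fundamentalDomain _ _ h,
    measureReal_congr (ZSpan.fundamentalDomain_ae_parallelepiped _ _), measureReal_def,
    OrthonormalBasis.coe_toBasis, OrthonormalBasis.volume_parallelepiped, ENNReal.toReal_one]

section Lattice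

variable {d : ℕ} (L : Submodule ℤ (E d))

/-- The finite group `ℤ^d / L`. -/
abbrev IntQuotient : Type :=
  (intLattice d).toAddSubgroup ⧸ L.toAddSubgroup.addSubgroupOf (intLattice d).toAddSubgroup

variable {L}

theorem natCard_intQuotient [DiscreteTopology L] [IsZLattice ℝ L] (hL : L ≤ intLattice d) :
    (Nat.card (IntQuotient L) : ℝ) = ZLattice.covolume L := by
  have h := ZLattice.covolume_div_covolume_eq_relIndex' L (intLattice d) hL
  rw [covolume_intLattice, div_one] at h
  rw [h]
  rfl

theorem finite_intQuotient [DiscreteTopology L] [IsZLattice ℝ L] (hL : L ≤ intLattice d) :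
    Finite (IntQuotient L) := by
  refine Nat.finite_of_card_ne_zero fun h => ?_
  have h1 := natCard_intQuotient hL
  rw [h, Nat.cast_zero] at h1
  exact (ZLattice.covolume_pos L volume).ne h1

/-- A representative of a class. -/
noncomputable def rep (g : IntQuotient L) : E d := (Quotient.out g : (intLattice d).toAddSubgroup)

theorem rep_mem (g : IntQuotient L) : rep g ∈ intLattice d := (Quotient.out g).2

theorem smul_rep_mem_iff (g : IntQuotient L) (k : ℕ) : k • rep g ∈ L ↔ k • g = 0 := by
  have h : g = QuotientAddGroup.mk (Quotient.out g) := (QuotientAddGroup.out_eq' g).symm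
  conv_rhs => rw [h, ← QuotientAddGroup.mk_nsmul, QuotientAddGroup.eq_zero_iff,
    AddSubgroup.mem_addSubgroupOf]
  rfl

theorem rep_sub_rep_mem_iff (g g' : IntQuotient L) : rep g - rep g' ∈ L ↔ g = g' := by
  have h : g = QuotientAddGroup.mk (Quotient.out g) := (QuotientAddGroup.out_eq' g).symm
  have h' : g' = QuotientAddGroup.mk (Quotient.out g') := (QuotientAddGroup.out_eq' g').symm
  conv_rhs => rw [h, h', eq_comm, QuotientAddGroup.eq, AddSubgroup.mem_addSubgroupOf, neg_add_eq_sub]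
  rfl

theorem exists_rep {x : E d} (hx : x ∈ intLattice d) : ∃ g : IntQuotient L, x - rep g ∈ L := by
  refine ⟨QuotientAddGroup.mk ⟨x, hx⟩, ?_⟩
  have h := QuotientAddGroup.out_eq' (QuotientAddGroup.mk ⟨x, hx⟩ : IntQuotient L)
  rw [QuotientAddGroup.eq, AddSubgroup.mem_addSubgroupOf, neg_add_eq_sub] at h
  exact h

/-- Multiplication by k embeds the k-torsion of ℤ^d/L into L/kL ≅ (ℤ/k)^d: if kx and kx' are
congruent modulo kL, then x - x' ∈ L. -/
theorem card_torsion_le (B : Module.Basis (Fin d) ℤ L) {k : ℕ}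
    (hk : k ≠ 0) : Nat.card {g : IntQuotient L // k • g = 0} ≤ k ^ d := by
  have : NeZero k := ⟨hk⟩
  have h1 : ∀ g : {g : IntQuotient L // k • g = 0}, k • rep g.1 ∈ L := fun g =>
    (smul_rep_mem_iff g.1 k).2 g.2
  let f : {g : IntQuotient L // k • g = 0} → Fin d → ZMod k := fun g i =>
    ((B.repr ⟨k • rep g.1, h1 g⟩ i : ℤ) : ZMod k)
  have hf : Function.Injective f := by
    intro g g' hgg
    have hdvd : ∀ i, ∃ c : ℤ, B.repr (⟨k • rep g.1, h1 g⟩ - ⟨k • rep g'.1, h1 g'⟩) i = k * c := by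
      intro i
      have := congrFun hgg i
      rw [eq_comm, ZMod.intCast_eq_intCast_iff_dvd_sub] at this
      rw [map_sub]
      exact this
    choose c hc using hdvd
    have h2 : (⟨k • rep g.1, h1 g⟩ - ⟨k • rep g'.1, h1 g'⟩ : L) = (k : ℤ) • ∑ i, c i • B i := by
      rw [← B.sum_repr (⟨k • rep g.1, h1 g⟩ - ⟨k • rep g'.1, h1 g'⟩ : L), smul_sum]
      exact sum_congr rfl fun i _ => by rw [hc, mul_smul]
    have h3 : (k : ℤ) • (rep g.1 - rep g'.1) = (k : ℤ) • ((∑ i, c i • B i : L) : E d) := by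
      have h4 := congrArg Subtype.val h2
      rw [Submodule.coe_smul] at h4
      rw [← h4, smul_sub, natCast_zsmul, natCast_zsmul]
      rfl
    have h5 : rep g.1 - rep g'.1 = ((∑ i, c i • B i : L) : E d) := by
      rw [← Int.cast_smul_eq_zsmul ℝ, ← Int.cast_smul_eq_zsmul ℝ] at h3
      exact smul_right_injective _ (by exact_mod_cast hk : ((k : ℤ) : ℝ) ≠ 0) h3
    refine Subtype.ext ((rep_sub_rep_mem_iff g.1 g'.1).1 ?_)
    rw [h5]
    exact Subtype.mem _
  have := Nat.card_le_card_of_injective f hf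
  simpa [Nat.card_eq_fintype_card, ZMod.card] using this

theorem mem_of_forall_dual [DiscreteTopology L] [IsZLattice ℝ L] (B : Module.Basis (Fin d) ℤ L)
    {x : E d} (h : ∀ y ∈ dualLattice L, ∃ N : ℤ, inner ℝ x y = (N : ℝ)) : x ∈ L := by
  have h1 := LinearMap.BilinForm.dualSubmodule_dualSubmodule_of_basis (R := ℤ)
    (B := innerₗ (E d)) ?_ ?_ (B.ofZLatticeBasis ℝ L)
  · rw [Module.Basis.ofZLatticeBasis_span ℝ] at h1
    rw [← h1, LinearMap.BilinForm.mem_dualSubmodule]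
    intro y hy
    obtain ⟨N, hN⟩ := h y hy
    exact Submodule.mem_one.2 ⟨N, by rw [innerₗ_apply_apply, hN]; rfl⟩
  · exact ⟨fun x hx => inner_self_eq_zero.1 (hx x), fun x hx => inner_self_eq_zero.1 (hx x)⟩
  · exact ⟨fun x y => real_inner_comm y x⟩

/-! ### The probability that a character is close to zero -/

/-- Every non-empty fibre of f has as many elements as the kernel, and kernel and range have orders
with product |G|. -/
theorem card_filter_mem_mul_card_range_le {G A : Type*} [AddCommGroup G] [Fintype G]
    [AddCommGroup A] [DecidableEq A] (f : G →+ A) (T : Finset A) :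
    #{q | f q ∈ T} * Nat.card f.range ≤ #T * Fintype.card G := by
  have h1 : #{q | f q ∈ T} ≤ Nat.card f.ker * #T := by
    refine card_le_mul_card_image_of_maps_to (f := f) (fun q hq => by simpa using hq) _
      fun t ht => ?_
    by_cases h0 : ∃ q₀, f q₀ = t
    · obtain ⟨q₀, rfl⟩ := h0
      have h2 : Nat.card f.ker = #{q | f q = 0} := by
        rw [show Nat.card f.ker = Nat.card {q // f q = 0} from rfl, Nat.card_eq_fintype_card,
          Fintype.card_subtype]
      rw [h2]
      refine card_le_card_of_injOn (fun q => q - q₀) (fun q hq => ?_)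
        fun q _ q' _ h => sub_left_injective h
      simp only [coe_filter, mem_filter, mem_univ, true_and, Set.mem_ofPred_eq] at hq ⊢
      rw [map_sub, hq.2, sub_self]
    · rw [card_eq_zero.2]
      · exact Nat.zero_le _
      · ext q
        simp only [mem_filter, mem_univ, true_and, notMem_empty, iff_false, not_and]
        exact fun _ h => h0 ⟨q, h⟩
  have h2 : Nat.card f.ker * Nat.card f.range = Fintype.card G := by
    rw [← AddSubgroup.index_ker, AddSubgroup.card_mul_index, Nat.card_eq_fintype_card]
  calc _ ≤ Nat.card f.ker * #T * Nat.card f.range := Nat.mul_le_mul_right _ h1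
    _ = #T * (Nat.card f.ker * Nat.card f.range) := by ring
    _ = _ := by rw [h2]

noncomputable instance : AddCommGroup (DualQuotient L) :=
  inferInstanceAs (AddCommGroup (↥(dualLattice L) ⧸ (intLattice d).submoduleOf (dualLattice L)))

/-- The inner product with `x`, modulo the integers. -/
noncomputable def innerMod (L : Submodule ℤ (E d)) (x : E d) : dualLattice L →ₗ[ℤ] AddCircle (1 : ℝ) :=
  ((QuotientAddGroup.mk' (AddSubgroup.zmultiples (1 : ℝ))).comp
    ((innerₗ (E d) x).toAddMonoidHom.comp (dualLattice L).subtype.toAddMonoidHom)).toIntLinearMap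

theorem innerMod_apply (x : E d) (y : dualLattice L) :
    innerMod L x y = ((inner ℝ x (y : E d) : ℝ) : AddCircle (1 : ℝ)) := rfl

theorem exists_inner_eq_int {x y : E d} (hx : x ∈ intLattice d) (hy : y ∈ intLattice d) :
    ∃ N : ℤ, inner ℝ x y = (N : ℝ) := by
  obtain ⟨a, rfl⟩ := mem_intLattice_iff.1 hx
  obtain ⟨b, rfl⟩ := mem_intLattice_iff.1 hy
  exact ⟨_, inner_intVec a b⟩

theorem coe_eq_zero_iff_int {r : ℝ} : (r : AddCircle (1 : ℝ)) = 0 ↔ ∃ N : ℤ, r = N := by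
  rw [AddCircle.coe_eq_zero_iff]
  simp [eq_comm]

/-- The character of the dual quotient that belongs to an integer vector. -/
noncomputable def dualChar {x : E d} (hx : x ∈ intLattice d) :
    DualQuotient L →+ AddCircle (1 : ℝ) :=
  (((intLattice d).submoduleOf (dualLattice L)).liftQ (innerMod L x) fun y hy => by
    rw [LinearMap.mem_ker, innerMod_apply, coe_eq_zero_iff_int]
    exact exists_inner_eq_int hx hy).toAddMonoidHom

theorem dualChar_mk {x : E d} (hx : x ∈ intLattice d) (y : dualLattice L) :
    dualChar hx (Submodule.Quotient.mk y : _ ⧸ (intLattice d).submoduleOf (dualLattice L)) =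
      ((inner ℝ x (y : E d) : ℝ) : AddCircle (1 : ℝ)) := rfl

/-- The cosets whose inner product with `x` is within `ε` of an integer. -/
def nearInt (L : Submodule ℤ (E d)) (ε : ℝ) (x : E d) : Set (DualQuotient L) :=
  {q | ∃ y ∈ q.toSet, ∃ N : ℤ, |inner ℝ x y - N| ≤ ε}

/-- Since kx ∈ L, the inner product of x with a dual vector is a multiple of 1/k. Being within ε of
an integer leaves modulo 1 only the multiples j/k with |j| ≤ εk. -/
theorem dualChar_mem_of_mem_nearInt {x : E d} (hx : x ∈ intLattice d) {k : ℕ} (hk : k ≠ 0)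
    (hkx : k • x ∈ L) {ε : ℝ} {q : DualQuotient L} (hq : q ∈ nearInt L ε x) :
    ∃ j : ℤ, |j| ≤ ⌊ε * k⌋₊ ∧ dualChar hx q = (((j : ℝ) / k : ℝ) : AddCircle (1 : ℝ)) := by
  obtain ⟨y, ⟨hy, rfl⟩, N, hN⟩ := hq
  have hk0 : (0 : ℝ) < k := by exact_mod_cast Nat.pos_of_ne_zero hk
  obtain ⟨M, hM⟩ := mem_dualLattice_iff.1 hy _ hkx
  rw [← Nat.cast_smul_eq_nsmul ℝ, inner_smul_right, real_inner_comm] at hM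
  refine ⟨M - N * k, ?_, ?_⟩
  · have h1 : |((M - N * k : ℤ) : ℝ)| ≤ ε * k := by
      push_cast
      rw [← hM, mul_comm (k : ℝ), ← sub_mul, abs_mul, abs_of_pos hk0]
      gcongr
    have h2 : ((M - N * k).natAbs : ℝ) ≤ ε * k := by
      rw [Nat.cast_natAbs]
      exact_mod_cast h1
    rw [Int.abs_eq_natAbs]
    exact_mod_cast Nat.le_floor h2
  · rw [dualChar_mk, ← sub_eq_zero, ← AddCircle.coe_sub, coe_eq_zero_iff_int]
    refine ⟨N, ?_⟩
    push_cast
    rw [← hM]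
    field_simp
    ring

/-- The order N of the range annihilates the character, so Nx has integral inner products with L^*.
By double duality Nx ∈ L, hence k divides N. -/
theorem le_card_range_dualChar [DiscreteTopology L] [IsZLattice ℝ L] [Finite (DualQuotient L)]
    (B : Module.Basis (Fin d) ℤ L) {x : E d} (hx : x ∈ intLattice d) {k : ℕ}
    (hk : ∀ j : ℕ, j • x ∈ L → k ∣ j) : k ≤ Nat.card (dualChar (L := L) hx).range := by
  have : Finite (dualChar (L := L) hx).range := Set.finite_range _
  have hpos : 0 < Nat.card (dualChar (L := L) hx).range := Nat.card_pos
  refine Nat.le_of_dvd hpos (hk _ (mem_of_forall_dual B fun y hy => ?_))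
  have h1 : Nat.card (dualChar (L := L) hx).range • dualChar (L := L) hx
      (Submodule.Quotient.mk ⟨y, hy⟩ : _ ⧸ (intLattice d).submoduleOf (dualLattice L)) = 0 := by
    exact congrArg Subtype.val (card_nsmul_eq_zero' (G := (dualChar (L := L) hx).range)
      (x := ⟨_, AddMonoidHom.mem_range.2 ⟨(Submodule.Quotient.mk ⟨y, hy⟩ :
        _ ⧸ (intLattice d).submoduleOf (dualLattice L)), rfl⟩⟩))
  rw [dualChar_mk, ← AddCircle.coe_nsmul, coe_eq_zero_iff_int] at h1
  obtain ⟨N, hN⟩ := h1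
  refine ⟨N, ?_⟩
  rw [← hN, ← Nat.cast_smul_eq_nsmul ℝ, inner_smul_left, nsmul_eq_mul]
  rfl

theorem card_nearInt_mul_le [DiscreteTopology L] [IsZLattice ℝ L] [Fintype (DualQuotient L)]
    (B : Module.Basis (Fin d) ℤ L) {x : E d} (hx : x ∈ intLattice d) {k : ℕ} (hk : k ≠ 0)
    (hkx : k • x ∈ L) (hk' : ∀ j : ℕ, j • x ∈ L → k ∣ j) (ε : ℝ) :
    Nat.card (nearInt L ε x) * k ≤ (2 * ⌊ε * k⌋₊ + 1) * Fintype.card (DualQuotient L) := by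
  classical
  let T : Finset (AddCircle (1 : ℝ)) := (Finset.Icc (-(⌊ε * k⌋₊ : ℤ)) ⌊ε * k⌋₊).image
    fun j : ℤ => (((j : ℝ) / k : ℝ) : AddCircle (1 : ℝ))
  have h1 := card_filter_mem_mul_card_range_le (dualChar (L := L) hx) T
  have h2 : #T ≤ 2 * ⌊ε * k⌋₊ + 1 := by
    refine card_image_le.trans ?_
    rw [Int.card_Icc]
    omega
  have h3 : Nat.card (nearInt L ε x) ≤ #{q | dualChar (L := L) hx q ∈ T} := by
    rw [Nat.card_eq_fintype_card, ← Set.toFinset_card]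
    refine card_le_card fun q hq => ?_
    rw [Set.mem_toFinset] at hq
    obtain ⟨j, hj, hjq⟩ := dualChar_mem_of_mem_nearInt hx hk hkx hq
    rw [mem_filter]
    exact ⟨mem_univ _, mem_image.2 ⟨j, mem_Icc.2 (abs_le.1 hj), hjq.symm⟩⟩
  calc _ ≤ #{q | dualChar (L := L) hx q ∈ T} * Nat.card (dualChar (L := L) hx).range :=
        Nat.mul_le_mul h3 (le_card_range_dualChar B hx hk')
    _ ≤ #T * Fintype.card (DualQuotient L) := h1
    _ ≤ _ := Nat.mul_le_mul_right _ h2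

end Lattice

end LLL

namespace LLL

open InnerProductSpace Finset PostProcess ProbabilityTheory

/-! ### Random cosets separate the lattice -/

section Probability

variable {d : ℕ} {L : Submodule ℤ (E d)} {Ω : Type*} [MeasurableSpace Ω] {μ : Measure Ω}

instance : DiscreteMeasurableSpace (DualQuotient L) := ⟨fun _ => trivial⟩

/-- On an infinite type `uniformOn Set.univ` is the zero measure and cannot be the law of a random
variable. Finiteness of L^*/ℤ^d thus comes from the hypothesis on the law. -/
theorem finite_of_hasLaw_uniformOn {α : Type*} [MeasurableSpace α]
    [IsProbabilityMeasure μ] {v : Ω → α} (h : HasLaw v (uniformOn Set.univ) μ) : Finite α := by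
  refine Set.finite_univ_iff.1 (finite_of_uniformOn_ne_zero (t := Set.univ) ?_)
  rw [← h.map_eq, Measure.map_apply_of_aemeasurable h.aemeasurable MeasurableSet.univ]
  simp

theorem measureReal_preimage_of_uniformOn {α : Type*} [MeasurableSpace α]
    [DiscreteMeasurableSpace α] [Fintype α] {v : Ω → α}
    (h : HasLaw v (uniformOn Set.univ) μ) (s : Set α) :
    μ.real (v ⁻¹' s) = Nat.card s / Fintype.card α := by
  classical
  have h1 := h.measureReal_eq (p := fun x => x ∈ s) (MeasurableSet.of_discrete)
  rw [show v ⁻¹' s = {ω | v ω ∈ s} from rfl, h1, measureReal_def, Set.ofPred_mem_eq, uniformOn_univ,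
    Measure.count_apply MeasurableSet.of_discrete, ENNReal.toReal_div]
  congr 1
  rw [Set.encard_eq_coe_toFinset_card, Nat.card_eq_fintype_card, Set.toFinset_card]
  simp

/-- Modulo ℤ, the inner product with a dual vector depends only on the class of a modulo L. Failure
of separation is therefore a union of finitely many events, one for each non-zero class. -/
theorem exists_mem_nearInt_of_not_separates {n : ℕ} {v : Fin n → DualQuotient L}
    (h : ¬ Separates v) :
    ∃ g : IntQuotient L, g ≠ 0 ∧ ∀ i, v i ∈ nearInt L (1 / (3 * 2 ^ d)) (rep g) := by
  unfold Separates at h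
  push Not at h
  obtain ⟨a, ha, hv⟩ := h
  obtain ⟨g, hg⟩ := exists_rep (L := L) (mem_intLattice_iff.2 ⟨a, rfl⟩)
  refine ⟨g, ?_, fun i => ?_⟩
  · rintro rfl
    have h1 : rep (0 : IntQuotient L) ∈ L := by
      have := (smul_rep_mem_iff (0 : IntQuotient L) 1).2 (smul_zero _)
      rwa [one_smul] at this
    exact ha (by simpa using L.add_mem hg h1)
  · obtain ⟨y, ⟨hy, hq⟩, N, hN⟩ := hv i
    obtain ⟨M, hM⟩ := mem_dualLattice_iff.1 hy _ hg
    refine ⟨y, ⟨hy, hq⟩, N - M, ?_⟩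
    rw [real_inner_comm, inner_sub_left] at hM
    push_cast
    rwa [← hM, show inner ℝ (rep g) y - (N - (inner ℝ (intVec a) y - inner ℝ (rep g) y)) =
      inner ℝ (intVec a) y - N by ring]

theorem addOrderOf_dvd_of_smul_rep_mem {g : IntQuotient L} (j : ℕ) (h : j • rep g ∈ L) :
    addOrderOf g ∣ j :=
  addOrderOf_dvd_of_nsmul_eq_zero ((smul_rep_mem_iff g j).1 h)

/-- For order k the probability is at most (2f + 1)/k with f = ⌊k/(3·2^d)⌋. If f = 0 this is 1/k;
otherwise 2f + 1 ≤ 3f ≤ k/2^d, which accounts for the 3 in the radius. -/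
theorem measureReal_nearInt_le [DiscreteTopology L] [IsZLattice ℝ L] [IsProbabilityMeasure μ]
    [Finite (IntQuotient L)] (B : Module.Basis (Fin d) ℤ L) {v : Ω → DualQuotient L}
    (h : HasLaw v (uniformOn Set.univ) μ) (g : IntQuotient L) :
    μ.real (v ⁻¹' nearInt L (1 / (3 * 2 ^ d)) (rep g)) ≤ max (1 / (addOrderOf g : ℝ)) (1 / 2 ^ d) := by
  have := finite_of_hasLaw_uniformOn h
  have := Fintype.ofFinite (DualQuotient L)
  have hk : 0 < addOrderOf g := addOrderOf_pos g
  obtain ⟨k, hke⟩ : ∃ k, k = addOrderOf g := ⟨_, rfl⟩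
  have h1 := card_nearInt_mul_le B (rep_mem g) hk.ne'
    ((smul_rep_mem_iff g _).2 (addOrderOf_nsmul_eq_zero g)) addOrderOf_dvd_of_smul_rep_mem
    (1 / (3 * 2 ^ d))
  rw [measureReal_preimage_of_uniformOn h]
  rw [← hke] at hk h1 ⊢
  have hk0 : (0 : ℝ) < k := by exact_mod_cast hk
  have hc0 : (0 : ℝ) < Fintype.card (DualQuotient L) := by
    exact_mod_cast Fintype.card_pos_iff.2 ⟨0⟩
  have h2 : (Nat.card (nearInt L (1 / (3 * 2 ^ d)) (rep g)) : ℝ) / Fintype.card (DualQuotient L) ≤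
      (2 * ⌊1 / (3 * 2 ^ d) * (k : ℝ)⌋₊ + 1 : ℕ) / k := by
    rw [div_le_div_iff₀ hc0 hk0]
    exact_mod_cast h1
  refine h2.trans ?_
  have hfl := Nat.floor_le (by positivity : 0 ≤ 1 / (3 * 2 ^ d) * (k : ℝ))
  generalize ⌊1 / (3 * 2 ^ d) * (k : ℝ)⌋₊ = f at hfl ⊢
  rcases Nat.eq_zero_or_pos f with rfl | hf
  · exact le_max_of_le_left (by simp)
  · refine le_max_of_le_right ?_
    have hf1 : (1 : ℝ) ≤ f := by exact_mod_cast hf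
    rw [div_le_iff₀ hk0]
    push_cast
    calc 2 * (f : ℝ) + 1 ≤ 3 * (1 / (3 * 2 ^ d) * (k : ℝ)) := by linarith
      _ = 1 / 2 ^ d * k := by field_simp

/-- The at most k^d classes of order k contribute at most k^(-4) ≤ (1/4) · 1/(k(k-1)), and these
terms telescope over k ≥ 2. -/
theorem sum_addOrderOf_le [Finite (IntQuotient L)] [Fintype (IntQuotient L)]
    [DecidableEq (IntQuotient L)] (B : Module.Basis (Fin d) ℤ L) :
    ∑ g ∈ univ.erase (0 : IntQuotient L), (1 / (addOrderOf g : ℝ)) ^ (d + 4) ≤ 1 / 4 := by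
  obtain ⟨N, hN⟩ : ∃ N, N = Fintype.card (IntQuotient L) := ⟨_, rfl⟩
  have hmaps : ∀ g ∈ univ.erase (0 : IntQuotient L), addOrderOf g ∈ Finset.Icc 2 N := by
    intro g hg
    rw [mem_Icc, hN]
    have h1 : addOrderOf g ≠ 1 := fun h => ne_of_mem_erase hg (AddMonoid.addOrderOf_eq_one_iff.1 h)
    have h2 := addOrderOf_pos g
    exact ⟨by omega, addOrderOf_le_card_univ⟩
  rw [← sum_fiberwise_of_maps_to hmaps]
  have hterm : ∀ k ∈ Finset.Icc 2 N, ∑ g ∈ univ.erase (0 : IntQuotient L) with addOrderOf g = k,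
      (1 / (addOrderOf g : ℝ)) ^ (d + 4) ≤ 1 / 4 * (1 / ((k : ℝ) - 1) - 1 / k) := by
    intro k hk
    have hk2 : 2 ≤ k := (mem_Icc.1 hk).1
    have hkr : (2 : ℝ) ≤ k := by exact_mod_cast hk2
    have hcard : #{g ∈ univ.erase (0 : IntQuotient L) | addOrderOf g = k} ≤ k ^ d := by
      refine le_trans ?_ (card_torsion_le B (by omega : k ≠ 0))
      rw [Nat.card_eq_fintype_card, Fintype.card_subtype]
      refine card_le_card fun g hg => ?_
      rw [mem_filter] at hg ⊢
      exact ⟨mem_univ _, by rw [← hg.2]; exact addOrderOf_nsmul_eq_zero g⟩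
    calc _ = ∑ g ∈ univ.erase (0 : IntQuotient L) with addOrderOf g = k,
          (1 / (k : ℝ)) ^ (d + 4) :=
          sum_congr rfl fun g hg => by rw [(mem_filter.1 hg).2]
      _ = #{g ∈ univ.erase (0 : IntQuotient L) | addOrderOf g = k} * (1 / (k : ℝ)) ^ (d + 4) := by
          rw [sum_const, nsmul_eq_mul]
      _ ≤ (k : ℝ) ^ d * (1 / (k : ℝ)) ^ (d + 4) := by
          gcongr
          exact_mod_cast hcard
      _ = 1 / (k : ℝ) ^ 2 * (1 / (k : ℝ) ^ 2) := by
          rw [div_pow, one_pow, pow_add]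
          field_simp
      _ ≤ 1 / 2 ^ 2 * (1 / (((k : ℝ) - 1) * k)) := by
          have : (0 : ℝ) < k - 1 := by linarith
          gcongr
          nlinarith
      _ = _ := by
          have : (k : ℝ) - 1 ≠ 0 := by linarith
          field_simp
          ring
  refine (sum_le_sum hterm).trans ?_
  rw [← mul_sum]
  have htel : ∀ N : ℕ, 1 ≤ N → ∑ k ∈ Finset.Icc 2 N, (1 / ((k : ℝ) - 1) - 1 / k) = 1 - 1 / N := by
    intro N hN
    induction N, hN using Nat.le_induction with
    | base => simp
    | succ n hn ih =>
      rw [sum_Icc_succ_top (by omega), ih]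
      push_cast
      rw [add_sub_cancel_right]
      ring
  rw [htel N (hN ▸ Fintype.card_pos)]
  have : (0 : ℝ) ≤ 1 / N := by positivity
  linarith

/-- Union bound over the non-zero classes. A power of the maximum is at most the sum of the powers:
the powers of 1/k sum to at most 1/4, and the powers of 2^-d to at most 2^(d²) · 2^(-d(d+4)) =
16^-d. -/
theorem measureReal_not_separates_le [DiscreteTopology L] [IsZLattice ℝ L]
    [IsProbabilityMeasure μ] (hLZ : L ≤ intLattice d) (hd : d ≠ 0)
    (hcov : ZLattice.covolume L < 2 ^ (d ^ 2)) (B : Module.Basis (Fin d) ℤ L) {n : ℕ}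
    (hn : d + 4 ≤ n) {v : Fin n → Ω → DualQuotient L}
    (hv : ∀ i, HasLaw (v i) (uniformOn Set.univ) μ) (hi : iIndepFun v μ) :
    μ.real {ω | ¬ Separates fun i => v i ω} ≤ 5 / 16 := by
  classical
  have hfin := finite_intQuotient hLZ
  have := Fintype.ofFinite (IntQuotient L)
  have hsub : {ω | ¬ Separates fun i => v i ω} ⊆ ⋃ g ∈ univ.erase (0 : IntQuotient L),
      ⋂ i ∈ (univ : Finset (Fin n)), v i ⁻¹' nearInt L (1 / (3 * 2 ^ d)) (rep g) := by
    intro ω hω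
    obtain ⟨g, hg, hgi⟩ := exists_mem_nearInt_of_not_separates hω
    simp only [Set.mem_iUnion, Set.mem_iInter]
    exact ⟨g, mem_erase.2 ⟨hg, mem_univ _⟩, fun i _ => hgi i⟩
  have hterm : ∀ g : IntQuotient L, μ.real (⋂ i ∈ (univ : Finset (Fin n)),
      v i ⁻¹' nearInt L (1 / (3 * 2 ^ d)) (rep g)) ≤
        (1 / (addOrderOf g : ℝ)) ^ (d + 4) + (1 / 2 ^ d) ^ (d + 4) := by
    intro g
    have hpos : (1 : ℝ) ≤ addOrderOf g := by exact_mod_cast addOrderOf_pos g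
    have h1 : 1 / (addOrderOf g : ℝ) ≤ 1 := by rw [div_le_one (by linarith)]; exact hpos
    have h2 : 1 / (2 : ℝ) ^ d ≤ 1 := by
      rw [div_le_one (by positivity)]; exact one_le_pow₀ (by norm_num)
    rw [measureReal_def, hi.measure_inter_preimage_eq_mul _ (fun i _ => MeasurableSet.of_discrete),
      ENNReal.toReal_prod]
    calc _ ≤ ∏ _i : Fin n, max (1 / (addOrderOf g : ℝ)) (1 / 2 ^ d) :=
          prod_le_prod (fun _ _ => ENNReal.toReal_nonneg)
            fun i _ => measureReal_nearInt_le B (hv i) g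
      _ = max (1 / (addOrderOf g : ℝ)) (1 / 2 ^ d) ^ n := by simp
      _ ≤ max (1 / (addOrderOf g : ℝ)) (1 / 2 ^ d) ^ (d + 4) :=
          pow_le_pow_of_le_one (le_max_of_le_left (by positivity)) (max_le h1 h2) hn
      _ ≤ _ := by
          rcases max_cases (1 / (addOrderOf g : ℝ)) (1 / 2 ^ d) with h | h
          · rw [h.1]; exact le_add_of_nonneg_right (by positivity)
          · rw [h.1]; exact le_add_of_nonneg_left (by positivity)
  have hcard : (Fintype.card (IntQuotient L) : ℝ) ≤ 2 ^ (d ^ 2) := by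
    rw [← Nat.card_eq_fintype_card, natCard_intQuotient hLZ]
    exact hcov.le
  calc _ ≤ μ.real (⋃ g ∈ univ.erase (0 : IntQuotient L),
        ⋂ i ∈ (univ : Finset (Fin n)), v i ⁻¹' nearInt L (1 / (3 * 2 ^ d)) (rep g)) :=
        measureReal_mono hsub (measure_ne_top _ _)
    _ ≤ ∑ g ∈ univ.erase (0 : IntQuotient L), μ.real
        (⋂ i ∈ (univ : Finset (Fin n)), v i ⁻¹' nearInt L (1 / (3 * 2 ^ d)) (rep g)) :=
        measureReal_biUnion_finset_le _ _
    _ ≤ ∑ g ∈ univ.erase (0 : IntQuotient L),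
        ((1 / (addOrderOf g : ℝ)) ^ (d + 4) + (1 / 2 ^ d) ^ (d + 4)) :=
        sum_le_sum fun g _ => hterm g
    _ = ∑ g ∈ univ.erase (0 : IntQuotient L), (1 / (addOrderOf g : ℝ)) ^ (d + 4) +
        #(univ.erase (0 : IntQuotient L)) * (1 / 2 ^ d) ^ (d + 4) := by
        rw [sum_add_distrib, sum_const, nsmul_eq_mul]
    _ ≤ 1 / 4 + 2 ^ (d ^ 2) * (1 / 2 ^ d) ^ (d + 4) := by
        gcongr
        · exact sum_addOrderOf_le B
        · refine le_trans ?_ hcard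
          exact_mod_cast card_le_univ _
    _ = 1 / 4 + 1 / 16 ^ d := by
        rw [div_pow, one_pow, ← pow_mul, mul_add, pow_add, show (16 : ℝ) = 2 ^ 4 by norm_num,
          ← pow_mul, ← sq, mul_comm 4 d]
        field_simp
    _ ≤ 1 / 4 + 1 / 16 := by
        gcongr
        exact le_self_pow₀ (by norm_num) hd
    _ = _ := by norm_num

/-- The probability that the cosets of the good runs separate the lattice and the bad runs have a
short basis. -/
theorem le_measureReal_inter [DiscreteTopology L] [IsZLattice ℝ L]
    [IsProbabilityMeasure μ] (hLZ : L ≤ intLattice d) (hd : d ≠ 0)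
    (hcov : ZLattice.covolume L < 2 ^ (d ^ 2)) (B : Module.Basis (Fin d) ℤ L) {n n' : ℕ}
    (hn : d + 4 ≤ n) {v : Fin n → Ω → DualQuotient L} {w : Fin n' → Ω → Fin d → ℚ}
    {𝓕 : Measure (Fin d → ℚ)}
    (hv : ∀ i, HasLaw (v i) (uniformOn Set.univ) μ) (hi : iIndepFun v μ)
    (hw : ∀ j, HasLaw (w j) 𝓕 μ) (hj : iIndepFun w μ)
    (hvw : IndepFun (fun ω i => v i ω) (fun ω j => w j ω) μ) {p : ℝ} (hp : 0 ≤ p)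
    {A : Set (Fin n' → Fin d → ℚ)} (hA : p ≤ (Measure.pi fun _ : Fin n' => 𝓕).real A) :
    p / 4 ≤ μ.real {ω | (Separates fun i => v i ω) ∧ (fun j => w j ω) ∈ A} := by
  have : Finite (DualQuotient L) := finite_of_hasLaw_uniformOn (hv ⟨0, by omega⟩)
  -- Both spaces are countable, so arbitrary events in them are measurable.
  have h1 := hvw.measure_inter_preimage_eq_mul {q | Separates q} A
    (Set.to_countable _).measurableSet (Set.to_countable _).measurableSet
  have h2 : μ.real ((fun ω j => w j ω) ⁻¹' A) = (Measure.pi fun _ : Fin n' => 𝓕).real A :=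
    (hj.hasLaw_pi hw).measureReal_eq (p := fun x => x ∈ A) (Set.to_countable _).measurableSet
  have h3 : 11 / 16 ≤ μ.real ((fun ω i => v i ω) ⁻¹' {q | Separates q}) := by
    have h4 := measureReal_not_separates_le hLZ hd hcov B hn hv hi
    have h5 : (1 : ℝ) ≤ μ.real ((fun ω i => v i ω) ⁻¹' {q | Separates q}) +
        μ.real {ω | ¬ Separates fun i => v i ω} := by
      rw [← probReal_univ (μ := μ)]
      refine le_trans (measureReal_mono ?_) (measureReal_union_le _ _)
      exact fun ω _ => em _
    linarith
  have h6 : μ.real {ω | (Separates fun i => v i ω) ∧ (fun j => w j ω) ∈ A} =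
      μ.real ((fun ω i => v i ω) ⁻¹' {q | Separates q}) * μ.real ((fun ω j => w j ω) ⁻¹' A) := by
    rw [measureReal_def, measureReal_def, measureReal_def, ← ENNReal.toReal_mul, ← h1]
    rfl
  rw [h6, h2]
  calc p / 4 ≤ 11 / 16 * p := by linarith
    _ ≤ _ := mul_le_mul h3 hA hp measureReal_nonneg

end Probability

end LLL

namespace LLL

open InnerProductSpace Finset PostProcess ProbabilityTheory

/-! ### The error term -/

/-- The error term. -/
noncomputable def errorTerm (K : ℝ) (d m : ℕ) : ℝ :=
  (1 + m / d) * (12 + 2 * |Real.logb 2 K| + 4 * Real.logb 2 (d + m + 1)) / (2 * d)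

theorem logb_two_nonneg {x : ℝ} (hx : 1 ≤ x) : 0 ≤ Real.logb 2 x :=
  Real.logb_nonneg (by norm_num) hx

theorem errorTerm_nonneg (K : ℝ) (d m : ℕ) : 0 ≤ errorTerm K d m := by
  have h : (0 : ℝ) ≤ Real.logb 2 (d + m + 1) :=
    logb_two_nonneg (by have : (0 : ℝ) ≤ d + m := by positivity
                        linarith)
  unfold errorTerm
  positivity

/-- For m ≤ κd the factor 1 + m/d is bounded and the logarithm is log d + O(1), so the term is O(log
d / d). -/
theorem errorTerm_eventually_lt (K κ ε : ℝ) (hε : 0 < ε) :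
    ∀ᶠ d : ℕ in Filter.atTop, ∀ m : ℕ, (m : ℝ) ≤ κ * d → |errorTerm K d m| < ε := by
  have h1 : Filter.Tendsto (fun d : ℕ => (1 + |κ|) * ((6 + |Real.logb 2 K| +
      2 * Real.logb 2 (2 + |κ|)) * (d : ℝ)⁻¹ + 2 / Real.log 2 * (Real.log d / d)))
      Filter.atTop (nhds 0) := by
    have h2 : Filter.Tendsto (fun d : ℕ => (d : ℝ)⁻¹) Filter.atTop (nhds 0) :=
      tendsto_inv_atTop_nhds_zero_nat
    have h3 : Filter.Tendsto (fun d : ℕ => Real.log d / d) Filter.atTop (nhds 0) := by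
      have := (Real.tendsto_pow_log_div_mul_add_atTop 1 0 1 one_ne_zero).comp
        (tendsto_natCast_atTop_atTop (R := ℝ))
      simpa [Function.comp_def] using this
    have := ((h2.const_mul (6 + |Real.logb 2 K| + 2 * Real.logb 2 (2 + |κ|))).add
      (h3.const_mul (2 / Real.log 2))).const_mul (1 + |κ|)
    simpa using this
  filter_upwards [h1.eventually (gt_mem_nhds hε), Filter.eventually_ge_atTop 1] with d hd hd1 m hm
  rw [abs_of_nonneg (errorTerm_nonneg K d m)]
  refine lt_of_le_of_lt ?_ hd
  have hd0 : (1 : ℝ) ≤ d := by exact_mod_cast hd1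
  have hdpos : (0 : ℝ) < d := by linarith
  have hmκ : (m : ℝ) ≤ |κ| * d := hm.trans (by gcongr; exact le_abs_self κ)
  have hmd : (m : ℝ) / d ≤ |κ| := by rwa [div_le_iff₀ hdpos]
  have hκ := abs_nonneg κ
  have hlog : Real.logb 2 (d + m + 1) ≤ Real.logb 2 (2 + |κ|) + Real.logb 2 d := by
    rw [← Real.logb_mul (by positivity) hdpos.ne']
    exact Real.logb_le_logb_of_le (by norm_num) (by positivity) (by linarith)
  calc errorTerm K d m ≤ (1 + |κ|) * (12 + 2 * |Real.logb 2 K| +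
        4 * (Real.logb 2 (2 + |κ|) + Real.logb 2 d)) / (2 * d) := by
        unfold errorTerm
        have h : (0 : ℝ) ≤ Real.logb 2 (d + m + 1) :=
          logb_two_nonneg (by have : (0 : ℝ) ≤ m := by positivity
                              linarith)
        gcongr
    _ = _ := by
        rw [Real.logb.eq_1 2 (d : ℝ)]
        field_simp
        ring

/-! ### The threshold for C -/

section Bounds

variable {d m m₁ m₂ : ℕ} {C δ S K cov : ℝ}

theorem logb_scale (hd : d ≠ 0) (hδ : δ = 2 ^ (-C * d) * √d / 2) (hS : S = δ⁻¹) :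
    0 < δ ∧ Real.logb 2 S = C * d + 1 - Real.logb 2 d / 2 := by
  have hd0 : (0 : ℝ) < d := by exact_mod_cast Nat.pos_of_ne_zero hd
  have hδ0 : 0 < δ := by rw [hδ]; positivity
  refine ⟨hδ0, ?_⟩
  rw [hS, Real.logb_inv, hδ, Real.logb_div (by positivity) (by norm_num),
    Real.logb_mul (by positivity) (by positivity), Real.logb_rpow (by norm_num) (by norm_num),
    Real.logb_self_eq_one (by norm_num), Real.sqrt_eq_rpow, Real.logb_rpow_eq_mul_logb_of_pos hd0]
  ring

theorem logb_natCast_le (d : ℕ) : Real.logb 2 d ≤ d := by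
  rcases Nat.eq_zero_or_pos d with rfl | hd
  · simp
  · rw [Real.logb_le_iff_le_rpow (by norm_num) (by exact_mod_cast hd), Real.rpow_natCast]
    exact_mod_cast Nat.lt_two_pow_self.le

theorem one_le_scale (hd : d ≠ 0)
    (hC : (5 / 2 + (m : ℝ) / (2 * d)) * (1 + (m₂ : ℝ) / d) + errorTerm K d m < C)
    (hδ : δ = 2 ^ (-C * d) * √d / 2) (hS : S = δ⁻¹) : 1 ≤ S := by
  obtain ⟨hδ0, hlog⟩ := logb_scale hd hδ hS
  have hS0 : 0 < S := by rw [hS]; positivity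
  have hC1 : 1 ≤ C := by
    have h1 := errorTerm_nonneg K d m
    have h2 : (0 : ℝ) ≤ (m : ℝ) / (2 * d) := by positivity
    have h3 : (0 : ℝ) ≤ (m₂ : ℝ) / d := by positivity
    nlinarith [mul_nonneg h2 h3]
  have h4 := logb_natCast_le d
  have hd0 : (0 : ℝ) ≤ d := by positivity
  have h5 : 0 ≤ Real.logb 2 S := by
    rw [hlog]
    nlinarith
  exact (Real.logb_nonneg_iff (by norm_num) hS0).1 h5

/-- In base-2 logarithms multiplied by r = m₂ + d, the exponent m₂/r of S leaves 2d log S on the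
right. On the left stand r(d + m) from the reduction, 2dr from the threshold, 2 log det ≤ 2d² ≤ 2dr,
and logarithmic terms. As log S is Cd up to log d, this asks for 2Cd² ≥ (5d + m)r plus lower order,
which is the condition on C. -/
theorem short_basis_bound (hd : d ≠ 0) (hm : m₂ ≤ m) (hK : 0 < K) (hcov : 0 < cov)
    (hcov' : cov < 2 ^ (d ^ 2))
    (hC : (5 / 2 + (m : ℝ) / (2 * d)) * (1 + (m₂ : ℝ) / d) + errorTerm K d m < C)
    (hδ : δ = 2 ^ (-C * d) * √d / 2) (hS : S = δ⁻¹) :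
    (d + m : ℕ) * 2 ^ (d + m) * (16 * (m + 1) * (K * √((m₂ : ℝ) + d) *
      S ^ ((m₂ : ℝ) / (m₂ + d)) * cov ^ (1 / ((m₂ : ℝ) + d))) ^ 2) ≤ (S / (16 * 2 ^ d)) ^ 2 := by
  obtain ⟨hδ0, hlog⟩ := logb_scale hd hδ hS
  have hS0 : 0 < S := by rw [hS]; positivity
  have hd0 : (1 : ℝ) ≤ d := by exact_mod_cast Nat.one_le_iff_ne_zero.2 hd
  have hm0 : (0 : ℝ) ≤ m₂ := by positivity
  have hmm : (m₂ : ℝ) ≤ m := by exact_mod_cast hm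
  obtain ⟨r, hr⟩ : ∃ r : ℝ, r = m₂ + d := ⟨_, rfl⟩
  have hr0 : 0 < r := by linarith
  have hn0 : (0 : ℝ) < (d + m : ℕ) := by push_cast; linarith
  have l16 : Real.logb 2 16 = 4 := by
    rw [show (16 : ℝ) = 2 ^ 4 by norm_num, Real.logb_pow, Real.logb_self_eq_one (by norm_num)]
    norm_num
  have l2 : ∀ k : ℕ, Real.logb 2 (2 ^ k) = k := fun k => by
    rw [Real.logb_pow, Real.logb_self_eq_one (by norm_num), mul_one]
  have hlc : Real.logb 2 cov ≤ d ^ 2 := by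
    rw [Real.logb_le_iff_le_rpow (by norm_num) hcov]
    have h := hcov'.le
    rw [← Real.rpow_natCast] at h
    exact_mod_cast h
  rw [← hr, ← Real.logb_le_logb (b := 2) (by norm_num) (by positivity) (by positivity),
    Real.logb_mul (by positivity) (by positivity), Real.logb_mul (by positivity) (by positivity),
    Real.logb_mul (by positivity) (by positivity), Real.logb_mul (by positivity) (by positivity),
    Real.logb_pow 2 (K * _ * _ * _), Real.logb_mul (by positivity) (by positivity),
    Real.logb_mul (by positivity) (by positivity),
    Real.logb_mul (by positivity) (by positivity), Real.sqrt_eq_rpow,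
    Real.logb_rpow_eq_mul_logb_of_pos hr0, Real.logb_rpow_eq_mul_logb_of_pos hS0,
    Real.logb_rpow_eq_mul_logb_of_pos hcov, Real.logb_pow 2 (S / _),
    Real.logb_div (by positivity) (by positivity), Real.logb_mul (by positivity) (by positivity),
    l16, l2, l2]
  obtain ⟨G, hG⟩ : ∃ G, G = Real.logb 2 (d + m + 1) := ⟨_, rfl⟩
  have hG0 : 0 ≤ G := by rw [hG]; exact logb_two_nonneg (by linarith)
  have hmono : ∀ x : ℝ, 0 < x → x ≤ d + m + 1 → Real.logb 2 x ≤ G := fun x hx h => by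
    rw [hG]; exact Real.logb_le_logb_of_le (by norm_num) hx h
  have g1 := hmono (d + m : ℕ) hn0 (by push_cast; linarith)
  have g2 := hmono ((m : ℝ) + 1) (by linarith) (by linarith)
  have g3 := hmono r hr0 (by linarith)
  have g4 := hmono d (by linarith) (by linarith)
  have g5 := le_abs_self (Real.logb 2 K)
  have g6 := abs_nonneg (Real.logb 2 K)
  -- The hypothesis on C, multiplied by 2d².
  have hC2 : (5 * d + m) * r + (d + m) * (12 + 2 * |Real.logb 2 K| + 4 * G) ≤ 2 * (C * d * d) := by
    have h := mul_le_mul_of_nonneg_right hC.le (by positivity : (0 : ℝ) ≤ 2 * d * d)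
    unfold errorTerm at h
    rw [← hG] at h
    calc _ = ((5 / 2 + (m : ℝ) / (2 * d)) * (1 + (m₂ : ℝ) / d) +
          (1 + m / d) * (12 + 2 * |Real.logb 2 K| + 4 * G) / (2 * d)) * (2 * d * d) := by
          rw [hr]; field_simp; ring
      _ ≤ _ := h
      _ = _ := by ring
  generalize |Real.logb 2 K| = k at *
  generalize Real.logb 2 K = lK at *
  generalize Real.logb 2 ((d + m : ℕ) : ℝ) = ln at *
  generalize Real.logb 2 ((m : ℝ) + 1) = lm at *
  generalize Real.logb 2 r = lr at *
  generalize Real.logb 2 (d : ℝ) = ld at *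
  generalize Real.logb 2 cov = lc at *
  generalize Real.logb 2 S = ls at *
  have hsum : ln + ((d + m : ℕ) : ℝ) + 12 + lm + 2 * lK + lr + 2 * d ≤
      3 * d + m + (12 + 2 * k + 3 * G) := by push_cast; linarith
  have key : r * (ln + ((d + m : ℕ) : ℝ) + 12 + lm + 2 * lK + lr + 2 * d) + 2 * lc ≤
      2 * d * ls := by
    have h1 := mul_le_mul_of_nonneg_left hsum hr0.le
    have h2 : 2 * d * ls = 2 * (C * d * d) + 2 * d - d * ld := by rw [hlog]; ring
    -- Of the four logarithms in `errorTerm`, three pay for the factors d + m, m + 1 and √r. The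
    -- fourth pays for the √d in δ.
    have h3 : d * ld ≤ d * G := mul_le_mul_of_nonneg_left g4 (by linarith)
    have h4 : r * (12 + 2 * k + 3 * G) ≤ (d + m) * (12 + 2 * k + 3 * G) :=
      mul_le_mul_of_nonneg_right (by linarith) (by linarith)
    have h5 : (d : ℝ) * d ≤ d * r := mul_le_mul_of_nonneg_left (by linarith) (by linarith)
    have h6 : (0 : ℝ) ≤ m * G := by positivity
    nlinarith
  have hfin : r * (2 * (ls - (4 + d))) - r * (ln + ((d + m : ℕ) : ℝ) + (4 + lm +
      ((2 : ℕ) : ℝ) * (lK + 1 / 2 * lr + m₂ / r * ls + 1 / r * lc))) =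
      2 * d * ls - (r * (ln + ((d + m : ℕ) : ℝ) + 12 + lm + 2 * lK + lr + 2 * d) + 2 * lc) := by
    have : (d : ℝ) = r - m₂ := by linarith
    field_simp
    push_cast
    rw [this]
    ring
  have := le_of_mul_le_mul_left (by linarith : r * (ln + ((d + m : ℕ) : ℝ) + (4 + lm +
      ((2 : ℕ) : ℝ) * (lK + 1 / 2 * lr + m₂ / r * ls + 1 / r * lc))) ≤ r * (2 * (ls - (4 + d)))) hr0
  push_cast at this ⊢
  linarith

end Bounds

theorem isBasisOf_of_dim_zero {L : Submodule ℤ (E 0)} (M : Matrix (Fin 0) (Fin 0) ℤ) :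
    IsBasisOf L M :=
  ⟨linearIndependent_empty_type, Subsingleton.elim _ _⟩

end LLL

/-! ### The main theorem -/

theorem mainTheorem4 :
    -- one polynomial-time algorithm for all lattices, distributions and parameters
    ∃ A : (x : PostProcess.Input) → Matrix (Fin x.d) (Fin x.d) ℤ, PostProcess.PolyTime A ∧
    -- for each constant `K` of the heuristic assumption there is an error term `η d m`,
    -- which is `o(1)` as `d → ∞` with `m = O(d)`
    ∀ K : ℝ, 0 < K → ∃ η : ℕ → ℕ → ℝ,
      (∀ κ ε : ℝ, 0 < ε → ∀ᶠ d : ℕ in Filter.atTop, ∀ m : ℕ, (m : ℝ) ≤ κ * d → |η d m| < ε) ∧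
    ∀ (d m m₁ m₂ : ℕ), m = m₁ + m₂ → d + 4 ≤ m₁ →
    -- the lattice, a full-rank sublattice of `ℤ^d`
    ∀ (L : Submodule ℤ (PostProcess.E d)) [DiscreteTopology L] [IsZLattice ℝ L],
      L ≤ PostProcess.intLattice d → ZLattice.covolume L < 2 ^ (d ^ 2) →
    ∀ (C δ S : ℝ),
      (5 / 2 + (m : ℝ) / (2 * d)) * (1 + (m₂ : ℝ) / d) + η d m < C →
      δ = 2 ^ (-C * d) * √d / 2 → S = δ⁻¹ →
    -- the distribution of bad runs, and the heuristic assumption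
    ∀ (𝓕 : MeasureTheory.Measure (Fin d → ℚ)) [MeasureTheory.IsProbabilityMeasure 𝓕] (p : ℝ)
      (B : Module.Basis (Fin d) ℤ L),
      PostProcess.ErrorBasisAssumption L B m₂ 𝓕 S K p →
    -- the runs: good ones are indexed by `Fin m₁` and bad ones by `Fin m₂`
    ∀ {Ω : Type*} [MeasurableSpace Ω] (μ : MeasureTheory.Measure Ω)
      [MeasureTheory.IsProbabilityMeasure μ]
      (v : Fin m₁ → Ω → PostProcess.DualQuotient L)
      (wGood : Fin m₁ → Ω → Fin d → ℚ) (wBad : Fin m₂ → Ω → Fin d → ℚ),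
      -- independent uniform cosets, independent of the independent samples from `𝓕`
      (∀ i, ProbabilityTheory.HasLaw (v i) (ProbabilityTheory.uniformOn Set.univ) μ) →
      (∀ j, ProbabilityTheory.HasLaw (wBad j) 𝓕 μ) →
      ProbabilityTheory.iIndepFun v μ →
      ProbabilityTheory.iIndepFun wBad μ →
      ProbabilityTheory.IndepFun (fun ω i => v i ω) (fun ω j => wBad j ω) μ →
      -- the vectors of good runs are at distance at most `δ` from these cosets
      (∀ i, Measurable (wGood i)) →
      (∀ i, ∀ᵐ ω ∂μ, PostProcess.torusDist (PostProcess.ratVec (wGood i ω)) (v i ω) ≤ δ) →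
    -- unknown positions of the good and the bad runs in the input of the algorithm
    ∀ (pos : Fin m₁ ⊕ Fin m₂ ≃ Fin m),
      p / 4 ≤ μ.real {ω | PostProcess.IsBasisOf L
        (A ⟨d, m, ⌊S⌋₊, fun k => Sum.elim (fun i => wGood i ω) (fun j => wBad j ω)
          (pos.symm k)⟩)} := by
  obtain ⟨A, hA, hA'⟩ := LLL.exists_polyTime_recovers
  refine ⟨A, hA, fun K hK => ⟨LLL.errorTerm K, LLL.errorTerm_eventually_lt K, ?_⟩⟩
  intro d m m₁ m₂ hm hm₁ L _ _ hLZ hcov C δ S hC hδ hS 𝓕 _ p B hp Ω _ μ _ v wGood wBad hv hw hvi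
    hwi hvw _ hdist pos
  -- The product of the two probabilities can be bounded below by p only for p ≥ 0; for negative p
  -- there is nothing to prove.
  rcases lt_or_ge p 0 with hp0 | hp0
  · exact (by linarith : p / 4 ≤ 0).trans MeasureTheory.measureReal_nonneg
  -- In dimension 0 the scale degenerates (√d = 0), but the empty matrix is always a basis.
  rcases eq_or_ne d 0 with rfl | hd
  · have h1 : p ≤ 1 := hp.trans MeasureTheory.measureReal_le_one
    refine (by linarith : p / 4 ≤ 1).trans ?_
    rw [← MeasureTheory.probReal_univ (μ := μ)]
    exact MeasureTheory.measureReal_mono fun ω _ => LLL.isBasisOf_of_dim_zero _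
  have hS1 := LLL.one_le_scale hd hC hδ hS
  have hδ0 := (LLL.logb_scale hd hδ hS).1
  have hT := LLL.short_basis_bound hd (by omega : m₂ ≤ m) hK
    (ZLattice.covolume_pos L MeasureTheory.volume) hcov hC hδ hS
  refine (LLL.le_measureReal_inter hLZ hd hcov B hm₁ hv hvi hw hwi hvw hp0 hp).trans ?_
  -- The distance bounds hold only almost surely, so the events are compared almost everywhere. This
  -- needs no measurability of the success event.
  refine ENNReal.toReal_mono (MeasureTheory.measure_ne_top _ _)
    (MeasureTheory.measure_mono_ae ?_)
  filter_upwards [MeasureTheory.ae_all_iff.2 hdist] with ω hω hsep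
  exact hA' ⟨d, m, ⌊S⌋₊, _⟩ L (LLL.recovers_of_separates hLZ hδ0 hS hS1 B hT hω hsep.1 hsep.2 pos)
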